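/- Let $q_1,q_2>0$, $Q:=\frac1{q_1}+\frac1{q_2}\in(1,2)$, let $B=(b_{ij})_{i,j=1,2}$ be a real nondegenerate matrix, and let $L_\pm:[-1,1]\to\mathbb R$ be continuous with $L_+(1)=L_-(1)$, $L_+(-1)=L_-(-1)$. Put $\rho(u)=|u_1|^{q_1}+|u_2|^{q_2}$, $L(u)=L_+(u_1/\rho(u)^{1/q_1})\mathbf 1(u_2\ge0)+L_-(u_1/\rho(u)^{1/q_1})\mathbf 1(u_2<0)$ and $a_\infty(u)=\rho(u)^{-1}L(u)$ for $u\in\mathbb R^2\setminus\{0\}$. Let $b:\mathbb Z^2\to\mathbb R$ satisfy $b(t)=\rho(Bt)^{-1}(L(Bt)+o(1))$ as $|t|\to\infty$, let $\varepsilon(s)$, $s\in\mathbb Z^2$, be i.i.d. random variables with mean $0$ and variance $1$, and let $X(t)=\sum_{s\in\mathbb Z^2}b(t-s)\varepsilon(s)$ (convergence in $L^2$), $t\in\mathbb Z^2$. For $\gamma>0$, $\lambda>0$ and $x\in\mathbb R_+^2=(0,\infty)^2$ let $$S_{\lambda,\gamma}(x)=\sum_{t\in\mathbb Z^2\cap(0,\lambda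 x_1]\times(0,\lambda^\gamma x_2]}X(t).$$ Put $\tilde Q_2=Q-\frac1{2q_2}$, $H_i=\frac12+q_i(Q-1)$ $(i=1,2)$ and $\tilde H_1=1-\frac{q_1}2(2-Q)$. Let $W$ be a real Gaussian white noise on $\mathbb R^2$ with variance the Lebesgue measure. For $2\times2$ matrices $D$ and $x\in\mathbb R^2_+$ let, with $(0,x]=(0,x_1]\times(0,x_2]$, $$V_D(x)=|\det B|^{-1}\int_{\mathbb R^2}\Big\{\int_{\mathbb R^2}a_\infty(t)\,\mathbf 1(Dt+u\in(0,x])\,dt\Big\}W(du),\qquad \tilde V_D(x)=|\det B|^{-1/2}\int_{\mathbb R^2}\Big\{\int_{(0,x]}a_\infty(Dt-u)\,dt\Big\}W(du),$$ and let $V_{01},V_{11},V_{21},V_{22}$ be $V_D$ for $D$ equal to $\frac1{\det B}$ times, respectively, $$\begin{bmatrix}b_{22}&0\\-b_{21}&0\end{bmatrix},\quad\begin{bmatrix}b_{22}&0\\0&0\end{bmatrix},\quad\begin{bmatrix}0&0\\-b_{21}&0\end{bmatrix},\quad\begin{bmatrix}0&0\\0&b_{11}\end{bmatrix},$$ and let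 $\tilde V_{00}=\tilde V_D$ for $D=\begin{bmatrix}b_{11}&0\\0&b_{22}\end{bmatrix}$. **Theorem.** Assume $q_1<q_2$ and $\tilde Q_2<1$. Then $X$ exists, the limit fields named below are well defined in the respective cases, and, for every $\gamma>0$, the finite-dimensional distributions of $\{\lambda^{-H(\gamma)}S_{\lambda,\gamma}(x),\ x\in\mathbb R_+^2\}$ converge weakly, as $\lambda\to\infty$, to those of $V^X_\gamma$, where: (i) (incongruous scaling) if $b_{21}b_{22}\ne0$, the transition point is $\gamma_0=1$: $V^X_\gamma=V_{11}$ with $H(\gamma)=H_1+\frac\gamma2$ for $\gamma>1$; $V^X_\gamma=V_{21}$ with $H(\gamma)=\frac12+\gamma H_1$ for $\gamma<1$; $V^X_\gamma=V_{01}$ with $H(1)=H_1+\frac12$ for $\gamma=1$. (ii) (congruous scaling) if $b_{21}=0$, the transition point is $\gamma_0=q_1/q_2$: $V^X_\gamma=V_{11}$ with $H(\gamma)=H_1+\frac\gamma2$ for $\gamma>\gamma_0$; $V^X_\gamma=V_{22}$ with $H(\gamma)=\frac12+\gamma H_2$ for $\gamma<\gamma_0$; $V^X_\gamma=\tilde V_{00}$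 with $H(\gamma_0)=\tilde H_1+\gamma_0$ for $\gamma=\gamma_0$. Moreover, in this case $V_{22}$ has the finite-dimensional distributions of $\sigma_{22}B_{\frac12,H_2}$, where $\sigma_{22}^2=\mathrm E|V_{22}(1,1)|^2$ and $B_{h_1,h_2}$ is the fractional Brownian sheet, i.e. the centred Gaussian field on $\mathbb R_+^2$ with covariance $\frac14\prod_{i=1}^2(x_i^{2h_i}+y_i^{2h_i}-|x_i-y_i|^{2h_i})$. -/

import Mathlib

open MeasureTheory ProbabilityTheory Filter Topology

noncomputable section

namespace LinearField

/-! ### Parameters, radial and angular functions -/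

/-- The parameters of the moving-average coefficients: the exponents `q₁`, `q₂`, the matrix `B`
and the two angular functions (used on `[-1, 1]` only). -/
structure Params where
  q₁ : ℝ
  q₂ : ℝ
  B : Matrix (Fin 2) (Fin 2) ℝ
  Lplus : ℝ → ℝ
  Lminus : ℝ → ℝ

/-- The matrix `D` applied to a point of the plane. -/
def act (D : Matrix (Fin 2) (Fin 2) ℝ) (t : ℝ × ℝ) : ℝ × ℝ :=
  (D 0 0 * t.1 + D 0 1 * t.2, D 1 0 * t.1 + D 1 1 * t.2)

/-- The half-open rectangle `(0, x] = (0, x₁] × (0, x₂]`. -/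
def rect (x : ℝ × ℝ) : Set (ℝ × ℝ) := Set.Ioc 0 x.1 ×ˢ Set.Ioc 0 x.2

/-- The open positive quadrant, the index set of the limit fields. -/
def quadrant : Set (ℝ × ℝ) := {x | 0 < x.1 ∧ 0 < x.2}

namespace Params

variable (p : Params)

/-- `Q = 1/q₁ + 1/q₂`. -/
def Q : ℝ := 1 / p.q₁ + 1 / p.q₂

/-- `Q̃₂ = Q - 1/(2 q₂)`. -/
def Qtilde₂ : ℝ := p.Q - 1 / (2 * p.q₂)

/-- `H̃₁ = 1 - (q₁/2)(2 - Q)`. -/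
def Htilde₁ : ℝ := 1 - p.q₁ / 2 * (2 - p.Q)

/-- `H₁ = 1/2 + q₁ (Q - 1)`. -/
def H₁ : ℝ := 1 / 2 + p.q₁ * (p.Q - 1)

/-- `H₂ = 1/2 + q₂ (Q - 1)`. -/
def H₂ : ℝ := 1 / 2 + p.q₂ * (p.Q - 1)

/-- The radial function `ρ(u) = |u₁|^q₁ + |u₂|^q₂`. -/
def rho (u : ℝ × ℝ) : ℝ := |u.1| ^ p.q₁ + |u.2| ^ p.q₂

/-- The angular function: `L₊(u₁/ρ(u)^(1/q₁))` if `u₂ ≥ 0`, `L₋(u₁/ρ(u)^(1/q₁))` if `u₂ < 0`. -/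
def L (u : ℝ × ℝ) : ℝ :=
  if 0 ≤ u.2 then p.Lplus (u.1 / p.rho u ^ (1 / p.q₁))
  else p.Lminus (u.1 / p.rho u ^ (1 / p.q₁))

/-- `a_∞(u) = ρ(u)⁻¹ L(u)`, for `u ≠ 0`. -/
def aInf (u : ℝ × ℝ) : ℝ := (p.rho u)⁻¹ * p.L u

end Params

/-! ### The linear random field -/

/-- The innovations are i.i.d. with mean `0` and variance `1`. -/
structure IsInnovation {Ω : Type*} [MeasurableSpace Ω] (ε : ℤ × ℤ → Ω → ℝ) (P : Measure Ω) :
    Prop where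
  indep : iIndepFun ε P
  identDistrib : ∀ s, IdentDistrib (ε s) (ε 0) P P
  memLp : MemLp (ε 0) 2 P
  mean : ∫ ω, ε 0 ω ∂P = 0
  variance : ∫ ω, ε 0 ω ^ 2 ∂P = 1

/-- The assumption on the coefficients: `b(t) = ρ(Bt)⁻¹ (L(Bt) + o(1))` as `|t| → ∞`, `t ∈ ℤ²`,
where `B` is nondegenerate, `1 < Q < 2`, and `L₊`, `L₋` are continuous on `[-1, 1]` and agree
at `±1`. No condition is put on `b(0)`. -/
structure IsCoefficient (p : Params) (b : ℤ × ℤ → ℝ) : Prop where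
  q₁_pos : 0 < p.q₁
  q₂_pos : 0 < p.q₂
  one_lt_Q : 1 < p.Q
  Q_lt_two : p.Q < 2
  det_ne_zero : p.B.det ≠ 0
  continuousOn_plus : ContinuousOn p.Lplus (Set.Icc (-1) 1)
  continuousOn_minus : ContinuousOn p.Lminus (Set.Icc (-1) 1)
  eq_one : p.Lplus 1 = p.Lminus 1
  eq_neg_one : p.Lplus (-1) = p.Lminus (-1)
  asymptotics : ∃ r : ℤ × ℤ → ℝ,
    Tendsto r (comap (fun t : ℤ × ℤ => |t.1| + |t.2|) atTop) (𝓝 0) ∧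
    ∀ t : ℤ × ℤ, t ≠ 0 →
      b t = (p.rho (act p.B ((t.1 : ℝ), (t.2 : ℝ))))⁻¹ *
        (p.L (act p.B ((t.1 : ℝ), (t.2 : ℝ))) + r t)

/-- `X(t) = ∑_{s ∈ ℤ²} b(t - s) ε(s)`, the series converging unconditionally in `L²(P)`.
This determines every `X(t)` up to a null set. -/
structure IsLinearField {Ω : Type*} [MeasurableSpace Ω] (b : ℤ × ℤ → ℝ) (ε : ℤ × ℤ → Ω → ℝ)
    (P : Measure Ω) (X : ℤ × ℤ → Ω → ℝ) : Prop where
  memLp : ∀ t, MemLp (X t) 2 P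
  tendsto : ∀ t, Tendsto
    (fun F : Finset (ℤ × ℤ) => eLpNorm (fun ω => X t ω - ∑ s ∈ F, b (t - s) * ε s ω) 2 P)
    atTop (𝓝 0)

/-- The partial sum of `X` over the integer points of `(0, lam x₁] × (0, lam^γ x₂]`. -/
def partialSum {Ω : Type*} (X : ℤ × ℤ → Ω → ℝ) (γ lam : ℝ) (x : ℝ × ℝ) (ω : Ω) : ℝ :=
  ∑ t ∈ Finset.Ioc (0 : ℤ) ⌊lam * x.1⌋ ×ˢ Finset.Ioc (0 : ℤ) ⌊lam ^ γ * x.2⌋, X t ω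

/-- Convergence of the finite-dimensional distributions of `lam^(-H) S_{lam,γ}(x)`, `x` in the
open positive quadrant, to those of the random field `V`, as `lam → ∞` through the reals. -/
def ScalesTo {Ω Ω' : Type*} [MeasurableSpace Ω] [MeasurableSpace Ω'] (P : Measure Ω)
    [IsProbabilityMeasure P] (P' : Measure Ω') [IsProbabilityMeasure P']
    (X : ℤ × ℤ → Ω → ℝ) (γ H : ℝ) (V : ℝ × ℝ → Ω' → ℝ) : Prop :=
  ∀ (n : ℕ) (x : Fin n → ℝ × ℝ), (∀ j, x j ∈ quadrant) →
    TendstoInDistribution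
      (fun (lam : ℝ) (ω : Ω) (j : Fin n) => (lam ^ H)⁻¹ * partialSum X γ lam (x j) ω)
      atTop (fun (ω' : Ω') (j : Fin n) => V (x j) ω') (fun _ => P) P'

/-! ### Gaussian white noise and the limit fields -/

/-- Real Gaussian white noise on the plane with Lebesgue control measure, given by its stochastic
integral: a linear isometry `I` from `L²(ℝ²)` to `L²(P')` with Gaussian centred values. The
noise of a Borel set `A` of finite measure is `W(A) = I(1_A)`. -/
structure WhiteNoise {Ω' : Type*} [MeasurableSpace Ω'] (P' : Measure Ω') where
  toIsometry : Lp ℝ 2 (volume : Measure (ℝ × ℝ)) →ₗᵢ[ℝ] Lp ℝ 2 P'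
  hasLaw : ∀ h, HasLaw (toIsometry h) (gaussianReal 0 (‖h‖₊ ^ 2)) P'

/-- Gaussian white noise on the plane exists. -/
theorem exists_whiteNoise : ∃ (Ω' : Type) (_ : MeasurableSpace Ω') (P' : Measure Ω'),
    IsProbabilityMeasure P' ∧ Nonempty (WhiteNoise P') := by
  classical
  obtain ⟨w, e, -⟩ := exists_hilbertBasis ℝ (Lp ℝ 2 (volume : Measure (ℝ × ℝ)))
  obtain ⟨Ω', m, P', ξ, hm, hlaw, hind, hP⟩ := exists_iid w (gaussianReal 0 1)
  refine ⟨Ω', m, P', hP, ?_⟩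
  have hG : ∀ i, HasGaussianLaw (ξ i) P' := fun i => (hlaw i).hasGaussianLaw
  have hL2 : ∀ i, MemLp (ξ i) 2 P' := fun i => (hG i).memLp_two
  have hmean : ∀ i, ∫ ω, ξ i ω ∂P' = 0 := fun i => by
    rw [(hlaw i).integral_eq]; simp
  have hvar : ∀ i, Var[ξ i; P'] = 1 := fun i => by
    rw [(hlaw i).variance_eq]; simp
  have hon : Orthonormal ℝ (fun i => (hL2 i).toLp (ξ i)) := by
    rw [orthonormal_iff_ite]
    intro i j
    rw [L2.inner_def]
    have h1 : ∫ ω, inner ℝ ((hL2 i).toLp (ξ i) ω) ((hL2 j).toLp (ξ j) ω) ∂P'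
        = ∫ ω, ξ i ω * ξ j ω ∂P' := by
      refine integral_congr_ae ?_
      filter_upwards [(hL2 i).coeFn_toLp, (hL2 j).coeFn_toLp] with ω h1 h2
      rw [h1, h2]; simp [mul_comm]
    rw [h1]
    split_ifs with hij
    · subst hij
      have := hvar i
      rw [variance_of_integral_eq_zero (hm i).aemeasurable (hmean i)] at this
      simpa [pow_two] using this
    · have := (hind.indepFun hij).integral_mul_eq_mul_integral
        (hm i).aestronglyMeasurable (hm j).aestronglyMeasurable
      simpa [hmean] using this
  let J : Lp ℝ 2 (volume : Measure (ℝ × ℝ)) →ₗᵢ[ℝ] Lp ℝ 2 P' :=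
    (hon.orthogonalFamily.linearIsometry).comp e.repr.toLinearIsometry
  have hJe : ∀ i, J (e i) = (hL2 i).toLp (ξ i) := fun i => by
    have h1 : J (e i) = hon.orthogonalFamily.linearIsometry (e.repr (e i)) := rfl
    rw [h1, e.repr_self, OrthogonalFamily.linearIsometry_apply_single]
    simp
  have key : ∀ f : w →₀ ℝ, HasLaw (J (Finsupp.linearCombination ℝ e f))
      (gaussianReal 0 (‖Finsupp.linearCombination ℝ e f‖₊ ^ 2)) P' := by
    intro f
    set h := Finsupp.linearCombination ℝ e f with hh
    have hae : (fun ω => ∑ i : f.support, f i * ξ i ω) =ᵐ[P'] J h := by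
      have h1 : J h = ∑ i ∈ f.support, f i • (hL2 i).toLp (ξ i) := by
        rw [hh, Finsupp.linearCombination_apply, Finsupp.sum, map_sum]
        simp [hJe]
      rw [h1]
      have h2 := Lp.coeFn_finsetSum f.support (fun i => f i • (hL2 i).toLp (ξ i))
      have h3 : ∀ᵐ ω ∂P', ∀ i ∈ f.support, (f i • (hL2 i).toLp (ξ i)) ω = f i * ξ i ω := by
        rw [Filter.eventually_all_finset]
        intro i _
        filter_upwards [Lp.coeFn_smul (f i) ((hL2 i).toLp (ξ i)), (hL2 i).coeFn_toLp] with ω a b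
        rw [a, Pi.smul_apply, b, smul_eq_mul]
      filter_upwards [h2, h3] with ω a b
      rw [a, Finset.sum_apply, Finset.sum_coe_sort f.support (fun i => f i * ξ i ω)]
      exact (Finset.sum_congr rfl fun i hi => (b i hi)).symm
    have hgl : HasGaussianLaw (J h) P' := by
      have h1 : iIndepFun (fun i : f.support => ξ i) P' :=
        hind.precomp Subtype.val_injective
      have h2 := iIndepFun.hasGaussianLaw (fun i : f.support => hG i) h1
      have h3 := h2.map_fun (∑ i : f.support, f i • ContinuousLinearMap.proj (R := ℝ) i)
      refine HasGaussianLaw.congr ?_ hae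
      simpa using h3
    have hmz : ∫ ω, J h ω ∂P' = 0 := by
      rw [← integral_congr_ae hae, integral_finsetSum Finset.univ
        (fun (i : f.support) _ => ((hG i).integrable.const_mul (f i)))]
      simp [integral_const_mul, hmean]
    have hv : Var[J h; P'] = ‖h‖ ^ 2 := by
      rw [variance_of_integral_eq_zero hgl.aemeasurable hmz, ← J.norm_map h,
        ← real_inner_self_eq_norm_sq, L2.inner_def]
      refine integral_congr_ae (Eventually.of_forall fun ω => ?_)
      simp [pow_two]
    refine ⟨hgl.aemeasurable, ?_⟩
    rw [hgl.map_eq_gaussianReal, hmz, hv]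
    congr 1
    ext
    simp
  refine ⟨⟨J, fun h => ?_⟩⟩
  have hdense : h ∈ closure (Set.range (Finsupp.linearCombination ℝ e)) := by
    have h1 := e.dense_span
    have h2 : h ∈ (⊤ : Submodule ℝ (Lp ℝ 2 (volume : Measure (ℝ × ℝ)))) := trivial
    rw [← h1, ← SetLike.mem_coe, Submodule.topologicalClosure_coe,
      ← Finsupp.range_linearCombination] at h2
    exact h2
  obtain ⟨g, hg, hgt⟩ := mem_closure_iff_seq_limit.1 hdense
  choose f hf using hg
  have hmeas : ∀ h, AEMeasurable (J h) P' := fun h => (Lp.aestronglyMeasurable _).aemeasurable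
  have h1 := (tendstoInMeasure_of_tendsto_Lp ((J.continuous.tendsto h).comp hgt)).tendstoInDistribution
    (fun n => hmeas (g n))
  refine ⟨hmeas h, ?_⟩
  have h2 := ProbabilityMeasure.tendsto_iff_tendsto_charFun.1 h1.tendsto
  have : IsProbabilityMeasure (P'.map (J h)) := Measure.isProbabilityMeasure_map (hmeas h)
  apply Measure.ext_of_charFun
  funext t
  refine tendsto_nhds_unique (h2 t) ?_
  have h3 : ∀ n, P'.map (J (g n)) = gaussianReal 0 (‖g n‖₊ ^ 2) := fun n => by
    rw [← hf n]; exact (key (f n)).map_eq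
  simp only [ProbabilityMeasure.coe_mk, Function.comp_apply, h3, charFun_gaussianReal]
  have h4 : Tendsto (fun n => ‖g n‖) atTop (𝓝 ‖h‖) := (continuous_norm.tendsto h).comp hgt
  have h5 : Tendsto (fun n => ((‖g n‖ : ℝ) : ℂ)) atTop (𝓝 ((‖h‖ : ℝ) : ℂ)) :=
    (Complex.continuous_ofReal.tendsto _).comp h4
  push_cast
  exact (Complex.continuous_exp.tendsto _).comp
    (tendsto_const_nhds.sub (((h5.pow 2).mul tendsto_const_nhds).div_const _))

open Classical in
/-- The stochastic integral `∫ h dW` of `h ∈ L²(ℝ²)` (set to `0` outside `L²`). -/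
def WhiteNoise.integral {Ω' : Type*} [MeasurableSpace Ω'] {P' : Measure Ω'} (W : WhiteNoise P')
    (h : ℝ × ℝ → ℝ) : Ω' → ℝ :=
  if hh : MemLp h 2 (volume : Measure (ℝ × ℝ)) then W.toIsometry (hh.toLp h) else 0

/-- The integrand of the inner integral of `V_D(x)` at `u`:
`t ↦ a_∞(t) 1(D t + u ∈ (0, x])`. -/
def innerV (p : Params) (D : Matrix (Fin 2) (Fin 2) ℝ) (x u : ℝ × ℝ) : ℝ × ℝ → ℝ :=
  Set.indicator {t | act D t + u ∈ rect x} p.aInf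

/-- The kernel of `V_D(x)`. -/
def kernelV (p : Params) (D : Matrix (Fin 2) (Fin 2) ℝ) (x u : ℝ × ℝ) : ℝ :=
  |p.B.det|⁻¹ * ∫ t, innerV p D x u t

/-- `V_D(x) = |det B|⁻¹ ∫_{ℝ²} {∫_{ℝ²} a_∞(t) 1(D t + u ∈ (0, x]) dt} W(du)`. -/
def fieldV {Ω' : Type*} [MeasurableSpace Ω'] {P' : Measure Ω'} (W : WhiteNoise P') (p : Params)
    (D : Matrix (Fin 2) (Fin 2) ℝ) (x : ℝ × ℝ) : Ω' → ℝ :=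
  W.integral (kernelV p D x)

/-- `V_D` is well defined: its inner integrals converge absolutely for almost every `u`, and its
kernels are square integrable. -/
def WellDefinedV (p : Params) (D : Matrix (Fin 2) (Fin 2) ℝ) : Prop :=
  ∀ x ∈ quadrant, (∀ᵐ u : ℝ × ℝ, Integrable (innerV p D x u)) ∧
    MemLp (kernelV p D x) 2 (volume : Measure (ℝ × ℝ))

/-- The kernel of `Ṽ_D(x)`. -/
def kernelVtilde (p : Params) (D : Matrix (Fin 2) (Fin 2) ℝ) (x u : ℝ × ℝ) : ℝ :=
  |p.B.det| ^ (-(1 / 2) : ℝ) * ∫ t in rect x, p.aInf (act D t - u)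

/-- `Ṽ_D(x) = |det B|^(-1/2) ∫_{ℝ²} {∫_{(0, x]} a_∞(D t - u) dt} W(du)`. -/
def fieldVtilde {Ω' : Type*} [MeasurableSpace Ω'] {P' : Measure Ω'} (W : WhiteNoise P')
    (p : Params) (D : Matrix (Fin 2) (Fin 2) ℝ) (x : ℝ × ℝ) : Ω' → ℝ :=
  W.integral (kernelVtilde p D x)

/-- `Ṽ_D` is well defined: its inner integrals converge absolutely for almost every `u`, and its
kernels are square integrable. -/
def WellDefinedVtilde (p : Params) (D : Matrix (Fin 2) (Fin 2) ℝ) : Prop :=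
  ∀ x ∈ quadrant,
    (∀ᵐ u : ℝ × ℝ, IntegrableOn (fun t => p.aInf (act D t - u)) (rect x)) ∧
    MemLp (kernelVtilde p D x) 2 (volume : Measure (ℝ × ℝ))

/-- `B̃₀₀`. -/
def Btilde00 (B : Matrix (Fin 2) (Fin 2) ℝ) : Matrix (Fin 2) (Fin 2) ℝ :=
  !![B 0 0, 0; 0, B 1 1]

/-- `B₀₁`. -/
def B01 (B : Matrix (Fin 2) (Fin 2) ℝ) : Matrix (Fin 2) (Fin 2) ℝ :=
  (1 / B.det) • !![B 1 1, 0; -B 1 0, 0]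

/-- `B₁₁`. -/
def B11 (B : Matrix (Fin 2) (Fin 2) ℝ) : Matrix (Fin 2) (Fin 2) ℝ :=
  (1 / B.det) • !![B 1 1, 0; 0, 0]

/-- `B₂₁`. -/
def B21 (B : Matrix (Fin 2) (Fin 2) ℝ) : Matrix (Fin 2) (Fin 2) ℝ :=
  (1 / B.det) • !![0, 0; -B 1 0, 0]

/-- `B₂₂`. -/
def B22 (B : Matrix (Fin 2) (Fin 2) ℝ) : Matrix (Fin 2) (Fin 2) ℝ :=
  (1 / B.det) • !![0, 0; 0, B 0 0]

/-! ### Fractional Brownian sheet -/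

/-- The covariance function of the fractional Brownian sheet with Hurst parameters `h₁`, `h₂`. -/
def fbsCov (h₁ h₂ : ℝ) (x y : ℝ × ℝ) : ℝ :=
  1 / 4 * (x.1 ^ (2 * h₁) + y.1 ^ (2 * h₁) - |x.1 - y.1| ^ (2 * h₁)) *
    (x.2 ^ (2 * h₂) + y.2 ^ (2 * h₂) - |x.2 - y.2| ^ (2 * h₂))

/-- `V` has the finite-dimensional distributions of `σ B_{h₁,h₂}` on the open positive quadrant:
it is a centred Gaussian field with covariance `σ²` times that of the sheet. -/
structure HasScaledFBSLaw {Ω' : Type*} [MeasurableSpace Ω'] (P' : Measure Ω')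
    (V : ℝ × ℝ → Ω' → ℝ) (σ h₁ h₂ : ℝ) : Prop where
  gaussian : IsGaussianProcess (fun x : quadrant => V x) P'
  mean : ∀ x ∈ quadrant, ∫ ω, V x ω ∂P' = 0
  covariance : ∀ x ∈ quadrant, ∀ y ∈ quadrant,
    ∫ ω, V x ω * V y ω ∂P' = σ ^ 2 * fbsCov h₁ h₂ x y

end LinearField

end

noncomputable section

namespace LinearField

/-! ### A central limit theorem for weighted sums -/

section CLT

/-! The normalised partial sum is a weighted sum `∑ c(s) ε(s)` of i.i.d. variables with
deterministic square summable weights. Such a sum is asymptotically normal with variance `lim ∑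
c(s)²` once this limit exists and the weights tend to zero uniformly
(`IsInnovation.tendsto_integral_exp`). With the Cramér-Wold device (`scalesTo_of_tendsto`) it
remains to show that the quadratic forms in the weights converge to those in the kernels of the
limit field, a deterministic question about convergence in L².

Put `s = (⌊λ u₁⌋, ⌊λ^γ u₂⌋)` and write `t - s` as the integer part of `B⁻¹ δ t`, where the dilation
`δ` multiplies `ρ` by `μ = λ^κ`. If `2H = 1 + γ + 2κ(Q - 1)`, the quadratic form in the weights is
exactly the integral of a squared combination of rescaled kernels (`IsCoefficient.coef_eq`,
`IsCoefficient.tsum_coef_sq`). Their integrand `μ b(⌊B⁻¹ δ t⌋)` tends to `a_∞(t)` by homogeneity,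
and up to rounding the box becomes the strip `D_λ t + u ∈ (0, x]`, where `D_λ` has entries
`(B⁻¹)_{ij} λ^(κ/q_j - γ_i)`, `γ₁ = 1`, `γ₂ = γ`. The regimes come from choosing `κ` so that one
nonzero entry stays constant and the others converge: `κ = q₁` for `V₁₁`, `V₀₁`, `Ṽ₀₀`, `κ = γ q₁`
for `V₂₁`, `κ = γ q₂` for `V₂₂`. If `b₂₁ = 0`, the entry with exponent `κ/q₁ - γ` vanishes, and the
transition moves from `1` to `q₁/q₂`.

Convergence of the kernels in L² (`IsScaling.tendsto_kernelLam`) is proved by cutting at `ρ = K`.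
Near the origin `1/ρ` is integrable because `Q > 1`, and dominated convergence applies. Far away
`1/ρ` is at most `K^(-η)` times a product of powers of `1 + |t₁|` and `1 + |t₂|`; the conditions `q₁
< q₂` and `Q̃₂ < 1` allow one exponent above `1/2` and the other above `1`. Cauchy-Schwarz over the
strip then makes the far part small uniformly over all matrices sharing the constant entry
(`FarControl.lintegral_sq_le`).

At `γ₀ = q₁/q₂` a linear substitution shows that `Ṽ_D` and `V_{D⁻¹}` have the same covariances. The
kernel of `V₂₂` factorises over the coordinates, and stationary increments together with
self-similarity of the second factor force the covariance of the sheet. -/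

lemma norm_prod_sub_prod_le {ι : Type*} (F : Finset ι) (a b : ι → ℂ) (ha : ∀ i ∈ F, ‖a i‖ ≤ 1)
    (hb : ∀ i ∈ F, ‖b i‖ ≤ 1) :
    ‖∏ i ∈ F, a i - ∏ i ∈ F, b i‖ ≤ ∑ i ∈ F, ‖a i - b i‖ := by
  classical
  induction F using Finset.induction_on with
  | empty => simp
  | insert j F hj ih =>
    rw [Finset.prod_insert hj, Finset.prod_insert hj, Finset.sum_insert hj]
    have h1 : a j * ∏ i ∈ F, a i - b j * ∏ i ∈ F, b i =
        (a j - b j) * ∏ i ∈ F, a i + b j * (∏ i ∈ F, a i - ∏ i ∈ F, b i) := by ring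
    have h2 : ‖∏ i ∈ F, a i‖ ≤ 1 := by
      rw [norm_prod]
      exact Finset.prod_le_one (fun _ _ => norm_nonneg _)
        fun i hi => ha i (Finset.mem_insert_of_mem hi)
    have h3 := ih (fun i hi => ha i (Finset.mem_insert_of_mem hi))
      (fun i hi => hb i (Finset.mem_insert_of_mem hi))
    have h4 := hb j (Finset.mem_insert_self _ _)
    rw [h1]
    refine (norm_add_le _ _).trans ?_
    rw [norm_mul, norm_mul]
    exact add_le_add (mul_le_of_le_one_right (norm_nonneg _) h2)
      ((mul_le_of_le_one_left (norm_nonneg _) h4).trans h3)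

variable {Ω : Type*} [MeasurableSpace Ω] {P : Measure Ω}

variable {ε : ℤ × ℤ → Ω → ℝ}

lemma IsInnovation.memLp_two (hε : IsInnovation ε P) (s : ℤ × ℤ) : MemLp (ε s) 2 P :=
  (hε.identDistrib s).memLp_iff.2 hε.memLp

lemma IsInnovation.aemeasurable (hε : IsInnovation ε P) (s : ℤ × ℤ) : AEMeasurable (ε s) P :=
  (hε.identDistrib s).aemeasurable_fst

lemma IsInnovation.aemeasurable_sum (hε : IsInnovation ε P) (c : ℤ × ℤ → ℝ)
    (F : Finset (ℤ × ℤ)) : AEMeasurable (fun ω => ∑ s ∈ F, c s * ε s ω) P :=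
  Finset.aemeasurable_fun_sum _ fun s _ => (hε.aemeasurable s).const_mul _

lemma IsInnovation.integral_exp_sum (hε : IsInnovation ε P) (c : ℤ × ℤ → ℝ)
    (F : Finset (ℤ × ℤ)) :
    ∫ ω, Complex.exp ((∑ s ∈ F, c s * ε s ω : ℝ) * Complex.I) ∂P =
      ∏ s ∈ F, charFun (P.map (ε 0)) (c s) := by
  have hm : ∀ s, AEMeasurable (fun ω => c s * ε s ω) P := fun s =>
    (hε.aemeasurable s).const_mul _
  have hind : iIndepFun (fun s ω => c s * ε s ω) P :=
    hε.indep.comp (fun s x => c s * x) fun s => measurable_const_mul _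
  have h1 := (hind.restrict F).charFun_map_fun_finsetSum_eq_prod (fun s _ => hm s)
  have h2 := congrFun h1 1
  rw [charFun_apply_real, integral_map (hε.aemeasurable_sum c F) (by fun_prop)] at h2
  simp only [Complex.ofReal_one, one_mul] at h2
  rw [h2, Finset.prod_apply]
  refine Finset.prod_congr rfl fun s _ => ?_
  rw [charFun_map_mul_comp (hε.aemeasurable s), mul_one, (hε.identDistrib s).map_eq]

variable [IsProbabilityMeasure P]

/-- Both functions have the second order expansion `1 - t²/2 + o(t²)` at zero. -/
lemma charFun_sub_exp_isLittleO {X : Ω → ℝ} (hX : AEMeasurable X P) (h0 : ∫ ω, X ω ∂P = 0)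
    (h1 : ∫ ω, X ω ^ 2 ∂P = 1) :
    (fun t : ℝ => charFun (P.map X) t - Complex.exp (-(t : ℂ) ^ 2 / 2)) =o[𝓝 0]
      fun t : ℝ => t ^ 2 := by
  have hc := taylor_charFun_two hX h0 (by simpa using h1)
  have he := (Complex.hasDerivAt_exp 0).isLittleO
  have ht : Tendsto (fun t : ℝ => -(t : ℂ) ^ 2 / 2) (𝓝 0) (𝓝 0) := by
    have : Continuous fun t : ℝ => -(t : ℂ) ^ 2 / 2 := by fun_prop
    simpa using this.tendsto 0
  have hO : ((fun x' : ℂ => x' - 0) ∘ fun t : ℝ => -(t : ℂ) ^ 2 / 2) =O[𝓝 0]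
      fun t : ℝ => t ^ 2 := by
    refine Asymptotics.IsBigO.of_bound (1 / 2) (Eventually.of_forall fun t => ?_)
    simp
    ring_nf
    exact le_rfl
  have he' := (he.comp_tendsto ht).trans_isBigO hO
  refine (hc.sub he').congr (fun t => ?_) fun _ => rfl
  simp only [Function.comp_apply, Complex.exp_zero, sub_zero, smul_eq_mul, mul_one]
  ring

/-- Since `|e^{iy} - e^{is}| ≤ |y - s|`, and the L¹ norm is at most the L² norm on a probability
space, L² approximation carries over to characteristic functions. -/
lemma norm_integral_exp_sub_le {Y S : Ω → ℝ} (hY : AEMeasurable Y P) (hS : AEMeasurable S P) :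
    ENNReal.ofReal ‖∫ ω, Complex.exp (Y ω * Complex.I) ∂P - ∫ ω, Complex.exp (S ω * Complex.I) ∂P‖
      ≤ eLpNorm (fun ω => Y ω - S ω) 2 P := by
  have hi : ∀ {Z : Ω → ℝ}, AEMeasurable Z P →
      Integrable (fun ω => Complex.exp (Z ω * Complex.I)) P := fun {Z} hZ => by
    refine Integrable.of_bound (C := 1) ?_ (Eventually.of_forall fun ω => ?_)
    · exact (Complex.measurable_exp.comp_aemeasurable
        ((Complex.measurable_ofReal.comp_aemeasurable hZ).mul_const _)).aestronglyMeasurable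
    · simp [Complex.norm_exp_ofReal_mul_I]
  rw [← integral_sub (hi hY) (hi hS), ofReal_norm]
  refine (enorm_integral_le_lintegral_enorm _).trans ?_
  refine le_trans (lintegral_mono (g := fun ω => ‖Y ω - S ω‖ₑ) fun ω => ?_) ?_
  · have h : Complex.exp (Y ω * Complex.I) - Complex.exp (S ω * Complex.I) =
        Complex.exp (S ω * Complex.I) *
          (Complex.exp (Complex.I * ((Y ω - S ω : ℝ) : ℂ)) - 1) := by
      rw [mul_sub, ← Complex.exp_add, mul_one]
      congr 2
      push_cast
      ring
    rw [h, enorm_mul]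
    have h1 : ‖Complex.exp (S ω * Complex.I)‖ₑ = 1 := by
      rw [← ofReal_norm, Complex.norm_exp_ofReal_mul_I]; simp
    rw [h1, one_mul]
    exact Real.enorm_exp_I_mul_ofReal_sub_one_le
  · rw [← eLpNorm_one_eq_lintegral_enorm]
    exact eLpNorm_le_eLpNorm_of_exponent_le (by norm_num) (hY.sub hS).aestronglyMeasurable

/-- Gaussian approximation of the characteristic function of an infinite weighted sum. -/
lemma IsInnovation.norm_integral_exp_sub_le (hε : IsInnovation ε P) {η δ : ℝ}
    (hη : ∀ t : ℝ, |t| ≤ δ →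
      ‖charFun (P.map (ε 0)) t - Complex.exp (-(t : ℂ) ^ 2 / 2)‖ ≤ η * t ^ 2)
    {c : ℤ × ℤ → ℝ} (hc : Summable fun s => c s ^ 2) (hcδ : ∀ s, |c s| ≤ δ)
    {Y : Ω → ℝ} (hY : AEMeasurable Y P)
    (hlim : Tendsto (fun F : Finset (ℤ × ℤ) => eLpNorm (fun ω => Y ω - ∑ s ∈ F, c s * ε s ω) 2 P)
      atTop (𝓝 0)) :
    ‖∫ ω, Complex.exp (Y ω * Complex.I) ∂P - Complex.exp (-((∑' s, c s ^ 2 : ℝ) : ℂ) / 2)‖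
      ≤ η * ∑' s, c s ^ 2 := by
  have h1 : Tendsto (fun F : Finset (ℤ × ℤ) =>
      ∫ ω, Complex.exp ((∑ s ∈ F, c s * ε s ω : ℝ) * Complex.I) ∂P) atTop
      (𝓝 (∫ ω, Complex.exp (Y ω * Complex.I) ∂P)) := by
    rw [tendsto_iff_norm_sub_tendsto_zero]
    have h := (ENNReal.tendsto_toReal ENNReal.zero_ne_top).comp hlim
    rw [ENNReal.toReal_zero] at h
    refine squeeze_zero' (Eventually.of_forall fun _ => norm_nonneg _) ?_ h
    have hfin : ∀ᶠ F : Finset (ℤ × ℤ) in atTop,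
        eLpNorm (fun ω => Y ω - ∑ s ∈ F, c s * ε s ω) 2 P < ⊤ :=
      hlim.eventually (gt_mem_nhds ENNReal.zero_lt_top)
    filter_upwards [hfin] with F hF
    rw [norm_sub_rev]
    exact (ENNReal.ofReal_le_iff_le_toReal hF.ne).1
      (LinearField.norm_integral_exp_sub_le hY (hε.aemeasurable_sum c F))
  have h2 : Tendsto (fun F : Finset (ℤ × ℤ) => Complex.exp (-((∑ s ∈ F, c s ^ 2 : ℝ) : ℂ) / 2))
      atTop (𝓝 (Complex.exp (-((∑' s, c s ^ 2 : ℝ) : ℂ) / 2))) := by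
    have hcont : Continuous fun x : ℝ => Complex.exp (-(x : ℂ) / 2) := by fun_prop
    exact (hcont.tendsto _).comp hc.hasSum
  refine le_of_tendsto_of_tendsto (h1.sub h2).norm (Tendsto.const_mul η hc.hasSum) ?_
  refine Eventually.of_forall fun F => ?_
  have h3 : Complex.exp (-((∑ s ∈ F, c s ^ 2 : ℝ) : ℂ) / 2) =
      ∏ s ∈ F, Complex.exp (-(c s : ℂ) ^ 2 / 2) := by
    rw [← Complex.exp_sum]
    congr 1
    push_cast
    rw [← Finset.sum_div, Finset.sum_neg_distrib]
  have : IsProbabilityMeasure (P.map (ε 0)) :=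
    Measure.isProbabilityMeasure_map (hε.aemeasurable 0)
  simp only
  rw [hε.integral_exp_sum, h3, Finset.mul_sum]
  -- Both products have factors of modulus at most one, so the difference of the products is at most
  -- the sum of the errors `η c(s)²` of the factors.
  refine (norm_prod_sub_prod_le F _ _ (fun s _ => norm_charFun_le_one _) fun s _ => ?_).trans
    (Finset.sum_le_sum fun s _ => hη _ (hcδ s))
  have : -(c s : ℂ) ^ 2 / 2 = ((-(c s) ^ 2 / 2 : ℝ) : ℂ) := by push_cast; ring
  rw [this, ← Complex.ofReal_exp, Complex.norm_real, Real.norm_eq_abs, abs_of_pos (Real.exp_pos _),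
    Real.exp_le_one_iff]
  nlinarith [sq_nonneg (c s)]

/-- A central limit theorem for infinite weighted sums of the innovations. -/
lemma IsInnovation.tendsto_integral_exp (hε : IsInnovation ε P) {ι : Type*} {l : Filter ι}
    {c : ι → ℤ × ℤ → ℝ} (hc : ∀ i, Summable fun s => c i s ^ 2) {v : ℝ}
    (hv : Tendsto (fun i => ∑' s, c i s ^ 2) l (𝓝 v))
    {δ : ι → ℝ} (hδ : Tendsto δ l (𝓝 0)) (hcδ : ∀ᶠ i in l, ∀ s, |c i s| ≤ δ i)
    {Y : ι → Ω → ℝ} (hY : ∀ i, AEMeasurable (Y i) P)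
    (hlim : ∀ i, Tendsto
      (fun F : Finset (ℤ × ℤ) => eLpNorm (fun ω => Y i ω - ∑ s ∈ F, c i s * ε s ω) 2 P)
      atTop (𝓝 0)) :
    Tendsto (fun i => ∫ ω, Complex.exp (Y i ω * Complex.I) ∂P) l
      (𝓝 (Complex.exp (-(v : ℂ) / 2))) := by
  have h2 : Tendsto (fun i => Complex.exp (-((∑' s, c i s ^ 2 : ℝ) : ℂ) / 2)) l
      (𝓝 (Complex.exp (-(v : ℂ) / 2))) := by
    have hcont : Continuous fun x : ℝ => Complex.exp (-(x : ℂ) / 2) := by fun_prop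
    exact (hcont.tendsto _).comp hv
  suffices h : Tendsto (fun i => ∫ ω, Complex.exp (Y i ω * Complex.I) ∂P -
      Complex.exp (-((∑' s, c i s ^ 2 : ℝ) : ℂ) / 2)) l (𝓝 0) by
    simpa using h.add h2
  rw [Metric.tendsto_nhds]
  intro e he
  have hv0 : ∀ᶠ i in l, ∑' s, c i s ^ 2 < |v| + 1 :=
    hv.eventually (gt_mem_nhds (by linarith [le_abs_self v]))
  -- Eventually `∑ c(s)² < |v| + 1`, so with this `η` the total error is at most `e / 2`.
  have hη : 0 < e / (2 * (|v| + 1)) := by positivity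
  have hlo := (charFun_sub_exp_isLittleO (hε.aemeasurable 0) hε.mean hε.variance).def hη
  obtain ⟨d, hd, hd'⟩ := Metric.eventually_nhds_iff.1 hlo
  have hδ' : ∀ᶠ i in l, δ i < d := hδ.eventually (gt_mem_nhds hd)
  filter_upwards [hv0, hδ', hcδ] with i h3 h4 h5
  rw [dist_zero_right]
  refine (hε.norm_integral_exp_sub_le (η := e / (2 * (|v| + 1))) (δ := δ i) ?_ (hc i) h5 (hY i)
    (hlim i)).trans_lt ?_
  · intro t ht
    have := hd' (y := t) (by rw [Real.dist_eq, sub_zero]; exact ht.trans_lt h4)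
    simpa using this
  · calc _ ≤ e / (2 * (|v| + 1)) * (|v| + 1) := by gcongr
      _ = e / 2 := by field_simp
      _ < e := by linarith

end CLT

/-! ### Existence of the linear field -/

section Existence

variable {Ω : Type*} [MeasurableSpace Ω] {P : Measure Ω} {ε : ℤ × ℤ → Ω → ℝ}

lemma IsInnovation.orthonormal (hε : IsInnovation ε P) :
    Orthonormal ℝ fun s => (hε.memLp_two s).toLp (ε s) := by
  rw [orthonormal_iff_ite]
  intro i j
  rw [L2.inner_def]
  have h1 : ∫ ω, inner ℝ ((hε.memLp_two i).toLp (ε i) ω) ((hε.memLp_two j).toLp (ε j) ω) ∂P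
      = ∫ ω, ε i ω * ε j ω ∂P := by
    refine integral_congr_ae ?_
    filter_upwards [(hε.memLp_two i).coeFn_toLp, (hε.memLp_two j).coeFn_toLp] with ω h1 h2
    rw [h1, h2]; simp [mul_comm]
  rw [h1]
  split_ifs with hij
  · subst hij
    have := ((hε.identDistrib i).comp (u := fun x : ℝ => x ^ 2) (by fun_prop)).integral_eq
    simp only [Function.comp_apply] at this
    rw [hε.variance] at this
    simpa [pow_two] using this
  · have := (hε.indep.indepFun hij).integral_mul_eq_mul_integral
      (hε.aemeasurable i).aestronglyMeasurable (hε.aemeasurable j).aestronglyMeasurable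
    simpa [(hε.identDistrib i).integral_eq, hε.mean] using this

/-- The innovations are orthonormal in L²(P), so square summability of the coefficients is what the
unconditional convergence of the series requires. -/
lemma exists_isLinearField (hε : IsInnovation ε P) {b : ℤ × ℤ → ℝ}
    (hb : Summable fun s => b s ^ 2) : ∃ X, IsLinearField b ε P X := by
  have hon := hε.orthonormal
  have hs : ∀ t, Summable fun s => b (t - s) • (hε.memLp_two s).toLp (ε s) := fun t => by
    have h1 : Summable fun s => ‖b (t - s)‖ ^ 2 := by
      simpa [Function.comp_def] using (Equiv.subLeft t).summable_iff.2 hb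
    have h2 := (hon.orthogonalFamily.summable_iff_norm_sq_summable fun s => b (t - s)).2 h1
    simpa using h2
  refine ⟨fun t => (∑' s, b (t - s) • (hε.memLp_two s).toLp (ε s) : Lp ℝ 2 P),
    fun t => Lp.memLp _, fun t => ?_⟩
  have h1 := tendsto_iff_edist_tendsto_0.1 (hs t).hasSum
  refine h1.congr fun F => ?_
  rw [edist_comm, Lp.edist_def]
  refine eLpNorm_congr_ae ?_
  have h2 := Lp.coeFn_finsetSum F (fun s => b (t - s) • (hε.memLp_two s).toLp (ε s))
  have h3 : ∀ᵐ ω ∂P, ∀ s ∈ F,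
      (b (t - s) • (hε.memLp_two s).toLp (ε s) : Lp ℝ 2 P) ω = b (t - s) * ε s ω := by
    rw [Filter.eventually_all_finset]
    intro s _
    filter_upwards [Lp.coeFn_smul (b (t - s)) ((hε.memLp_two s).toLp (ε s)),
      (hε.memLp_two s).coeFn_toLp] with ω h4 h5
    rw [h4, Pi.smul_apply, h5, smul_eq_mul]
  filter_upwards [h2, h3] with ω h4 h5
  rw [Pi.sub_apply, h4, Finset.sum_apply, Finset.sum_congr rfl h5]

end Existence

/-! ### Stochastic integrals -/

section Stochastic

variable {Ω' : Type*} [MeasurableSpace Ω'] {P' : Measure Ω'}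

lemma norm_toLp_sq {f : ℝ × ℝ → ℝ} (hf : MemLp f 2 (volume : Measure (ℝ × ℝ))) :
    ‖hf.toLp f‖ ^ 2 = ∫ u, f u ^ 2 := by
  rw [← real_inner_self_eq_norm_sq, L2.inner_def]
  refine integral_congr_ae ?_
  filter_upwards [hf.coeFn_toLp] with u hu
  simp [hu, pow_two]

lemma WhiteNoise.integral_of_memLp (W : WhiteNoise P') {h : ℝ × ℝ → ℝ}
    (hh : MemLp h 2 (volume : Measure (ℝ × ℝ))) :
    W.integral h = W.toIsometry (hh.toLp h) := by
  rw [WhiteNoise.integral, dif_pos hh]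

lemma WhiteNoise.aemeasurable_integral (W : WhiteNoise P') (h : ℝ × ℝ → ℝ) :
    AEMeasurable (W.integral h) P' := by
  rw [WhiteNoise.integral]
  split_ifs
  · exact (Lp.aestronglyMeasurable _).aemeasurable
  · exact aemeasurable_const

/-- Linearity holds only almost everywhere, because a stochastic integral is a representative of an
L² class. -/
lemma WhiteNoise.integral_sum_ae (W : WhiteNoise P') {ι : Type*} [Fintype ι]
    {K : ι → ℝ × ℝ → ℝ} (hK : ∀ j, MemLp (K j) 2 (volume : Measure (ℝ × ℝ))) (θ : ι → ℝ) :
    (fun ω => ∑ j, θ j * W.integral (K j) ω) =ᵐ[P'] W.integral (fun u => ∑ j, θ j * K j u) := by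
  have hS : MemLp (fun u => ∑ j, θ j * K j u) 2 (volume : Measure (ℝ × ℝ)) :=
    memLp_finsetSum _ fun j _ => (hK j).const_mul (θ j)
  have h1 : hS.toLp _ = ∑ j, θ j • (hK j).toLp (K j) := by
    refine Lp.ext ?_
    have h2 := Lp.coeFn_finsetSum Finset.univ (fun j => θ j • (hK j).toLp (K j))
    have h3 : ∀ᵐ u, ∀ j, (θ j • (hK j).toLp (K j) : Lp ℝ 2 _) u = θ j * K j u := by
      rw [ae_all_iff]
      intro j
      filter_upwards [Lp.coeFn_smul (θ j) ((hK j).toLp (K j)), (hK j).coeFn_toLp] with u a b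
      rw [a, Pi.smul_apply, b, smul_eq_mul]
    filter_upwards [h2, h3, hS.coeFn_toLp] with u a b c
    rw [a, c, Finset.sum_apply]
    exact Finset.sum_congr rfl fun j _ => (b j).symm
  rw [W.integral_of_memLp hS, h1, map_sum]
  have h2 := Lp.coeFn_finsetSum Finset.univ fun j => W.toIsometry (θ j • (hK j).toLp (K j))
  have h3 : ∀ᵐ ω ∂P', ∀ j, (W.toIsometry (θ j • (hK j).toLp (K j)) : Lp ℝ 2 _) ω =
      θ j * W.integral (K j) ω := by
    rw [ae_all_iff]
    intro j
    rw [map_smul]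
    filter_upwards [Lp.coeFn_smul (θ j) (W.toIsometry ((hK j).toLp (K j)))] with ω a
    rw [a, Pi.smul_apply, smul_eq_mul, W.integral_of_memLp (hK j)]
  filter_upwards [h2, h3] with ω a b
  rw [a, Finset.sum_apply]
  exact Finset.sum_congr rfl fun j _ => (b j).symm

lemma WhiteNoise.hasLaw_integral (W : WhiteNoise P') {h : ℝ × ℝ → ℝ}
    (hh : MemLp h 2 (volume : Measure (ℝ × ℝ))) :
    HasLaw (W.integral h) (gaussianReal 0 (∫ u, h u ^ 2).toNNReal) P' := by
  rw [W.integral_of_memLp hh, ← norm_toLp_sq hh]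
  have := W.hasLaw (hh.toLp h)
  convert this using 2
  rw [Real.toNNReal_pow (norm_nonneg _), norm_toNNReal]

lemma WhiteNoise.hasLaw_sum (W : WhiteNoise P') {ι : Type*} [Fintype ι]
    {K : ι → ℝ × ℝ → ℝ} (hK : ∀ j, MemLp (K j) 2 (volume : Measure (ℝ × ℝ))) (θ : ι → ℝ) :
    HasLaw (fun ω => ∑ j, θ j * W.integral (K j) ω)
      (gaussianReal 0 (∫ u, (∑ j, θ j * K j u) ^ 2).toNNReal) P' :=
  (W.hasLaw_integral (memLp_finsetSum _ fun j _ => (hK j).const_mul (θ j))).congr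
    (W.integral_sum_ae hK θ)

/-- Frequency one is enough: rescaling `θ` produces all other frequencies. The partial sums are
treated in the same way. -/
lemma WhiteNoise.integral_exp_sum (W : WhiteNoise P') {ι : Type*} [Fintype ι]
    {K : ι → ℝ × ℝ → ℝ} (hK : ∀ j, MemLp (K j) 2 (volume : Measure (ℝ × ℝ))) (θ : ι → ℝ) :
    ∫ ω, Complex.exp ((∑ j, θ j * W.integral (K j) ω : ℝ) * Complex.I) ∂P' =
      Complex.exp (-((∫ u, (∑ j, θ j * K j u) ^ 2 : ℝ) : ℂ) / 2) := by
  have hl := W.hasLaw_sum hK θ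
  have h1 := charFun_gaussianReal (μ := 0) (v := (∫ u, (∑ j, θ j * K j u) ^ 2).toNNReal) 1
  rw [← hl.map_eq, charFun_apply_real, integral_map hl.aemeasurable (by fun_prop)] at h1
  simp only [Complex.ofReal_one, one_mul] at h1
  rw [h1, Real.coe_toNNReal _ (integral_nonneg fun _ => sq_nonneg _)]
  congr 1
  simp [neg_div]

lemma WhiteNoise.integral_mul (W : WhiteNoise P') {f g : ℝ × ℝ → ℝ}
    (hf : MemLp f 2 (volume : Measure (ℝ × ℝ))) (hg : MemLp g 2 (volume : Measure (ℝ × ℝ))) :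
    ∫ ω, W.integral f ω * W.integral g ω ∂P' = ∫ u, f u * g u := by
  have h1 := W.toIsometry.inner_map_map (hf.toLp f) (hg.toLp g)
  rw [L2.inner_def, L2.inner_def] at h1
  have h2 : ∫ u, inner ℝ (hf.toLp f u) (hg.toLp g u) = ∫ u, f u * g u := by
    refine integral_congr_ae ?_
    filter_upwards [hf.coeFn_toLp, hg.coeFn_toLp] with u a b
    rw [a, b]; simp [mul_comm]
  rw [h2] at h1
  rw [← h1, W.integral_of_memLp hf, W.integral_of_memLp hg]
  simp [mul_comm]

/-- A linear functional of finitely many stochastic integrals is itself the stochastic integral of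
one kernel, hence Gaussian. -/
lemma WhiteNoise.gaussian_family (W : WhiteNoise P') {T : Type*}
    {K : T → ℝ × ℝ → ℝ} (hK : ∀ t, MemLp (K t) 2 (volume : Measure (ℝ × ℝ))) :
    IsGaussianProcess (fun t => W.integral (K t)) P' := by
  classical
  refine ⟨fun I => ⟨⟨fun L => ?_⟩⟩⟩
  have hm : AEMeasurable (fun ω => I.restrict fun t => W.integral (K t) ω) P' :=
    aemeasurable_pi_lambda _ fun t => W.aemeasurable_integral _
  have h1 : ∀ y : I → ℝ, L y = ∑ j, L (Pi.single j 1) * y j := fun y => by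
    conv_lhs => rw [← Finset.univ_sum_single y, map_sum]
    refine Finset.sum_congr rfl fun j _ => ?_
    have : (Pi.single j (y j) : I → ℝ) = y j • Pi.single j (1 : ℝ) := by
      rw [← Pi.single_smul, smul_eq_mul, mul_one]
    rw [this, map_smul, smul_eq_mul, mul_comm]
  have hl := W.hasLaw_sum (K := fun j : I => K j) (fun j => hK j) fun j => L (Pi.single j 1)
  have h2 : (P'.map fun ω => I.restrict fun t => W.integral (K t) ω).map L =
      gaussianReal 0 (∫ u, (∑ j : I, L (Pi.single j 1) * K j u) ^ 2).toNNReal := by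
    rw [AEMeasurable.map_map_of_aemeasurable (by fun_prop) hm, ← hl.map_eq]
    congr 1
    funext ω
    simp only [Function.comp_apply]
    rw [h1]
    rfl
  have h3 := h2
  rw [h2, integral_map hm (by fun_prop), variance_map (by fun_prop) hm]
  have h4 : (fun ω => L (I.restrict fun t => W.integral (K t) ω)) =
      fun ω => ∑ j : I, L (Pi.single j 1) * W.integral (K j) ω := by
    funext ω
    rw [h1]
    rfl
  have h5 : (⇑L ∘ fun ω => I.restrict fun t => W.integral (K t) ω) =
      fun ω => ∑ j : I, L (Pi.single j 1) * W.integral (K j) ω := h4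
  rw [h4, h5, hl.integral_eq, hl.variance_eq, integral_id_gaussianReal, variance_id_gaussianReal,
    Real.toNNReal_coe]

end Stochastic

/-! ### A criterion for the scaling limit -/

section Criterion

variable {Ω : Type*} [MeasurableSpace Ω] {P : Measure Ω} {ε : ℤ × ℤ → Ω → ℝ}

/-- `Y = ∑ c(s) ε(s)`, with unconditional convergence in `L²`. -/
structure IsWeightedSum (ε : ℤ × ℤ → Ω → ℝ) (P : Measure Ω) (c : ℤ × ℤ → ℝ) (Y : Ω → ℝ) :
    Prop where
  aestronglyMeasurable : AEStronglyMeasurable Y P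
  tendsto : Tendsto (fun F : Finset (ℤ × ℤ) => eLpNorm (fun ω => Y ω - ∑ s ∈ F, c s * ε s ω) 2 P)
    atTop (𝓝 0)

lemma IsWeightedSum.const_mul {c : ℤ × ℤ → ℝ} {Y : Ω → ℝ} (h : IsWeightedSum ε P c Y) (a : ℝ) :
    IsWeightedSum ε P (fun s => a * c s) fun ω => a * Y ω := by
  refine ⟨h.aestronglyMeasurable.const_mul a, ?_⟩
  have h1 := ENNReal.Tendsto.const_mul (a := ‖a‖ₑ) h.tendsto (Or.inr enorm_ne_top)
  rw [mul_zero] at h1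
  refine h1.congr fun F => ?_
  have h2 : (fun ω => a * Y ω - ∑ s ∈ F, a * c s * ε s ω) =
      a • fun ω => Y ω - ∑ s ∈ F, c s * ε s ω := by
    funext ω
    simp only [Pi.smul_apply, smul_eq_mul, mul_sub, Finset.mul_sum, mul_assoc]
  rw [h2, eLpNorm_const_smul]

lemma IsWeightedSum.sum (hε : IsInnovation ε P) {ι : Type*} (I : Finset ι)
    {c : ι → ℤ × ℤ → ℝ} {Y : ι → Ω → ℝ} (h : ∀ i ∈ I, IsWeightedSum ε P (c i) (Y i)) :
    IsWeightedSum ε P (fun s => ∑ i ∈ I, c i s) fun ω => ∑ i ∈ I, Y i ω := by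
  refine ⟨Finset.aestronglyMeasurable_fun_sum _ fun i hi => (h i hi).aestronglyMeasurable, ?_⟩
  have h1 := tendsto_finsetSum I fun i hi => (h i hi).tendsto
  rw [Finset.sum_const_zero] at h1
  refine tendsto_of_tendsto_of_tendsto_of_le_of_le tendsto_const_nhds h1 (fun _ => zero_le)
    fun F => ?_
  have h2 : (fun ω => ∑ i ∈ I, Y i ω - ∑ s ∈ F, (∑ i ∈ I, c i s) * ε s ω) =
      ∑ i ∈ I, fun ω => Y i ω - ∑ s ∈ F, c i s * ε s ω := by
    funext ω
    rw [Finset.sum_apply, Finset.sum_sub_distrib, Finset.sum_comm (s := I)]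
    simp only [Finset.sum_mul]
  simp only [h2]
  exact eLpNorm_sum_le (fun i hi => (h i hi).aestronglyMeasurable.sub
    (hε.aemeasurable_sum _ F).aestronglyMeasurable) (by norm_num)

lemma summable_sq_sum {ι α : Type*} (I : Finset ι) {f : ι → α → ℝ}
    (h : ∀ i ∈ I, Summable fun s => f i s ^ 2) : Summable fun s => (∑ i ∈ I, f i s) ^ 2 :=
  Summable.of_nonneg_of_le (fun _ => sq_nonneg _)
    (fun _ => sq_sum_le_card_mul_sum_sq) ((summable_sum h).mul_left _)

/-- The coefficient of `ε(s)` in the normalised partial sum. -/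
def coef (b : ℤ × ℤ → ℝ) (γ H lam : ℝ) (x : ℝ × ℝ) (s : ℤ × ℤ) : ℝ :=
  (lam ^ H)⁻¹ * ∑ t ∈ Finset.Ioc (0 : ℤ) ⌊lam * x.1⌋ ×ˢ Finset.Ioc (0 : ℤ) ⌊lam ^ γ * x.2⌋, b (t - s)

lemma summable_coef_sq {b : ℤ × ℤ → ℝ} (hb : Summable fun s => b s ^ 2) (γ H lam : ℝ)
    (x : ℝ × ℝ) : Summable fun s => coef b γ H lam x s ^ 2 := by
  simp only [coef, mul_pow]
  refine Summable.mul_left _ (summable_sq_sum _ fun t _ => ?_)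
  simpa [Function.comp_def] using (Equiv.subLeft t).summable_iff.2 hb

lemma IsLinearField.isWeightedSum (hε : IsInnovation ε P) {b : ℤ × ℤ → ℝ} {X : ℤ × ℤ → Ω → ℝ}
    (hX : IsLinearField b ε P X) (γ H lam : ℝ) (x : ℝ × ℝ) :
    IsWeightedSum ε P (coef b γ H lam x) fun ω => (lam ^ H)⁻¹ * partialSum X γ lam x ω :=
  (IsWeightedSum.sum hε _ fun t _ =>
    ⟨(hX.memLp t).aestronglyMeasurable, hX.tendsto t⟩).const_mul _

variable [IsProbabilityMeasure P] {Ω' : Type*} [MeasurableSpace Ω'] {P' : Measure Ω'}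
  [IsProbabilityMeasure P']

/-- Cramér-Wold device. -/
lemma tendstoInDistribution_of_integral_exp {n : ℕ} {Y : ℝ → Ω → Fin n → ℝ} {Z : Ω' → Fin n → ℝ}
    (hY : ∀ lam, AEMeasurable (Y lam) P) (hZ : AEMeasurable Z P')
    (h : ∀ θ : Fin n → ℝ, Tendsto
      (fun lam => ∫ ω, Complex.exp ((∑ j, θ j * Y lam ω j : ℝ) * Complex.I) ∂P) atTop
      (𝓝 (∫ ω, Complex.exp ((∑ j, θ j * Z ω j : ℝ) * Complex.I) ∂P'))) :
    TendstoInDistribution Y atTop Z (fun _ => P) P' := by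
  -- Characteristic functions need an inner product, so the vectors are moved to Euclidean space and
  -- moved back at the end.
  have hc : Continuous (WithLp.toLp 2 : (Fin n → ℝ) → EuclideanSpace ℝ (Fin n)) :=
    PiLp.continuous_toLp 2 _
  have hY' : ∀ lam, AEMeasurable (fun ω => WithLp.toLp 2 (Y lam ω)) P := fun lam =>
    hc.measurable.comp_aemeasurable (hY lam)
  have hZ' : AEMeasurable (fun ω => WithLp.toLp 2 (Z ω)) P' := hc.measurable.comp_aemeasurable hZ
  have key : TendstoInDistribution (fun lam ω => WithLp.toLp 2 (Y lam ω)) atTop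
      (fun ω => WithLp.toLp 2 (Z ω)) (fun _ => P) P' := by
    refine ⟨hY', hZ', ?_⟩
    -- The continuity theorem is applied along sequences, so the real parameter is first restricted
    -- to an arbitrary sequence tending to infinity.
    refine tendsto_of_seq_tendsto fun u hu => ?_
    refine ProbabilityMeasure.tendsto_of_tendsto_charFun fun t => ?_
    have h1 := (h t.ofLp).comp hu
    simp only [Function.comp_def] at h1 ⊢
    simp only [ProbabilityMeasure.coe_mk, charFun_apply]
    rw [integral_map hZ' (by fun_prop)]
    refine Tendsto.congr (fun k => ?_) (h1.trans (le_of_eq ?_))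
    · change _ = ∫ x, Complex.exp (((inner ℝ x t : ℝ) : ℂ) * Complex.I)
        ∂(P.map fun ω => WithLp.toLp 2 (Y (u k) ω))
      rw [integral_map (hY' _) (by fun_prop)]
      simp [PiLp.inner_apply]
    · simp [PiLp.inner_apply]
  have := key.continuous_comp (PiLp.continuous_ofLp 2 _)
  exact this

/-- The bridge from probability to analysis: `hvar` identifies the limiting variances, and `hsup` is
the uniform smallness of the weights that the central limit theorem needs. -/
lemma scalesTo_of_tendsto (hε : IsInnovation ε P) {b : ℤ × ℤ → ℝ}
    (hb : Summable fun s => b s ^ 2) (W : WhiteNoise P') {X : ℤ × ℤ → Ω → ℝ}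
    (hX : IsLinearField b ε P X) {γ H : ℝ} {K : ℝ × ℝ → ℝ × ℝ → ℝ}
    (hK : ∀ x ∈ quadrant, MemLp (K x) 2 (volume : Measure (ℝ × ℝ)))
    (hvar : ∀ (n : ℕ) (x : Fin n → ℝ × ℝ) (θ : Fin n → ℝ), (∀ j, x j ∈ quadrant) →
      Tendsto (fun lam => ∑' s, (∑ j, θ j * coef b γ H lam (x j) s) ^ 2) atTop
        (𝓝 (∫ u, (∑ j, θ j * K (x j) u) ^ 2)))
    (hsup : ∀ x ∈ quadrant, ∃ δ : ℝ → ℝ, Tendsto δ atTop (𝓝 0) ∧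
      ∀ᶠ lam in atTop, ∀ s, |coef b γ H lam x s| ≤ δ lam) :
    ScalesTo P P' X γ H fun x => W.integral (K x) := by
  intro n x hx
  have hw := fun lam j => hX.isWeightedSum hε γ H lam (x j)
  refine tendstoInDistribution_of_integral_exp
    (fun lam => aemeasurable_pi_lambda _ fun j => (hw lam j).aestronglyMeasurable.aemeasurable)
    (aemeasurable_pi_lambda _ fun j => W.aemeasurable_integral _) fun θ => ?_
  rw [W.integral_exp_sum (fun j => hK (x j) (hx j)) θ]
  choose δ hδ hδ' using fun j => hsup (x j) (hx j)
  have hw' := fun lam => IsWeightedSum.sum hε Finset.univ fun j _ => (hw lam j).const_mul (θ j)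
  refine hε.tendsto_integral_exp (δ := fun lam => ∑ j, |θ j| * δ j lam)
    (fun lam => summable_sq_sum _ fun j _ => ?_) (hvar n x θ hx) ?_ ?_
    (fun lam => (hw' lam).aestronglyMeasurable.aemeasurable) (fun lam => (hw' lam).tendsto)
  · simp only [mul_pow]
    exact (summable_coef_sq hb γ H lam (x j)).mul_left _
  · have := tendsto_finsetSum Finset.univ fun j _ => (hδ j).const_mul |θ j|
    simpa using this
  · filter_upwards [eventually_all.2 hδ'] with lam h s
    refine (Finset.abs_sum_le_sum_abs _ _).trans (Finset.sum_le_sum fun j _ => ?_)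
    rw [abs_mul]
    exact mul_le_mul_of_nonneg_left (h j s) (abs_nonneg _)

end Criterion

/-! ### Changes of variables in the plane -/

section Plane

/-- `act D` as a linear map. -/
def actLin (D : Matrix (Fin 2) (Fin 2) ℝ) : ℝ × ℝ →ₗ[ℝ] ℝ × ℝ where
  toFun := act D
  map_add' u v := by simp only [act, Prod.fst_add, Prod.snd_add, Prod.mk_add_mk]; ext <;> simp <;> ring
  map_smul' c u := by simp only [act, Prod.smul_fst, Prod.smul_snd, smul_eq_mul, RingHom.id_apply, Prod.smul_mk]; ext <;> simp <;> ring

lemma det_actLin (D : Matrix (Fin 2) (Fin 2) ℝ) : LinearMap.det (actLin D) = D.det := by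
  rw [← LinearMap.det_toMatrix (Module.Basis.finTwoProd ℝ)]
  congr 1
  ext i j
  fin_cases i <;> fin_cases j <;> simp [LinearMap.toMatrix_apply, actLin, act]

lemma continuous_act (D : Matrix (Fin 2) (Fin 2) ℝ) : Continuous (act D) := by
  unfold act; fun_prop

lemma measurable_act (D : Matrix (Fin 2) (Fin 2) ℝ) : Measurable (act D) :=
  (continuous_act D).measurable

lemma act_mul (A D : Matrix (Fin 2) (Fin 2) ℝ) (t : ℝ × ℝ) : act (A * D) t = act A (act D t) := by
  simp only [act, Matrix.mul_apply, Fin.sum_univ_two]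
  ext <;> simp <;> ring

lemma act_one (t : ℝ × ℝ) : act 1 t = t := by simp [act]

lemma act_add (D : Matrix (Fin 2) (Fin 2) ℝ) (t u : ℝ × ℝ) : act D (t + u) = act D t + act D u :=
  (actLin D).map_add t u

lemma act_sub (D : Matrix (Fin 2) (Fin 2) ℝ) (t u : ℝ × ℝ) : act D (t - u) = act D t - act D u :=
  (actLin D).map_sub t u

lemma act_inv_act {D : Matrix (Fin 2) (Fin 2) ℝ} (hD : D.det ≠ 0) (t : ℝ × ℝ) :
    act D⁻¹ (act D t) = t := by
  rw [← act_mul, Matrix.nonsing_inv_mul _ (Ne.isUnit hD), act_one]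

lemma act_act_inv {D : Matrix (Fin 2) (Fin 2) ℝ} (hD : D.det ≠ 0) (t : ℝ × ℝ) :
    act D (act D⁻¹ t) = t := by
  rw [← act_mul, Matrix.mul_nonsing_inv _ (Ne.isUnit hD), act_one]

lemma map_act_volume {D : Matrix (Fin 2) (Fin 2) ℝ} (hD : D.det ≠ 0) :
    (volume : Measure (ℝ × ℝ)).map (act D) = ENNReal.ofReal |D.det|⁻¹ • volume := by
  have h := Measure.map_linearMap_addHaar_eq_smul_addHaar (volume : Measure (ℝ × ℝ))
    (f := actLin D) (by rwa [det_actLin])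
  rw [det_actLin, abs_inv] at h
  exact h

lemma measurableEmbedding_act {D : Matrix (Fin 2) (Fin 2) ℝ} (hD : D.det ≠ 0) :
    MeasurableEmbedding (act D) := by
  refine MeasurableEquiv.measurableEmbedding
    ⟨⟨act D, act D⁻¹, act_inv_act hD, act_act_inv hD⟩, measurable_act D, measurable_act _⟩

lemma lintegral_act {D : Matrix (Fin 2) (Fin 2) ℝ} (hD : D.det ≠ 0) (f : ℝ × ℝ → ENNReal) :
    ∫⁻ t, f (act D t) = ENNReal.ofReal |D.det|⁻¹ * ∫⁻ t, f t := by
  rw [← (measurableEmbedding_act hD).lintegral_map, map_act_volume hD, lintegral_smul_measure,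
    smul_eq_mul]

lemma integral_act {D : Matrix (Fin 2) (Fin 2) ℝ} (hD : D.det ≠ 0) (f : ℝ × ℝ → ℝ) :
    ∫ t, f (act D t) = |D.det|⁻¹ * ∫ t, f t := by
  rw [← (measurableEmbedding_act hD).integral_map, map_act_volume hD, integral_smul_measure,
    smul_eq_mul, ENNReal.toReal_ofReal (by positivity)]

lemma integrable_act_iff {D : Matrix (Fin 2) (Fin 2) ℝ} (hD : D.det ≠ 0) {f : ℝ × ℝ → ℝ} :
    Integrable (fun t => f (act D t)) ↔ Integrable f := by
  have h := (measurableEmbedding_act hD).integrable_map_iff (g := f) (μ := volume)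
  rw [map_act_volume hD, integrable_smul_measure (by simpa using hD) (by simp)] at h
  exact h.symm

lemma memLp_act {D : Matrix (Fin 2) (Fin 2) ℝ} (hD : D.det ≠ 0) {f : ℝ × ℝ → ℝ}
    (hf : MemLp f 2 (volume : Measure (ℝ × ℝ))) :
    MemLp (fun t => f (act D t)) 2 (volume : Measure (ℝ × ℝ)) := by
  refine MemLp.comp_of_map ?_ (measurable_act D).aemeasurable
  rw [map_act_volume hD]
  exact hf.smul_measure (by simp)

/-- Coordinatewise integer part. -/
def floorPair (t : ℝ × ℝ) : ℤ × ℤ := (⌊t.1⌋, ⌊t.2⌋)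

lemma measurable_floorPair : Measurable floorPair :=
  (Int.measurable_floor.comp measurable_fst).prodMk (Int.measurable_floor.comp measurable_snd)

/-- Each integer cell has unit area. This turns lattice sums into integrals of step functions, to
which linear changes of variables apply. -/
lemma map_floorPair_volume : (volume : Measure (ℝ × ℝ)).map floorPair = Measure.count := by
  refine Measure.ext_of_singleton fun s => ?_
  rw [Measure.map_apply measurable_floorPair (measurableSet_singleton s),
    Measure.count_singleton]
  have : floorPair ⁻¹' {s} = Set.Ico (s.1 : ℝ) (s.1 + 1) ×ˢ Set.Ico (s.2 : ℝ) (s.2 + 1) := by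
    ext t
    simp only [floorPair, Set.mem_preimage, Set.mem_singleton_iff, Prod.ext_iff, Int.floor_eq_iff,
      Set.mem_prod, Set.mem_Ico]
  rw [this, Measure.volume_eq_prod, Measure.prod_prod]
  simp

lemma lintegral_floorPair (F : ℤ × ℤ → ENNReal) : ∫⁻ t, F (floorPair t) = ∑' s, F s := by
  rw [← lintegral_map (measurable_of_countable F) measurable_floorPair, map_floorPair_volume,
    lintegral_count]

lemma integral_floorPair {F : ℤ × ℤ → ℝ} (hF : Summable F) :
    ∫ t, F (floorPair t) = ∑' s, F s := by
  have h1 : Integrable F Measure.count := by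
    rw [integrable_count_iff]
    simpa using hF.norm
  rw [← integral_map measurable_floorPair.aemeasurable
    (measurable_of_countable F).aestronglyMeasurable, map_floorPair_volume, integral_countable h1]
  simp [Measure.real]

end Plane

/-! ### Homogeneity and bounds for the coefficients -/

namespace Params

/-- The anisotropic dilation under which `ρ` is homogeneous of degree one. -/
def dil (p : Params) (μ : ℝ) (t : ℝ × ℝ) : ℝ × ℝ :=
  (μ ^ (1 / p.q₁) * t.1, μ ^ (1 / p.q₂) * t.2)

variable {p : Params}

lemma rho_nonneg (p : Params) (u : ℝ × ℝ) : 0 ≤ p.rho u := by unfold rho; positivity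

lemma abs_fst_rpow_le_rho (p : Params) (u : ℝ × ℝ) : |u.1| ^ p.q₁ ≤ p.rho u := by
  unfold rho
  linarith [Real.rpow_nonneg (abs_nonneg u.2) p.q₂]

lemma abs_snd_rpow_le_rho (p : Params) (u : ℝ × ℝ) : |u.2| ^ p.q₂ ≤ p.rho u := by
  unfold rho
  linarith [Real.rpow_nonneg (abs_nonneg u.1) p.q₁]

lemma abs_fst_le_rho_rpow (h₁ : 0 < p.q₁) (u : ℝ × ℝ) : |u.1| ≤ p.rho u ^ (1 / p.q₁) := by
  have h := Real.rpow_le_rpow (by positivity) (p.abs_fst_rpow_le_rho u) (z := 1 / p.q₁)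
    (by positivity)
  rwa [← Real.rpow_mul (abs_nonneg _), mul_one_div_cancel h₁.ne', Real.rpow_one] at h

lemma abs_snd_le_rho_rpow (h₂ : 0 < p.q₂) (u : ℝ × ℝ) : |u.2| ≤ p.rho u ^ (1 / p.q₂) := by
  have h := Real.rpow_le_rpow (by positivity) (p.abs_snd_rpow_le_rho u) (z := 1 / p.q₂)
    (by positivity)
  rwa [← Real.rpow_mul (abs_nonneg _), mul_one_div_cancel h₂.ne', Real.rpow_one] at h

lemma rho_pos_of_snd_ne_zero {u : ℝ × ℝ} (hu : u.2 ≠ 0) : 0 < p.rho u :=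
  (Real.rpow_pos_of_pos (abs_pos.2 hu) _).trans_le (p.abs_snd_rpow_le_rho u)

lemma continuous_rho (h₁ : 0 < p.q₁) (h₂ : 0 < p.q₂) : Continuous p.rho := by
  unfold rho
  exact (continuous_fst.abs.rpow_const fun _ => Or.inr h₁.le).add
    (continuous_snd.abs.rpow_const fun _ => Or.inr h₂.le)

lemma rho_dil (h₁ : 0 < p.q₁) (h₂ : 0 < p.q₂) {μ : ℝ} (hμ : 0 < μ) (t : ℝ × ℝ) :
    p.rho (p.dil μ t) = μ * p.rho t := by
  unfold rho dil
  simp only [abs_mul, abs_of_pos (Real.rpow_pos_of_pos hμ _)]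
  rw [Real.mul_rpow (by positivity) (abs_nonneg _), Real.mul_rpow (by positivity) (abs_nonneg _),
    ← Real.rpow_mul hμ.le, ← Real.rpow_mul hμ.le, one_div_mul_cancel h₁.ne',
    one_div_mul_cancel h₂.ne', Real.rpow_one]
  ring

lemma L_dil (h₁ : 0 < p.q₁) (h₂ : 0 < p.q₂) {μ : ℝ} (hμ : 0 < μ) (t : ℝ × ℝ) :
    p.L (p.dil μ t) = p.L t := by
  have h : (p.dil μ t).1 / p.rho (p.dil μ t) ^ (1 / p.q₁) = t.1 / p.rho t ^ (1 / p.q₁) := by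
    rw [rho_dil h₁ h₂ hμ, Real.mul_rpow hμ.le (p.rho_nonneg t)]
    exact mul_div_mul_left _ _ (Real.rpow_pos_of_pos hμ _).ne'
  have h' : 0 ≤ (p.dil μ t).2 ↔ 0 ≤ t.2 := mul_nonneg_iff_of_pos_left (Real.rpow_pos_of_pos hμ _)
  unfold L
  simp only [h, h']

lemma aInf_dil (h₁ : 0 < p.q₁) (h₂ : 0 < p.q₂) {μ : ℝ} (hμ : 0 < μ) (t : ℝ × ℝ) :
    p.aInf (p.dil μ t) = μ⁻¹ * p.aInf t := by
  unfold aInf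
  rw [rho_dil h₁ h₂ hμ, L_dil h₁ h₂ hμ, mul_inv, mul_assoc]

lemma angle_mem_Icc (h₁ : 0 < p.q₁) (u : ℝ × ℝ) :
    u.1 / p.rho u ^ (1 / p.q₁) ∈ Set.Icc (-1 : ℝ) 1 := by
  rw [Set.mem_Icc, ← abs_le, abs_div, abs_of_nonneg (Real.rpow_nonneg (p.rho_nonneg u) _)]
  exact div_le_one_of_le₀ (abs_fst_le_rho_rpow h₁ u) (Real.rpow_nonneg (p.rho_nonneg u) _)

/-- A quasi-triangle inequality, from `|a + b| ≤ 2 max(|a|, |b|)` in each coordinate; it covers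
exponents below and above one alike. -/
lemma rho_add_le (h₁ : 0 < p.q₁) (h₂ : 0 < p.q₂) (u v : ℝ × ℝ) :
    p.rho (u + v) ≤ (2 ^ p.q₁ + 2 ^ p.q₂) * (p.rho u + p.rho v) := by
  have key : ∀ {q : ℝ}, 0 < q → ∀ a b : ℝ, |a + b| ^ q ≤ 2 ^ q * (|a| ^ q + |b| ^ q) := by
    intro q hq a b
    have h1 : |a + b| ≤ 2 * max |a| |b| :=
      (abs_add_le a b).trans (by linarith [le_max_left |a| |b|, le_max_right |a| |b|])
    refine (Real.rpow_le_rpow (abs_nonneg _) h1 hq.le).trans ?_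
    rw [Real.mul_rpow (by norm_num) (by positivity)]
    gcongr
    rcases max_choice |a| |b| with h | h <;> rw [h]
    · linarith [Real.rpow_nonneg (abs_nonneg b) q]
    · linarith [Real.rpow_nonneg (abs_nonneg a) q]
  have h3 := key h₁ u.1 v.1
  have h4 := key h₂ u.2 v.2
  have p1 := Real.rpow_nonneg (abs_nonneg u.1) p.q₁
  have p2 := Real.rpow_nonneg (abs_nonneg v.1) p.q₁
  have p3 := Real.rpow_nonneg (abs_nonneg u.2) p.q₂
  have p4 := Real.rpow_nonneg (abs_nonneg v.2) p.q₂
  have p5 : (0 : ℝ) ≤ 2 ^ p.q₁ := by positivity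
  have p6 : (0 : ℝ) ≤ 2 ^ p.q₂ := by positivity
  simp only [rho, Prod.fst_add, Prod.snd_add]
  nlinarith [mul_nonneg p5 (add_nonneg p3 p4), mul_nonneg p6 (add_nonneg p1 p2)]

lemma measurable_rho (h₁ : 0 < p.q₁) (h₂ : 0 < p.q₂) : Measurable p.rho :=
  (continuous_rho h₁ h₂).measurable

end Params

section Coefficient

open Params

variable {p : Params} {b : ℤ × ℤ → ℝ}

/-- Real version of an integer point. -/
def toReal (n : ℤ × ℤ) : ℝ × ℝ := ((n.1 : ℝ), (n.2 : ℝ))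

lemma IsCoefficient.exists_abs_L_le (hb : IsCoefficient p b) : ∃ M, 0 ≤ M ∧ ∀ u, |p.L u| ≤ M := by
  obtain ⟨M₁, h1⟩ := isCompact_Icc.exists_bound_of_continuousOn hb.continuousOn_plus
  obtain ⟨M₂, h2⟩ := isCompact_Icc.exists_bound_of_continuousOn hb.continuousOn_minus
  refine ⟨max 0 (max M₁ M₂), le_max_left _ _, fun u => ?_⟩
  have hu := angle_mem_Icc hb.q₁_pos u
  unfold L
  split_ifs
  · exact (h1 _ hu).trans ((le_max_left _ _).trans (le_max_right _ _))
  · exact (h2 _ hu).trans ((le_max_right _ _).trans (le_max_right _ _))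

lemma IsCoefficient.measurable_L (hb : IsCoefficient p b) : Measurable p.L := by
  have hang : Measurable fun u : ℝ × ℝ => u.1 / p.rho u ^ (1 / p.q₁) :=
    measurable_fst.div ((measurable_rho hb.q₁_pos hb.q₂_pos).pow_const _)
  have hm : ∀ {f : ℝ → ℝ}, ContinuousOn f (Set.Icc (-1) 1) →
      Measurable fun u : ℝ × ℝ => f (u.1 / p.rho u ^ (1 / p.q₁)) := fun {f} hf => by
    -- The angular functions are controlled on `[-1, 1]` only, so they are extended by their
    -- endpoint values; the angle never leaves this interval.
    have h1 : Continuous (Set.IccExtend (by norm_num : (-1 : ℝ) ≤ 1) ((Set.Icc (-1) 1).domRestrict f)) :=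
      (continuousOn_iff_continuous_domRestrict.1 hf).Icc_extend'
    have h2 := h1.measurable.comp hang
    convert h2 using 2 with u
    simp only [Function.comp_apply]
    rw [Set.IccExtend_of_mem _ _ (angle_mem_Icc hb.q₁_pos u)]
    rfl
  exact Measurable.ite (measurableSet_le measurable_const measurable_snd) (hm hb.continuousOn_plus)
    (hm hb.continuousOn_minus)

lemma IsCoefficient.measurable_aInf (hb : IsCoefficient p b) : Measurable p.aInf :=
  (measurable_rho hb.q₁_pos hb.q₂_pos).inv.mul hb.measurable_L

/-- Off the axis `t₂ = 0` a single branch is active locally. The axis is a null set, so this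
suffices for convergence almost everywhere. -/
lemma IsCoefficient.continuousAt_L (hb : IsCoefficient p b) {t : ℝ × ℝ} (ht : t.2 ≠ 0) :
    ContinuousAt p.L t := by
  have hρ := rho_pos_of_snd_ne_zero (p := p) ht
  have hang : ContinuousAt (fun u : ℝ × ℝ => u.1 / p.rho u ^ (1 / p.q₁)) t := by
    refine continuousAt_fst.div ?_ (Real.rpow_pos_of_pos hρ _).ne'
    exact (continuous_rho hb.q₁_pos hb.q₂_pos).continuousAt.rpow_const (Or.inl hρ.ne')
  have hc : ∀ {f : ℝ → ℝ}, ContinuousOn f (Set.Icc (-1) 1) →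
      ContinuousAt (fun u : ℝ × ℝ => f (u.1 / p.rho u ^ (1 / p.q₁))) t := fun {f} hf => by
    have h1 : Continuous (Set.IccExtend (by norm_num : (-1 : ℝ) ≤ 1) ((Set.Icc (-1) 1).domRestrict f)) :=
      (continuousOn_iff_continuous_domRestrict.1 hf).Icc_extend'
    have h2 := h1.continuousAt.comp hang
    convert h2 using 2 with u
    simp only [Function.comp_apply]
    rw [Set.IccExtend_of_mem _ _ (angle_mem_Icc hb.q₁_pos u)]
    rfl
  rcases lt_or_gt_of_ne ht with h | h
  · refine (hc hb.continuousOn_minus).congr ?_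
    filter_upwards [continuousAt_snd.eventually (gt_mem_nhds h)] with u hu
    simp only [L, not_le.2 hu, if_false]
  · refine (hc hb.continuousOn_plus).congr ?_
    filter_upwards [continuousAt_snd.eventually (lt_mem_nhds h)] with u hu
    simp only [L, le_of_lt hu, if_true]

lemma abs_act_le (D : Matrix (Fin 2) (Fin 2) ℝ) : ∃ C, 0 ≤ C ∧ ∀ t : ℝ × ℝ,
    |(act D t).1| ≤ C * (|t.1| + |t.2|) ∧ |(act D t).2| ≤ C * (|t.1| + |t.2|) := by
  refine ⟨|D 0 0| + |D 0 1| + |D 1 0| + |D 1 1|, by positivity, fun t => ?_⟩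
  have a0 := abs_nonneg (D 0 0)
  have a1 := abs_nonneg (D 0 1)
  have a2 := abs_nonneg (D 1 0)
  have a3 := abs_nonneg (D 1 1)
  have t1 := abs_nonneg t.1
  have t2 := abs_nonneg t.2
  constructor
  · refine (abs_add_le _ _).trans ?_
    rw [abs_mul, abs_mul]
    nlinarith [mul_nonneg a0 t2, mul_nonneg a1 t1, mul_nonneg a2 t1, mul_nonneg a2 t2,
      mul_nonneg a3 t1, mul_nonneg a3 t2]
  · refine (abs_add_le _ _).trans ?_
    rw [abs_mul, abs_mul]
    nlinarith [mul_nonneg a0 t1, mul_nonneg a1 t1, mul_nonneg a0 t2, mul_nonneg a1 t2,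
      mul_nonneg a2 t2, mul_nonneg a3 t1]

lemma finite_setOf_abs_add_abs_le (N : ℤ) : {n : ℤ × ℤ | |n.1| + |n.2| ≤ N}.Finite := by
  refine ((Set.finite_Icc (-N) N).prod (Set.finite_Icc (-N) N)).subset fun n hn => ?_
  simp only [Set.mem_ofPred_eq] at hn
  have h1 := abs_nonneg n.1
  have h2 := abs_nonneg n.2
  exact ⟨abs_le.1 (by linarith), abs_le.1 (by linarith)⟩

/-- The asymptotics give the bound far out, and finitely many points remain, among them the origin,
where the asymptotics say nothing. -/
lemma IsCoefficient.exists_abs_mul_le (hb : IsCoefficient p b) :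
    ∃ C, 0 ≤ C ∧ ∀ n, |b n| * (1 + p.rho (act p.B (toReal n))) ≤ C := by
  obtain ⟨M, hM0, hM⟩ := hb.exists_abs_L_le
  obtain ⟨r, hr, hbr⟩ := hb.asymptotics
  have h1 : ∀ᶠ n in comap (fun t : ℤ × ℤ => |t.1| + |t.2|) atTop, |r n| < 1 := by
    have := hr.abs
    rw [abs_zero] at this
    exact this.eventually (gt_mem_nhds one_pos)
  rw [eventually_comap] at h1
  obtain ⟨N, hN⟩ := eventually_atTop.1 h1
  obtain ⟨A, hA0, hA⟩ := abs_act_le p.B⁻¹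
  -- If `ρ(w) ≤ 1`, both coordinates of `w` are at most `1` in modulus, whence `|n₁| + |n₂| ≤ 4A`.
  -- Beyond `N'` one therefore has `ρ(w) > 1`.
  obtain ⟨N', hN'⟩ := exists_int_gt (4 * A)
  have hfin := finite_setOf_abs_add_abs_le (max (max N N') 0)
  obtain ⟨C, hC⟩ := (hfin.image fun n => |b n| * (1 + p.rho (act p.B (toReal n)))).bddAbove
  refine ⟨max C (2 * (M + 1)), le_max_of_le_right (by positivity), fun n => ?_⟩
  by_cases hn : |n.1| + |n.2| ≤ max (max N N') 0
  · exact (hC ⟨n, hn, rfl⟩).trans (le_max_left _ _)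
  · rw [not_le, max_lt_iff, max_lt_iff] at hn
    obtain ⟨⟨hn1, hn2⟩, hn3⟩ := hn
    refine le_trans ?_ (le_max_right _ _)
    have hn0 : n ≠ 0 := by rintro rfl; simp at hn3
    have hr1 := (hN _ hn1.le n rfl).le
    set w := act p.B (toReal n) with hw
    have hnw : toReal n = act p.B⁻¹ w := (act_inv_act hb.det_ne_zero _).symm
    have hρ : 1 < p.rho w := by
      by_contra hlt
      rw [not_lt] at hlt
      have e1 := (abs_fst_le_rho_rpow hb.q₁_pos w).trans
        (Real.rpow_le_one (p.rho_nonneg w) hlt (one_div_pos.2 hb.q₁_pos).le)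
      have e2 := (abs_snd_le_rho_rpow hb.q₂_pos w).trans
        (Real.rpow_le_one (p.rho_nonneg w) hlt (one_div_pos.2 hb.q₂_pos).le)
      have e3 := (hA w).1
      have e4 := (hA w).2
      rw [← hnw] at e3 e4
      have e5 : ((|n.1| + |n.2| : ℤ) : ℝ) ≤ 4 * A := by
        push_cast
        simp only [toReal] at e3 e4
        nlinarith
      have e6 : (N' : ℝ) < ((|n.1| + |n.2| : ℤ) : ℝ) := by exact_mod_cast hn2
      linarith
    have hbn : b n = (p.rho w)⁻¹ * (p.L w + r n) := hbr n hn0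
    rw [hbn, abs_mul, abs_of_pos (inv_pos.2 (one_pos.trans hρ))]
    have h5 : |p.L w + r n| ≤ M + 1 := (abs_add_le _ _).trans (add_le_add (hM w) hr1)
    have h6 : (p.rho w)⁻¹ * (1 + p.rho w) ≤ 2 := by
      rw [inv_mul_le_iff₀ (one_pos.trans hρ)]
      linarith
    calc (p.rho w)⁻¹ * |p.L w + r n| * (1 + p.rho w)
        = |p.L w + r n| * ((p.rho w)⁻¹ * (1 + p.rho w)) := by ring
      _ ≤ (M + 1) * 2 := by
        refine mul_le_mul h5 h6 ?_ (by positivity)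
        have := p.rho_nonneg w
        positivity
      _ = 2 * (M + 1) := by ring

lemma abs_sub_floorPair_le (t : ℝ × ℝ) :
    |(toReal (floorPair t) - t).1| ≤ 1 ∧ |(toReal (floorPair t) - t).2| ≤ 1 := by
  have h1 := Int.floor_le t.1
  have h2 := Int.lt_floor_add_one t.1
  have h3 := Int.floor_le t.2
  have h4 := Int.lt_floor_add_one t.2
  simp only [toReal, floorPair, Prod.fst_sub, Prod.snd_sub, abs_le]
  exact ⟨⟨by linarith, by linarith⟩, ⟨by linarith, by linarith⟩⟩

/-- The rounding error in the coordinates `v = B t`. -/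
lemma IsCoefficient.exists_abs_round_le (hb : IsCoefficient p b) : ∃ A, 0 ≤ A ∧ ∀ v,
    |(act p.B (toReal (floorPair (act p.B⁻¹ v))) - v).1| ≤ A ∧
    |(act p.B (toReal (floorPair (act p.B⁻¹ v))) - v).2| ≤ A := by
  obtain ⟨A, hA0, hA⟩ := abs_act_le p.B
  refine ⟨A * (1 + 1), by positivity, fun v => ?_⟩
  have h1 : act p.B (toReal (floorPair (act p.B⁻¹ v))) - v =
      act p.B (toReal (floorPair (act p.B⁻¹ v)) - act p.B⁻¹ v) := by
    rw [act_sub, act_act_inv hb.det_ne_zero]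
  obtain ⟨h2, h3⟩ := abs_sub_floorPair_le (act p.B⁻¹ v)
  rw [h1]
  exact ⟨(hA _).1.trans (by gcongr), (hA _).2.trans (by gcongr)⟩

/-- Rounding moves `v` by a bounded vector, so by `rho_add_le` the values `1 + ρ` at `v` and at the
rounded point are comparable. -/
lemma IsCoefficient.exists_abs_floorPair_mul_le (hb : IsCoefficient p b) :
    ∃ C, 0 ≤ C ∧ ∀ v, |b (floorPair (act p.B⁻¹ v))| * (1 + p.rho v) ≤ C := by
  obtain ⟨C, hC0, hC⟩ := hb.exists_abs_mul_le
  obtain ⟨A, hA0, hA⟩ := hb.exists_abs_round_le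
  have h₁ := hb.q₁_pos
  have h₂ := hb.q₂_pos
  set κ : ℝ := 2 ^ p.q₁ + 2 ^ p.q₂ with hκ
  set R : ℝ := A ^ p.q₁ + A ^ p.q₂ with hR
  have hκ0 : 0 ≤ κ := by positivity
  have hR0 : 0 ≤ R := by positivity
  refine ⟨C * (1 + κ * (1 + R)), by positivity, fun v => ?_⟩
  set n := floorPair (act p.B⁻¹ v)
  set w := act p.B (toReal n)
  have h1 := rho_add_le h₁ h₂ w (v - w)
  rw [add_sub_cancel] at h1
  have h2 : p.rho (v - w) ≤ R := by
    obtain ⟨h3, h4⟩ := hA v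
    rw [← abs_neg, ← Prod.fst_neg, neg_sub] at h3
    rw [← abs_neg, ← Prod.snd_neg, neg_sub] at h4
    exact add_le_add (Real.rpow_le_rpow (abs_nonneg _) h3 h₁.le)
      (Real.rpow_le_rpow (abs_nonneg _) h4 h₂.le)
  have h5 := p.rho_nonneg w
  calc |b n| * (1 + p.rho v) ≤ |b n| * ((1 + p.rho w) * (1 + κ * (1 + R))) := by
        gcongr
        nlinarith [mul_nonneg hκ0 h5, mul_nonneg (mul_nonneg hκ0 h5) hR0, mul_le_mul_of_nonneg_left h2 hκ0]
    _ = |b n| * (1 + p.rho w) * (1 + κ * (1 + R)) := by ring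
    _ ≤ C * (1 + κ * (1 + R)) := by gcongr; exact hC n

/-- By homogeneity the rescaled coefficient is at most `C μ / (1 + μ ρ(t)) ≤ C / ρ(t)`, a majorant
independent of `μ`. The second alternative is set apart because the inverse of zero is zero. -/
lemma IsCoefficient.exists_abs_rescaled_le (hb : IsCoefficient p b) :
    ∃ C, 0 ≤ C ∧ ∀ μ, 0 < μ → ∀ t,
      |μ * b (floorPair (act p.B⁻¹ (p.dil μ t)))| ≤ C * (p.rho t)⁻¹ ∨ p.rho t = 0 := by
  obtain ⟨C, hC0, hC⟩ := hb.exists_abs_floorPair_mul_le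
  refine ⟨C, hC0, fun μ hμ t => ?_⟩
  rcases (p.rho_nonneg t).eq_or_lt with h0 | h0
  · exact Or.inr h0.symm
  left
  have h1 := hC (p.dil μ t)
  rw [rho_dil hb.q₁_pos hb.q₂_pos hμ] at h1
  rw [← div_eq_mul_inv, le_div_iff₀ h0, abs_mul, abs_of_pos hμ]
  nlinarith [abs_nonneg (b (floorPair (act p.B⁻¹ (p.dil μ t))))]

/-- The rescaled coefficients converge to `a_∞`. -/
lemma IsCoefficient.tendsto_rescaled (hb : IsCoefficient p b) {t : ℝ × ℝ} (ht : t.2 ≠ 0) :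
    Tendsto (fun μ => μ * b (floorPair (act p.B⁻¹ (p.dil μ t)))) atTop (𝓝 (p.aInf t)) := by
  obtain ⟨A, hA0, hA⟩ := hb.exists_abs_round_le
  obtain ⟨r, hr, hbr⟩ := hb.asymptotics
  have h₁ := hb.q₁_pos
  have h₂ := hb.q₂_pos
  set n : ℝ → ℤ × ℤ := fun μ => floorPair (act p.B⁻¹ (p.dil μ t)) with hn
  set w : ℝ → ℝ × ℝ := fun μ => act p.B (toReal (n μ)) with hw
  -- The point whose dilate is the rounded point `w μ`. The bounded rounding error is divided by
  -- `μ^(1/q_i)`, so `t' μ → t`, while homogeneity is available at `t' μ` exactly.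
  set t' : ℝ → ℝ × ℝ := fun μ =>
    (t.1 + μ ^ (-(1 / p.q₁)) * (w μ - p.dil μ t).1, t.2 + μ ^ (-(1 / p.q₂)) * (w μ - p.dil μ t).2)
    with ht'
  have hwt : ∀ μ, 0 < μ → w μ = p.dil μ (t' μ) := fun μ hμ => by
    simp only [ht', dil, mul_add, ← mul_assoc, ← Real.rpow_add hμ, add_neg_cancel, Real.rpow_zero,
      one_mul, Prod.fst_sub, Prod.snd_sub, add_sub_cancel]
  have hsmall : ∀ {q : ℝ}, 0 < q → ∀ {f : ℝ → ℝ}, (∀ μ, |f μ| ≤ A) →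
      Tendsto (fun μ : ℝ => μ ^ (-(1 / q)) * f μ) atTop (𝓝 0) := by
    intro q hq f hf
    have h := (tendsto_rpow_neg_atTop (one_div_pos.2 hq)).mul_const A
    rw [zero_mul] at h
    refine squeeze_zero_norm' ?_ h
    filter_upwards [eventually_gt_atTop 0] with μ hμ
    rw [Real.norm_eq_abs, abs_mul, abs_of_pos (Real.rpow_pos_of_pos hμ _)]
    exact mul_le_mul_of_nonneg_left (hf μ) (Real.rpow_pos_of_pos hμ _).le
  have htt : Tendsto t' atTop (𝓝 t) := by
    have e1 := (hsmall h₁ fun μ => (hA (p.dil μ t)).1).const_add t.1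
    have e2 := (hsmall h₂ fun μ => (hA (p.dil μ t)).2).const_add t.2
    rw [add_zero] at e1 e2
    exact e1.prodMk_nhds e2
  have hρ0 := rho_pos_of_snd_ne_zero (p := p) ht
  have hρ : Tendsto (fun μ => p.rho (t' μ)) atTop (𝓝 (p.rho t)) :=
    ((continuous_rho h₁ h₂).tendsto t).comp htt
  have hL : Tendsto (fun μ => p.L (t' μ)) atTop (𝓝 (p.L t)) := (hb.continuousAt_L ht).tendsto.comp htt
  have hρw : Tendsto (fun μ => p.rho (w μ)) atTop atTop := by
    refine (Tendsto.atTop_mul_pos hρ0 tendsto_id hρ).congr' ?_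
    filter_upwards [eventually_gt_atTop 0] with μ hμ
    rw [hwt μ hμ, rho_dil h₁ h₂ hμ]
    rfl
  -- On finitely many lattice points `ρ` is bounded, whereas `ρ(w μ) → ∞`; hence the lattice points
  -- leave every bounded set and `r` tends to zero along them.
  have hnN : Tendsto (fun μ => |(n μ).1| + |(n μ).2|) atTop atTop := by
    refine tendsto_atTop.2 fun N => ?_
    obtain ⟨R, hR⟩ := ((finite_setOf_abs_add_abs_le N).image
      fun m => p.rho (act p.B (toReal m))).bddAbove
    filter_upwards [hρw.eventually (eventually_gt_atTop R)] with μ hμ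
    by_contra hlt
    exact absurd (hR ⟨n μ, (not_le.1 hlt).le, rfl⟩) (not_le.2 hμ)
  have hrn : Tendsto (fun μ => r (n μ)) atTop (𝓝 0) := hr.comp (tendsto_comap_iff.2 hnN)
  have hlim := (hρ.inv₀ hρ0.ne').mul (hL.add hrn)
  rw [add_zero] at hlim
  refine hlim.congr' ?_
  filter_upwards [eventually_gt_atTop 0, hnN.eventually (eventually_gt_atTop 0)] with μ hμ hμn
  have hn0 : n μ ≠ 0 := by
    intro h
    rw [h] at hμn
    simp at hμn
  change _ = μ * b (n μ)
  rw [hbr _ hn0]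
  change _ = μ * ((p.rho (w μ))⁻¹ * (p.L (w μ) + r (n μ)))
  rw [hwt μ hμ, rho_dil h₁ h₂ hμ, L_dil h₁ h₂ hμ, mul_inv, ← mul_assoc, ← mul_assoc,
    mul_inv_cancel₀ hμ.ne', one_mul]

end Coefficient

/-! ### Integrability of `1/ρ` near the origin and over strips -/

section Bounds

open scoped ENNReal

open Params

/-- Cauchy-Schwarz for `m ≤ √v √w`. -/
lemma sq_lintegral_le_mul {α : Type*} [MeasurableSpace α] {ν : Measure α} {m v w : α → ℝ≥0∞}
    (hv : Measurable v) (hw : Measurable w) (h : ∀ t, m t ^ 2 ≤ v t * w t) :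
    (∫⁻ t, m t ∂ν) ^ 2 ≤ (∫⁻ t, v t ∂ν) * ∫⁻ t, w t ∂ν := by
  have hr : ∀ x : ℝ≥0∞, (x ^ (1 / 2 : ℝ)) ^ (2 : ℝ) = x := fun x => by
    rw [← ENNReal.rpow_mul]; norm_num
  have h1 : ∀ t, m t ≤ (v t) ^ (1 / 2 : ℝ) * (w t) ^ (1 / 2 : ℝ) := fun t => by
    rw [← ENNReal.mul_rpow_of_nonneg _ _ (by norm_num), one_div,
      ENNReal.le_rpow_inv_iff (by norm_num), ENNReal.rpow_two]
    exact h t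
  have h2 := ENNReal.lintegral_mul_le_Lp_mul_Lq ν (Real.HolderConjugate.two_two)
    (hv.pow_const (1 / 2 : ℝ)).aemeasurable (hw.pow_const (1 / 2 : ℝ)).aemeasurable
  simp only [hr] at h2
  have h3 := (lintegral_mono h1).trans h2
  calc _ ≤ ((∫⁻ t, v t ∂ν) ^ (1 / 2 : ℝ) * (∫⁻ t, w t ∂ν) ^ (1 / 2 : ℝ)) ^ 2 := by gcongr
    _ = _ := by rw [mul_pow, ← ENNReal.rpow_two, ← ENNReal.rpow_two, hr, hr]

lemma measurableSet_act_add_mem (D : Matrix (Fin 2) (Fin 2) ℝ) (x u : ℝ × ℝ) :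
    MeasurableSet {t | act D t + u ∈ rect x} :=
  ((measurable_act D).add_const u) (measurableSet_Ioc.prod measurableSet_Ioc)

lemma measurableSet_rect (x : ℝ × ℝ) : MeasurableSet (rect x) :=
  measurableSet_Ioc.prod measurableSet_Ioc

variable {p : Params}

lemma abs_rpow_mul_abs_rpow_le (h₁ : 0 < p.q₁) (h₂ : 0 < p.q₂) {a₁ a₂ c : ℝ} (ha₁ : 0 ≤ a₁)
    (ha₂ : 0 ≤ a₂) (hc : a₁ / p.q₁ + a₂ / p.q₂ = c) {t : ℝ × ℝ} (ht : 0 < p.rho t) :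
    |t.1| ^ a₁ * |t.2| ^ a₂ ≤ p.rho t ^ c := by
  have e1 := Real.rpow_le_rpow (abs_nonneg _) (abs_fst_le_rho_rpow h₁ t) ha₁
  have e2 := Real.rpow_le_rpow (abs_nonneg _) (abs_snd_le_rho_rpow h₂ t) ha₂
  rw [← Real.rpow_mul ht.le, one_div_mul_eq_div] at e1 e2
  rw [← hc, Real.rpow_add ht]
  exact mul_le_mul e1 e2 (by positivity) (by positivity)

/-- As `ρ > 1`, `1 + |t_i| ≤ 2 ρ^(1/q_i)`, so the product of powers is at most `2^(a₁+a₂) ρ^(1-η)`.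
The deficit `η` in the exponents is converted into the decay `K^(-η)`. -/
lemma rho_inv_le_of_lt (h₁ : 0 < p.q₁) (h₂ : 0 < p.q₂) {a₁ a₂ η : ℝ} (ha₁ : 0 ≤ a₁)
    (ha₂ : 0 ≤ a₂) (hη : 0 < η) (hc : a₁ / p.q₁ + a₂ / p.q₂ = 1 - η) {K : ℝ} (hK : 1 ≤ K)
    {t : ℝ × ℝ} (ht : K < p.rho t) :
    (p.rho t)⁻¹ ≤ 2 ^ (a₁ + a₂) * K ^ (-η) * ((1 + |t.1|) ^ (-a₁) * (1 + |t.2|) ^ (-a₂)) := by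
  have hρ : 1 < p.rho t := hK.trans_lt ht
  have hρ0 : 0 < p.rho t := one_pos.trans hρ
  have b1 : 1 + |t.1| ≤ 2 * p.rho t ^ (1 / p.q₁) := by
    linarith [abs_fst_le_rho_rpow h₁ t, Real.one_le_rpow hρ.le (one_div_pos.2 h₁).le]
  have b2 : 1 + |t.2| ≤ 2 * p.rho t ^ (1 / p.q₂) := by
    linarith [abs_snd_le_rho_rpow h₂ t, Real.one_le_rpow hρ.le (one_div_pos.2 h₂).le]
  have e1 := Real.rpow_le_rpow (by positivity) b1 ha₁
  have e2 := Real.rpow_le_rpow (by positivity) b2 ha₂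
  rw [Real.mul_rpow (by norm_num) (by positivity), ← Real.rpow_mul hρ0.le, one_div_mul_eq_div]
    at e1 e2
  have e3 : (1 + |t.1|) ^ a₁ * (1 + |t.2|) ^ a₂ ≤ 2 ^ (a₁ + a₂) * (p.rho t * K ^ (-η)) := by
    refine (mul_le_mul e1 e2 (by positivity) (by positivity)).trans ?_
    calc _ = 2 ^ (a₁ + a₂) * (p.rho t ^ (1 - η)) := by
          rw [← hc, Real.rpow_add hρ0, Real.rpow_add two_pos]; ring
      _ ≤ _ := by
          rw [sub_eq_add_neg, Real.rpow_add hρ0, Real.rpow_one]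
          gcongr ?_ * (?_ * ?_)
          exact Real.rpow_le_rpow_of_nonpos (one_pos.trans_le hK) ht.le (by linarith)
  have p1 : 0 < 1 + |t.1| := by positivity
  have p2 : 0 < 1 + |t.2| := by positivity
  rw [Real.rpow_neg p1.le, Real.rpow_neg p2.le, ← mul_inv, ← div_eq_mul_inv, le_div_iff₀ (by positivity),
    inv_mul_le_iff₀ hρ0]
  linarith

lemma ae_snd_ne_zero : ∀ᵐ t : ℝ × ℝ, t.2 ≠ 0 := by
  have h := (Measure.quasiMeasurePreserving_snd (μ := (volume : Measure ℝ))
    (ν := (volume : Measure ℝ))).ae (p := fun y => y ≠ 0) (by simp [ae_iff])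
  exact h

lemma ae_fst_ne_zero : ∀ᵐ t : ℝ × ℝ, t.1 ≠ 0 := by
  have h := (Measure.quasiMeasurePreserving_fst (μ := (volume : Measure ℝ))
    (ν := (volume : Measure ℝ))).ae (p := fun y => y ≠ 0) (by simp [ae_iff])
  exact h

lemma lintegral_abs_rpow_lt_top {a : ℝ} (ha : a < 1) (M : ℝ) :
    ∫⁻ s in Set.Icc (-M) M, ENNReal.ofReal (|s| ^ (-a)) < ∞ := by
  have h1 : LocallyIntegrable (fun s : ℝ => |s| ^ (-a)) :=
    locallyIntegrable_of_norm_le_rpow (C := 1) (by simp) (α := a) (by simpa using ha)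
      (Eventually.of_forall fun s => by
        rw [Real.norm_eq_abs, Real.norm_eq_abs, one_mul, abs_of_nonneg (by positivity)])
      (measurable_norm.pow_const _).aestronglyMeasurable
  exact (h1.integrableOn_isCompact isCompact_Icc).lintegral_lt_top

/-- `1/ρ` is integrable near the origin. -/
lemma lintegral_rho_inv_lt_top (h₁ : 0 < p.q₁) (h₂ : 0 < p.q₂) (hQ : 1 < p.Q) (K : ℝ) :
    ∫⁻ t in {t | p.rho t ≤ K}, ENNReal.ofReal (p.rho t)⁻¹ < ∞ := by
  have hQ0 : 0 < p.Q := one_pos.trans hQ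
  -- With this exponent `a/q₁ + a/q₂ = 1`, so `1/ρ ≤ |t₁|^(-a) |t₂|^(-a)`; the condition `Q > 1`
  -- gives `a < 1`, which makes the product locally integrable.
  set a := 1 / p.Q with ha
  have ha0 : 0 ≤ a := by positivity
  have ha1 : a < 1 := by rw [ha, div_lt_one hQ0]; exact hQ
  have hc : a / p.q₁ + a / p.q₂ = 1 := by
    rw [ha, div_add_div _ _ h₁.ne' h₂.ne']
    have : p.Q = (p.q₁ + p.q₂) / (p.q₁ * p.q₂) := by
      unfold Q; field_simp; exact add_comm _ _
    rw [this]
    field_simp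
    exact add_comm _ _
  set M₁ := K ^ (1 / p.q₁)
  set M₂ := K ^ (1 / p.q₂)
  have hsub : {t | p.rho t ≤ K} ⊆ Set.Icc (-M₁) M₁ ×ˢ Set.Icc (-M₂) M₂ := fun t ht => by
    have ht' : p.rho t ≤ K := ht
    exact ⟨abs_le.1 ((abs_fst_le_rho_rpow h₁ t).trans
        (Real.rpow_le_rpow (p.rho_nonneg t) ht' (by positivity))),
      abs_le.1 ((abs_snd_le_rho_rpow h₂ t).trans
        (Real.rpow_le_rpow (p.rho_nonneg t) ht' (by positivity)))⟩
  refine (lintegral_mono_set hsub).trans_lt ?_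
  have hle : ∫⁻ t in Set.Icc (-M₁) M₁ ×ˢ Set.Icc (-M₂) M₂, ENNReal.ofReal (p.rho t)⁻¹ ≤
      ∫⁻ t in Set.Icc (-M₁) M₁ ×ˢ Set.Icc (-M₂) M₂,
        ENNReal.ofReal (|t.1| ^ (-a)) * ENNReal.ofReal (|t.2| ^ (-a)) := by
    refine lintegral_mono_ae (ae_restrict_of_ae ?_)
    filter_upwards [ae_fst_ne_zero, ae_snd_ne_zero] with t h3 h4
    have hρ := rho_pos_of_snd_ne_zero (p := p) h4
    have h5 := abs_rpow_mul_abs_rpow_le h₁ h₂ ha0 ha0 hc hρ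
    rw [Real.rpow_one] at h5
    rw [← ENNReal.ofReal_mul (by positivity), Real.rpow_neg (abs_nonneg _),
      Real.rpow_neg (abs_nonneg _), ← mul_inv]
    have : 0 < |t.1| := abs_pos.2 h3
    have : 0 < |t.2| := abs_pos.2 h4
    exact ENNReal.ofReal_le_ofReal (inv_anti₀ (by positivity) h5)
  refine hle.trans_lt ?_
  rw [Measure.volume_eq_prod, ← Measure.prod_restrict,
    lintegral_prod_mul (f := fun s => ENNReal.ofReal (|s| ^ (-a)))
      (g := fun s => ENNReal.ofReal (|s| ^ (-a)))
      (measurable_norm.pow_const _).ennreal_ofReal.aemeasurable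
      (measurable_norm.pow_const _).ennreal_ofReal.aemeasurable]
  exact ENNReal.mul_lt_top (lintegral_abs_rpow_lt_top ha1 _) (lintegral_abs_rpow_lt_top ha1 _)

/-- The weighted bounds that control `1/ρ` away from the origin over the strips
`{t | D t + u ∈ (0, x]}`, uniformly in `D ∈ 𝒟`. -/
def FarControl (p : Params) (𝒟 : Set (Matrix (Fin 2) (Fin 2) ℝ)) : Prop :=
  ∃ (m v w : ℝ × ℝ → ℝ≥0∞) (η : ℝ) (C : ℝ≥0∞), Measurable m ∧ Measurable v ∧ Measurable w ∧ 0 < η ∧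
    C ≠ ∞ ∧ (∀ t, m t ^ 2 ≤ v t * w t) ∧ ∫⁻ t, v t ≠ ∞ ∧ (∀ t, m t ≤ w t) ∧
    (∀ K, 1 ≤ K → ∀ t, K < p.rho t →
      ENNReal.ofReal (p.rho t)⁻¹ ≤ C * ENNReal.ofReal (K ^ (-η)) * m t) ∧
    ∀ x, ∃ A, A ≠ ∞ ∧ ∀ D ∈ 𝒟, ∀ u, ∫⁻ t in {t | act D t + u ∈ rect x}, w t ≤ A

lemma volume_affine_preimage_Ioc {α : ℝ} (hα : α ≠ 0) (c ℓ : ℝ) :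
    volume {s : ℝ | α * s + c ∈ Set.Ioc 0 ℓ} = ENNReal.ofReal |α⁻¹| * ENNReal.ofReal ℓ := by
  have : {s : ℝ | α * s + c ∈ Set.Ioc 0 ℓ} = (α * ·) ⁻¹' Set.Ioc (-c) (ℓ - c) := by
    ext s
    simp only [Set.mem_ofPred_eq, Set.mem_Ioc, Set.mem_preimage]
    constructor <;> rintro ⟨h1, h2⟩ <;> constructor <;> linarith
  rw [this, Real.volume_preimage_mul_left hα, Real.volume_Ioc]
  congr 2
  ring

lemma lintegral_indicator_affine {α : ℝ} (hα : α ≠ 0) (c ℓ : ℝ) (k : ℝ≥0∞) :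
    ∫⁻ y, {y : ℝ | α * y + c ∈ Set.Ioc 0 ℓ}.indicator (fun _ => k) y =
      ENNReal.ofReal |α⁻¹| * ENNReal.ofReal ℓ * k := by
  have hm : MeasurableSet {y : ℝ | α * y + c ∈ Set.Ioc 0 ℓ} :=
    measurableSet_Ioc.preimage (f := fun y : ℝ => α * y + c) (by fun_prop)
  rw [lintegral_indicator hm, lintegral_const, Measure.restrict_apply_univ,
    volume_affine_preimage_Ioc hα, mul_comm]

lemma mem_rect_coord {D : Matrix (Fin 2) (Fin 2) ℝ} {x t u : ℝ × ℝ} (h : act D t + u ∈ rect x)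
    (i : Fin 2) : D i 0 * t.1 + D i 1 * t.2 + ![u.1, u.2] i ∈ Set.Ioc 0 (![x.1, x.2] i) := by
  obtain ⟨h1, h2⟩ := h
  fin_cases i
  · exact h1
  · exact h2

lemma lintegral_one_add_abs_rpow_lt_top {a : ℝ} (ha : 1 < a) :
    ∫⁻ s : ℝ, ENNReal.ofReal ((1 + |s|) ^ (-a)) < ∞ := by
  have := finite_integral_one_add_norm (E := ℝ) (μ := volume) (r := a) (by simpa using ha)
  simpa using this

lemma one_add_abs_rpow_le_one {a : ℝ} (ha : 0 ≤ a) (s : ℝ) :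
    ENNReal.ofReal ((1 + |s|) ^ (-a)) ≤ 1 := by
  rw [← ENNReal.ofReal_one]
  exact ENNReal.ofReal_le_ofReal
    (Real.rpow_le_one_of_one_le_of_nonpos (by linarith [abs_nonneg s]) (by linarith))

lemma one_add_abs_rpow_sq (a s : ℝ) :
    ENNReal.ofReal ((1 + |s|) ^ (-a)) ^ 2 = ENNReal.ofReal ((1 + |s|) ^ (-(2 * a))) := by
  rw [← ENNReal.ofReal_pow (by positivity), ← Real.rpow_natCast, ← Real.rpow_mul (by positivity)]
  congr 2
  push_cast
  ring

/-- Exponents for the product bound of `1/ρ`. -/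
lemma exists_exponents {q₁ q₂ : ℝ} (h₁ : 0 < q₁) (h₂ : 0 < q₂) (h : 1 / (2 * q₁) + 1 / q₂ < 1) :
    ∃ a₁ a₂ η : ℝ, 1 / 2 < a₁ ∧ 1 < a₂ ∧ 0 < η ∧ a₁ / q₁ + a₂ / q₂ = 1 - η := by
  set e := 1 - (1 / (2 * q₁) + 1 / q₂) with he
  have he0 : 0 < e := by linarith
  -- Of the slack `e`, a quarter goes to each of the two exponents and the remaining half is `η`.
  refine ⟨1 / 2 + q₁ * (e / 4), 1 + q₂ * (e / 4), e / 2, by nlinarith, by nlinarith, by linarith, ?_⟩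
  rw [he]
  field_simp
  ring

/-- A nonzero entry multiplying `t₁` confines `t₁`, for fixed `t₂` and `u`, to an interval of length
independent of the other entries. Integrability is then needed in `t₂` alone on the strip, which
gives a bound uniform over the class. -/
lemma farControl_fst (h₁ : 0 < p.q₁) (h₂ : 0 < p.q₂) (h : 1 / (2 * p.q₁) + 1 / p.q₂ < 1)
    (i : Fin 2) {α : ℝ} (hα : α ≠ 0) : FarControl p {D | D i 0 = α} := by
  obtain ⟨a₁, a₂, η, ha₁, ha₂, hη, hc⟩ := exists_exponents h₁ h₂ h
  set m₁ : ℝ → ℝ≥0∞ := fun s => ENNReal.ofReal ((1 + |s|) ^ (-a₁)) with hm₁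
  set m₂ : ℝ → ℝ≥0∞ := fun s => ENNReal.ofReal ((1 + |s|) ^ (-a₂)) with hm₂
  have hm₁' : Measurable m₁ := by fun_prop
  have hm₂' : Measurable m₂ := by fun_prop
  -- The factorisation `m² = v w` puts the square on the factor with the smaller exponent: `2a₁ > 1`
  -- and `a₂ > 1` make `v` integrable over the plane, and `w` needs only `a₂ > 1` over strips.
  refine ⟨fun t => m₁ t.1 * m₂ t.2, fun t => m₁ t.1 ^ 2 * m₂ t.2, fun t => m₂ t.2, η,
    ENNReal.ofReal (2 ^ (a₁ + a₂)), by fun_prop, by fun_prop, by fun_prop, hη, by simp,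
    fun t => le_of_eq (by ring), ?_, fun t => ?_, fun K hK t ht => ?_, fun x => ?_⟩
  · rw [Measure.volume_eq_prod, lintegral_prod_mul (f := fun s => m₁ s ^ 2) (g := m₂)
      (by fun_prop) (by fun_prop)]
    simp only [hm₁, one_add_abs_rpow_sq]
    exact (ENNReal.mul_lt_top (lintegral_one_add_abs_rpow_lt_top (by linarith))
      (lintegral_one_add_abs_rpow_lt_top ha₂)).ne
  · exact mul_le_of_le_one_left' (one_add_abs_rpow_le_one (by linarith) _)
  · simp only [hm₁, hm₂]
    rw [← ENNReal.ofReal_mul (by positivity), ← ENNReal.ofReal_mul (by positivity),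
      ← ENNReal.ofReal_mul (by positivity)]
    exact ENNReal.ofReal_le_ofReal
      (rho_inv_le_of_lt h₁ h₂ (by linarith) (by linarith) hη hc hK ht)
  · refine ⟨(ENNReal.ofReal |α⁻¹| * ENNReal.ofReal (![x.1, x.2] i)) * ∫⁻ s, m₂ s,
      (ENNReal.mul_lt_top (by finiteness) (lintegral_one_add_abs_rpow_lt_top ha₂)).ne,
      fun D hD u => ?_⟩
    have hD' : D i 0 = α := hD
    set E := {t : ℝ × ℝ | α * t.1 + (D i 1 * t.2 + ![u.1, u.2] i) ∈ Set.Ioc 0 (![x.1, x.2] i)} with hE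
    have hEm : MeasurableSet E := by
      refine measurableSet_Ioc.preimage (f := fun t : ℝ × ℝ => α * t.1 + (D i 1 * t.2 + ![u.1, u.2] i)) ?_
      fun_prop
    have hsub : {t | act D t + u ∈ rect x} ⊆ E := fun t ht => by
      have := mem_rect_coord ht i
      rw [hD', add_assoc] at this
      exact this
    refine (lintegral_mono_set hsub).trans ?_
    rw [← lintegral_indicator hEm, Measure.volume_eq_prod,
      lintegral_prod_symm _ ((by fun_prop : Measurable fun t : ℝ × ℝ => m₂ t.2).indicator hEm).aemeasurable,
      ← lintegral_const_mul _ hm₂']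
    refine lintegral_mono fun s => ?_
    have h5 : ∀ y, E.indicator (fun t : ℝ × ℝ => m₂ t.2) (y, s) =
        {y : ℝ | α * y + (D i 1 * s + ![u.1, u.2] i) ∈ Set.Ioc 0 (![x.1, x.2] i)}.indicator
          (fun _ => m₂ s) y := fun y => by
      simp only [Set.indicator, hE, Set.mem_ofPred_eq]
    simp only [h5]
    exact (lintegral_indicator_affine hα _ _ _).le

/-- The mirror image, with the coordinates exchanged; now `t₂` is confined and the exponent above
`1` belongs to `t₁`. -/
lemma farControl_snd (h₁ : 0 < p.q₁) (h₂ : 0 < p.q₂) (h : 1 / p.q₁ + 1 / (2 * p.q₂) < 1)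
    (i : Fin 2) {α : ℝ} (hα : α ≠ 0) : FarControl p {D | D i 1 = α} := by
  obtain ⟨a₂, a₁, η, ha₂, ha₁, hη, hc⟩ := exists_exponents h₂ h₁ (by linarith)
  rw [add_comm] at hc
  set m₁ : ℝ → ℝ≥0∞ := fun s => ENNReal.ofReal ((1 + |s|) ^ (-a₁)) with hm₁
  set m₂ : ℝ → ℝ≥0∞ := fun s => ENNReal.ofReal ((1 + |s|) ^ (-a₂)) with hm₂
  have hm₁' : Measurable m₁ := by fun_prop
  have hm₂' : Measurable m₂ := by fun_prop
  refine ⟨fun t => m₁ t.1 * m₂ t.2, fun t => m₁ t.1 * m₂ t.2 ^ 2, fun t => m₁ t.1, η,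
    ENNReal.ofReal (2 ^ (a₁ + a₂)), by fun_prop, by fun_prop, by fun_prop, hη, by simp,
    fun t => le_of_eq (by ring), ?_, fun t => ?_, fun K hK t ht => ?_, fun x => ?_⟩
  · rw [Measure.volume_eq_prod, lintegral_prod_mul (f := m₁) (g := fun s => m₂ s ^ 2)
      (by fun_prop) (by fun_prop)]
    simp only [hm₂, one_add_abs_rpow_sq]
    exact (ENNReal.mul_lt_top (lintegral_one_add_abs_rpow_lt_top ha₁)
      (lintegral_one_add_abs_rpow_lt_top (by linarith))).ne
  · exact mul_le_of_le_one_right' (one_add_abs_rpow_le_one (by linarith) _)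
  · simp only [hm₁, hm₂]
    rw [← ENNReal.ofReal_mul (by positivity), ← ENNReal.ofReal_mul (by positivity),
      ← ENNReal.ofReal_mul (by positivity)]
    exact ENNReal.ofReal_le_ofReal
      (rho_inv_le_of_lt h₁ h₂ (by linarith) (by linarith) hη hc hK ht)
  · refine ⟨(ENNReal.ofReal |α⁻¹| * ENNReal.ofReal (![x.1, x.2] i)) * ∫⁻ s, m₁ s,
      (ENNReal.mul_lt_top (by finiteness) (lintegral_one_add_abs_rpow_lt_top ha₁)).ne,
      fun D hD u => ?_⟩
    have hD' : D i 1 = α := hD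
    set E := {t : ℝ × ℝ | α * t.2 + (D i 0 * t.1 + ![u.1, u.2] i) ∈ Set.Ioc 0 (![x.1, x.2] i)} with hE
    have hEm : MeasurableSet E := by
      refine measurableSet_Ioc.preimage (f := fun t : ℝ × ℝ => α * t.2 + (D i 0 * t.1 + ![u.1, u.2] i)) ?_
      fun_prop
    have hsub : {t | act D t + u ∈ rect x} ⊆ E := fun t ht => by
      have := mem_rect_coord ht i
      rw [hD', add_comm (D i 0 * t.1), add_assoc] at this
      exact this
    refine (lintegral_mono_set hsub).trans ?_
    rw [← lintegral_indicator hEm, Measure.volume_eq_prod,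
      lintegral_prod _ ((by fun_prop : Measurable fun t : ℝ × ℝ => m₁ t.1).indicator hEm).aemeasurable,
      ← lintegral_const_mul _ hm₁']
    refine lintegral_mono fun s => ?_
    have h5 : ∀ y, E.indicator (fun t : ℝ × ℝ => m₁ t.1) (s, y) =
        {y : ℝ | α * y + (D i 0 * s + ![u.1, u.2] i) ∈ Set.Ioc 0 (![x.1, x.2] i)}.indicator
          (fun _ => m₁ s) y := fun y => by
      simp only [Set.indicator, hE, Set.mem_ofPred_eq]
    simp only [h5]
    exact (lintegral_indicator_affine hα _ _ _).le

/-- By Tonelli: for fixed `t` the admissible `u` form a translate of the rectangle. The matrix plays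
no role, so singular limit matrices are covered. -/
lemma lintegral_volume_preimage (D : Matrix (Fin 2) (Fin 2) ℝ) (x : ℝ × ℝ) {v : ℝ × ℝ → ℝ≥0∞}
    (hv : Measurable v) :
    ∫⁻ u, ∫⁻ t in {t | act D t + u ∈ rect x}, v t = volume (rect x) * ∫⁻ t, v t := by
  have hm : MeasurableSet {z : (ℝ × ℝ) × (ℝ × ℝ) | act D z.2 + z.1 ∈ rect x} :=
    (measurableSet_rect x).preimage (((measurable_act D).comp measurable_snd).add measurable_fst)
  have h1 : ∀ u, ∫⁻ t in {t | act D t + u ∈ rect x}, v t =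
      ∫⁻ t, {z : (ℝ × ℝ) × (ℝ × ℝ) | act D z.2 + z.1 ∈ rect x}.indicator (fun z => v z.2) (u, t) :=
    fun u => by
      rw [← lintegral_indicator (measurableSet_act_add_mem D x u)]
      rfl
  simp only [h1]
  rw [lintegral_lintegral_swap (f := fun u t =>
    {z : (ℝ × ℝ) × (ℝ × ℝ) | act D z.2 + z.1 ∈ rect x}.indicator (fun z => v z.2) (u, t))
    ((hv.comp measurable_snd).indicator hm).aemeasurable, ← lintegral_const_mul _ hv]
  refine lintegral_congr fun t => ?_
  have h2 : ∀ u, {z : (ℝ × ℝ) × (ℝ × ℝ) | act D z.2 + z.1 ∈ rect x}.indicator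
      (fun z => v z.2) (u, t) = ((act D t + ·) ⁻¹' rect x).indicator (fun _ => v t) u := fun u => rfl
  simp only [h2]
  rw [lintegral_indicator ((measurableSet_rect x).preimage (measurable_const_add _)), lintegral_const,
    Measure.restrict_apply_univ, measure_preimage_add, mul_comm]

lemma volume_rect_ne_top (x : ℝ × ℝ) : volume (rect x) ≠ ∞ := by
  rw [rect, Measure.volume_eq_prod, Measure.prod_prod]
  simp [ENNReal.mul_eq_top]

/-- Square integrability in `u`, with decay in `K`, of the part of the strip integrals of `1/ρ`
away from the origin. -/
lemma FarControl.lintegral_sq_le {𝒟 : Set (Matrix (Fin 2) (Fin 2) ℝ)} (h : FarControl p 𝒟)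
    (x : ℝ × ℝ) : ∃ (A : ℝ≥0∞) (η : ℝ), A ≠ ∞ ∧ 0 < η ∧ ∀ D ∈ 𝒟, ∀ K, 1 ≤ K →
      ∫⁻ u, (∫⁻ t in {t | act D t + u ∈ rect x} ∩ {t | K < p.rho t},
        ENNReal.ofReal (p.rho t)⁻¹) ^ 2 ≤ A * ENNReal.ofReal (K ^ (-η)) ^ 2 := by
  obtain ⟨m, v, w, η, C, hm, hv, hw, hη, hC, hmvw, hvt, hmw, hK, hA⟩ := h
  obtain ⟨A, hA, hA'⟩ := hA x
  refine ⟨C ^ 2 * A * (volume (rect x) * ∫⁻ t, v t), η, ?_, hη, fun D hD K hK1 => ?_⟩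
  · have := volume_rect_ne_top x
    finiteness
  set k := ENNReal.ofReal (K ^ (-η))
  -- Cauchy-Schwarz on the strip: the integral of `w` is bounded uniformly, and that of `v` is kept,
  -- to be integrated over `u`.
  have h1 : ∀ u, (∫⁻ t in {t | act D t + u ∈ rect x} ∩ {t | K < p.rho t},
      ENNReal.ofReal (p.rho t)⁻¹) ^ 2 ≤
      (C ^ 2 * A * k ^ 2) * ∫⁻ t in {t | act D t + u ∈ rect x}, v t := fun u => by
    have hE := measurableSet_act_add_mem D x u
    have e1 : ∫⁻ t in {t | act D t + u ∈ rect x} ∩ {t | K < p.rho t}, ENNReal.ofReal (p.rho t)⁻¹ ≤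
        C * k * ∫⁻ t in {t | act D t + u ∈ rect x}, m t := by
      rw [← lintegral_const_mul _ hm]
      refine (setLIntegral_mono (by fun_prop) fun t ht => hK K hK1 t ht.2).trans ?_
      exact lintegral_mono_set Set.inter_subset_left
    calc _ ≤ (C * k * ∫⁻ t in {t | act D t + u ∈ rect x}, m t) ^ 2 := by gcongr
      _ = C ^ 2 * k ^ 2 * (∫⁻ t in {t | act D t + u ∈ rect x}, m t) ^ 2 := by ring
      _ ≤ C ^ 2 * k ^ 2 * ((∫⁻ t in {t | act D t + u ∈ rect x}, v t) * A) := by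
        gcongr
        refine (sq_lintegral_le_mul hv hw hmvw).trans ?_
        gcongr
        exact hA' D hD u
      _ = _ := by ring
  refine (lintegral_mono h1).trans ?_
  rw [lintegral_const_mul' _ _ (by have : k ≠ ∞ := ENNReal.ofReal_ne_top; finiteness),
    lintegral_volume_preimage D x hv]
  exact le_of_eq (by ring)

/-- The strip integrals of `1/ρ` are bounded. -/
lemma FarControl.lintegral_le {𝒟 : Set (Matrix (Fin 2) (Fin 2) ℝ)} (h : FarControl p 𝒟)
    (h₁ : 0 < p.q₁) (h₂ : 0 < p.q₂) (hQ : 1 < p.Q) (x : ℝ × ℝ) :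
    ∃ A : ℝ≥0∞, A ≠ ∞ ∧ ∀ D ∈ 𝒟, ∀ u,
      ∫⁻ t in {t | act D t + u ∈ rect x}, ENNReal.ofReal (p.rho t)⁻¹ ≤ A := by
  obtain ⟨m, v, w, η, C, hm, hv, hw, hη, hC, hmvw, hvt, hmw, hK, hA⟩ := h
  obtain ⟨A, hA, hA'⟩ := hA x
  have hn := lintegral_rho_inv_lt_top h₁ h₂ hQ 1
  refine ⟨(∫⁻ t in {t | p.rho t ≤ 1}, ENNReal.ofReal (p.rho t)⁻¹) + C * A, by finiteness, fun D hD u => ?_⟩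
  have hsub : {t | act D t + u ∈ rect x} ⊆
      {t | p.rho t ≤ 1} ∪ ({t | act D t + u ∈ rect x} ∩ {t | 1 < p.rho t}) := fun t ht => by
    rcases le_or_gt (p.rho t) 1 with h | h
    · exact Or.inl h
    · exact Or.inr ⟨ht, h⟩
  refine (lintegral_mono_set hsub).trans ((lintegral_union_le _ _ _).trans ?_)
  gcongr
  have hE := measurableSet_act_add_mem D x u
  have e1 : ∫⁻ t in {t | act D t + u ∈ rect x} ∩ {t | 1 < p.rho t}, ENNReal.ofReal (p.rho t)⁻¹ ≤
      ∫⁻ t in {t | act D t + u ∈ rect x}, C * w t := by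
    refine (setLIntegral_mono (hw.const_mul C) fun t ht => ?_).trans
      (lintegral_mono_set Set.inter_subset_left)
    refine (hK 1 le_rfl t ht.2).trans ?_
    rw [Real.one_rpow, ENNReal.ofReal_one, mul_one]
    gcongr
    exact hmw t
  refine e1.trans ?_
  rw [lintegral_const_mul _ hw]
  gcongr
  exact hA' D hD u

end Bounds

/-! ### Convergence of the rescaled kernels -/

section Kernels

open scoped ENNReal

open Params

variable {p : Params} {b : ℤ × ℤ → ℝ}

lemma eLpNorm_two_eq (f : ℝ × ℝ → ℝ) :
    eLpNorm f 2 (volume : Measure (ℝ × ℝ)) = (∫⁻ u, ‖f u‖ₑ ^ 2) ^ (1 / 2 : ℝ) := by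
  rw [eLpNorm_eq_lintegral_rpow_enorm_toReal (by norm_num) (by norm_num)]
  simp

lemma sq_add_le (a c : ℝ≥0∞) : (a + c) ^ 2 ≤ 4 * a ^ 2 + 4 * c ^ 2 := by
  rcases le_total a c with h | h
  · calc (a + c) ^ 2 ≤ (c + c) ^ 2 := by gcongr
      _ = 4 * c ^ 2 := by ring
      _ ≤ _ := le_add_self
  · calc (a + c) ^ 2 ≤ (a + a) ^ 2 := by gcongr
      _ = 4 * a ^ 2 := by ring
      _ ≤ _ := le_self_add

/-- The strip integral of `1/ρ`. -/
def strip (p : Params) (D : Matrix (Fin 2) (Fin 2) ℝ) (x : ℝ × ℝ) (u : ℝ × ℝ) : ℝ≥0∞ :=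
  ∫⁻ t in {t | act D t + u ∈ rect x}, ENNReal.ofReal (p.rho t)⁻¹

lemma FarControl.lintegral_strip_sq_lt_top {𝒟 : Set (Matrix (Fin 2) (Fin 2) ℝ)}
    (h : FarControl p 𝒟) (h₁ : 0 < p.q₁) (h₂ : 0 < p.q₂) (hQ : 1 < p.Q)
    {D : Matrix (Fin 2) (Fin 2) ℝ} (hD : D ∈ 𝒟) (x : ℝ × ℝ) :
    ∫⁻ u, strip p D x u ^ 2 < ∞ := by
  obtain ⟨A, η, hA, hη, hF⟩ := h.lintegral_sq_le x
  have hρ := measurable_rho h₁ h₂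
  have hm : MeasurableSet {t | p.rho t ≤ 1} := measurableSet_le hρ measurable_const
  set I := ∫⁻ t in {t | p.rho t ≤ 1}, ENNReal.ofReal (p.rho t)⁻¹ with hI
  have hIt : I < ∞ := lintegral_rho_inv_lt_top h₁ h₂ hQ 1
  set v : ℝ × ℝ → ℝ≥0∞ := {t | p.rho t ≤ 1}.indicator fun t => ENNReal.ofReal (p.rho t)⁻¹ with hv
  have hvm : Measurable v := hρ.inv.ennreal_ofReal.indicator hm
  have hvI : ∫⁻ t, v t = I := lintegral_indicator hm _
  -- The near part is at most `I`, so its square is at most `I` times itself, and integration over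
  -- `u` leaves the area of the rectangle times `I`.
  have h1 : ∀ u, strip p D x u ^ 2 ≤ 4 * (I * ∫⁻ t in {t | act D t + u ∈ rect x}, v t) +
      4 * (∫⁻ t in {t | act D t + u ∈ rect x} ∩ {t | 1 < p.rho t},
        ENNReal.ofReal (p.rho t)⁻¹) ^ 2 := fun u => by
    have e1 : strip p D x u ≤ (∫⁻ t in {t | act D t + u ∈ rect x}, v t) +
        ∫⁻ t in {t | act D t + u ∈ rect x} ∩ {t | 1 < p.rho t}, ENNReal.ofReal (p.rho t)⁻¹ := by
      have hsub : {t | act D t + u ∈ rect x} ⊆ ({t | act D t + u ∈ rect x} ∩ {t | p.rho t ≤ 1}) ∪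
          ({t | act D t + u ∈ rect x} ∩ {t | 1 < p.rho t}) := fun t ht => by
        rcases le_or_gt (p.rho t) 1 with h | h
        · exact Or.inl ⟨ht, h⟩
        · exact Or.inr ⟨ht, h⟩
      refine (lintegral_mono_set hsub).trans ((lintegral_union_le _ _ _).trans ?_)
      refine add_le_add (le_of_eq ?_) le_rfl
      rw [hv, setLIntegral_indicator hm, Set.inter_comm]
    have e2 : ∫⁻ t in {t | act D t + u ∈ rect x}, v t ≤ I := by
      rw [← hvI]; exact setLIntegral_le_lintegral _ _
    refine (pow_le_pow_left' e1 2).trans ((sq_add_le _ _).trans ?_)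
    gcongr
    rw [sq]
    gcongr
  refine (lintegral_mono h1).trans_lt ?_
  have hm1 : Measurable fun u => ∫⁻ t in {t | act D t + u ∈ rect x}, v t := by
    have hms : MeasurableSet {z : (ℝ × ℝ) × (ℝ × ℝ) | act D z.2 + z.1 ∈ rect x} :=
      (measurableSet_rect x).preimage (((measurable_act D).comp measurable_snd).add measurable_fst)
    have h3 : (fun u => ∫⁻ t in {t | act D t + u ∈ rect x}, v t) = fun u => ∫⁻ t,
        {z : (ℝ × ℝ) × (ℝ × ℝ) | act D z.2 + z.1 ∈ rect x}.indicator (fun z => v z.2) (u, t) := by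
      funext u
      rw [← lintegral_indicator (measurableSet_act_add_mem D x u)]
      rfl
    rw [h3]
    exact ((hvm.comp measurable_snd).indicator hms).lintegral_prod_right'
  rw [lintegral_add_left ((hm1.const_mul _).const_mul _), lintegral_const_mul _ (hm1.const_mul _),
    lintegral_const_mul _ hm1, lintegral_volume_preimage D x hvm, hvI,
    lintegral_const_mul' _ _ (by norm_num)]
  have h5 := hF D hD 1 le_rfl
  rw [Real.one_rpow, ENNReal.ofReal_one, one_pow, mul_one] at h5
  have h6 := volume_rect_ne_top x
  have h7 := h5.trans_lt hA.lt_top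
  finiteness

lemma IsCoefficient.enorm_aInf_le (hb : IsCoefficient p b) : ∃ C : ℝ≥0∞, C ≠ ∞ ∧
    ∀ t, ‖p.aInf t‖ₑ ≤ C * ENNReal.ofReal (p.rho t)⁻¹ := by
  obtain ⟨M, hM0, hM⟩ := hb.exists_abs_L_le
  refine ⟨ENNReal.ofReal M, by simp, fun t => ?_⟩
  rw [← ENNReal.ofReal_mul hM0, ← ofReal_norm, Real.norm_eq_abs]
  refine ENNReal.ofReal_le_ofReal ?_
  rw [aInf, abs_mul, abs_of_nonneg (inv_nonneg.2 (p.rho_nonneg t)), mul_comm]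
  exact mul_le_mul_of_nonneg_right (hM t) (inv_nonneg.2 (p.rho_nonneg t))

lemma measurable_innerV (hb : IsCoefficient p b) (D : Matrix (Fin 2) (Fin 2) ℝ) (x : ℝ × ℝ) :
    Measurable fun z : (ℝ × ℝ) × (ℝ × ℝ) => innerV p D x z.1 z.2 := by
  have hms : MeasurableSet {z : (ℝ × ℝ) × (ℝ × ℝ) | act D z.2 + z.1 ∈ rect x} :=
    (measurableSet_rect x).preimage (((measurable_act D).comp measurable_snd).add measurable_fst)
  exact (hb.measurable_aInf.comp measurable_snd).indicator hms

lemma measurable_kernelV (hb : IsCoefficient p b) (D : Matrix (Fin 2) (Fin 2) ℝ) (x : ℝ × ℝ) :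
    Measurable (kernelV p D x) :=
  ((measurable_innerV hb D x).stronglyMeasurable.integral_prod_right').measurable.const_mul _

lemma lintegral_enorm_innerV_le (hb : IsCoefficient p b) : ∃ C : ℝ≥0∞, C ≠ ∞ ∧
    ∀ D x u, ∫⁻ t, ‖innerV p D x u t‖ₑ ≤ C * strip p D x u := by
  obtain ⟨C, hC, hC'⟩ := hb.enorm_aInf_le
  refine ⟨C, hC, fun D x u => ?_⟩
  simp only [innerV, enorm_indicator_eq_indicator_enorm]
  rw [lintegral_indicator (measurableSet_act_add_mem D x u), strip, ← lintegral_const_mul' _ _ hC]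
  exact lintegral_mono fun t => hC' t

lemma FarControl.integrable_innerV {𝒟 : Set (Matrix (Fin 2) (Fin 2) ℝ)}
    (h : FarControl p 𝒟) (hb : IsCoefficient p b) {D : Matrix (Fin 2) (Fin 2) ℝ} (hD : D ∈ 𝒟)
    (x u : ℝ × ℝ) : Integrable (innerV p D x u) := by
  obtain ⟨C, hC, hC'⟩ := lintegral_enorm_innerV_le hb
  obtain ⟨A, hA, hA'⟩ := h.lintegral_le hb.q₁_pos hb.q₂_pos hb.one_lt_Q x
  refine ⟨((measurable_innerV hb D x).comp measurable_prodMk_left).aestronglyMeasurable, ?_⟩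
  refine (hC' D x u).trans_lt (ENNReal.mul_lt_top hC.lt_top ?_)
  exact (hA' D hD u).trans_lt hA.lt_top

lemma FarControl.memLp_kernelV {𝒟 : Set (Matrix (Fin 2) (Fin 2) ℝ)}
    (h : FarControl p 𝒟) (hb : IsCoefficient p b) {D : Matrix (Fin 2) (Fin 2) ℝ} (hD : D ∈ 𝒟)
    (x : ℝ × ℝ) : MemLp (kernelV p D x) 2 (volume : Measure (ℝ × ℝ)) := by
  obtain ⟨C, hC, hC'⟩ := lintegral_enorm_innerV_le hb
  have hs := h.lintegral_strip_sq_lt_top hb.q₁_pos hb.q₂_pos hb.one_lt_Q hD x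
  refine ⟨(measurable_kernelV hb D x).aestronglyMeasurable, ?_⟩
  rw [eLpNorm_two_eq]
  refine ENNReal.rpow_lt_top_of_nonneg (by norm_num) (ne_of_lt ?_)
  refine (lintegral_mono fun u => ?_).trans_lt (b := ∫⁻ u, (‖|p.B.det|⁻¹‖ₑ * C) ^ 2 * strip p D x u ^ 2) ?_
  · rw [kernelV, enorm_mul, ← mul_pow, mul_assoc]
    gcongr
    exact (enorm_integral_le_lintegral_enorm _).trans (hC' D x u)
  · rw [lintegral_const_mul' _ _ (by finiteness)]
    finiteness

lemma FarControl.wellDefinedV {𝒟 : Set (Matrix (Fin 2) (Fin 2) ℝ)}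
    (h : FarControl p 𝒟) (hb : IsCoefficient p b) {D : Matrix (Fin 2) (Fin 2) ℝ} (hD : D ∈ 𝒟) :
    WellDefinedV p D := fun x _ =>
  ⟨Eventually.of_forall fun u => h.integrable_innerV hb hD x u, h.memLp_kernelV hb hD x⟩

/-- The rescaled coefficient. -/
def resc (p : Params) (b : ℤ × ℤ → ℝ) (μ : ℝ) (t : ℝ × ℝ) : ℝ :=
  μ * b (floorPair (act p.B⁻¹ (p.dil μ t)))

/-- The rescaled integer point. -/
def latticePt (p : Params) (γ κ lam : ℝ) (u t : ℝ × ℝ) : ℝ × ℝ :=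
  (lam⁻¹ * ((floorPair (act p.B⁻¹ (p.dil (lam ^ κ) t))).1 + ⌊lam * u.1⌋ : ℤ),
    (lam ^ γ)⁻¹ * ((floorPair (act p.B⁻¹ (p.dil (lam ^ κ) t))).2 + ⌊lam ^ γ * u.2⌋ : ℤ))

/-- The rescaled matrix. -/
def scaledMat (p : Params) (γ κ lam : ℝ) : Matrix (Fin 2) (Fin 2) ℝ :=
  !![lam⁻¹ * (p.B⁻¹ 0 0 * (lam ^ κ) ^ (1 / p.q₁)), lam⁻¹ * (p.B⁻¹ 0 1 * (lam ^ κ) ^ (1 / p.q₂));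
    (lam ^ γ)⁻¹ * (p.B⁻¹ 1 0 * (lam ^ κ) ^ (1 / p.q₁)),
    (lam ^ γ)⁻¹ * (p.B⁻¹ 1 1 * (lam ^ κ) ^ (1 / p.q₂))]

lemma act_scaledMat (p : Params) (γ κ lam : ℝ) (t : ℝ × ℝ) : act (scaledMat p γ κ lam) t =
    (lam⁻¹ * (act p.B⁻¹ (p.dil (lam ^ κ) t)).1, (lam ^ γ)⁻¹ * (act p.B⁻¹ (p.dil (lam ^ κ) t)).2) := by
  simp only [act, scaledMat, dil, Matrix.of_apply, Matrix.cons_val_zero, Matrix.cons_val_one,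
    Matrix.cons_val', Matrix.cons_val_fin_one]
  ext <;> simp <;> ring

/-- Two integer parts are taken, each losing less than one unit before division by `l`. -/
lemma latticePt_aux {l : ℝ} (hl : 0 < l) (a s : ℝ) :
    l⁻¹ * (⌊a⌋ + ⌊l * s⌋ : ℤ) ≤ l⁻¹ * a + s ∧ l⁻¹ * a + s ≤ l⁻¹ * (⌊a⌋ + ⌊l * s⌋ : ℤ) + 2 * l⁻¹ := by
  have e : l⁻¹ * a + s = l⁻¹ * (a + l * s) := by field_simp
  have h1 := Int.floor_le a
  have h2 := (Int.lt_floor_add_one a).le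
  have h3 := Int.floor_le (l * s)
  have h4 := (Int.lt_floor_add_one (l * s)).le
  have h5 : (0 : ℝ) ≤ l⁻¹ := by positivity
  rw [e]
  push_cast
  constructor
  · exact mul_le_mul_of_nonneg_left (by linarith) h5
  · rw [mul_comm 2, ← mul_add]
    exact mul_le_mul_of_nonneg_left (by linarith) h5

/-- For `λ ≥ 1` the rounding costs at most `2` in each coordinate; enlarging the rectangle replaces
the rounded region by a true strip, to which the uniform bounds apply. -/
lemma mem_rect_of_latticePt_mem {γ κ lam : ℝ} (hγ : 0 < γ) (hlam : 1 ≤ lam) {x u t : ℝ × ℝ}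
    (h : latticePt p γ κ lam u t ∈ rect x) :
    act (scaledMat p γ κ lam) t + u ∈ rect (x.1 + 2, x.2 + 2) := by
  have hl0 : 0 < lam := one_pos.trans_le hlam
  have hg0 : 0 < lam ^ γ := Real.rpow_pos_of_pos hl0 _
  have e1 : lam⁻¹ ≤ 1 := inv_le_one_of_one_le₀ hlam
  have e2 : (lam ^ γ)⁻¹ ≤ 1 := inv_le_one_of_one_le₀ (Real.one_le_rpow hlam hγ.le)
  obtain ⟨⟨h1, h2⟩, ⟨h3, h4⟩⟩ := h
  obtain ⟨a1, a2⟩ := latticePt_aux hl0 (act p.B⁻¹ (p.dil (lam ^ κ) t)).1 u.1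
  obtain ⟨a3, a4⟩ := latticePt_aux hg0 (act p.B⁻¹ (p.dil (lam ^ κ) t)).2 u.2
  rw [act_scaledMat]
  simp only [latticePt, floorPair] at h1 h2 h3 h4
  refine ⟨⟨?_, ?_⟩, ⟨?_, ?_⟩⟩ <;> simp only [Prod.fst_add, Prod.snd_add] <;> linarith

lemma tendsto_latticePt {γ κ : ℝ} (hγ : 0 < γ) {D : Matrix (Fin 2) (Fin 2) ℝ} {t u : ℝ × ℝ}
    (hD : Tendsto (fun lam => act (scaledMat p γ κ lam) t) atTop (𝓝 (act D t))) :
    Tendsto (fun lam => latticePt p γ κ lam u t) atTop (𝓝 (act D t + u)) := by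
  have h1 : Tendsto (fun lam => act (scaledMat p γ κ lam) t + u) atTop (𝓝 (act D t + u)) :=
    hD.add_const u
  have key : ∀ {l : ℝ → ℝ} {f g : ℝ → ℝ} {c : ℝ}, Tendsto l atTop atTop → Tendsto f atTop (𝓝 c) →
      (∀ᶠ lam in atTop, g lam ≤ f lam ∧ f lam ≤ g lam + 2 * (l lam)⁻¹) → Tendsto g atTop (𝓝 c) := by
    intro l f g c hl hf hg
    have h2 : Tendsto (fun lam => f lam - 2 * (l lam)⁻¹) atTop (𝓝 c) := by
      have := hf.sub ((tendsto_inv_atTop_zero.comp hl).const_mul 2)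
      simpa using this
    refine tendsto_of_tendsto_of_tendsto_of_le_of_le' h2 hf ?_ ?_
    · filter_upwards [hg] with lam h; linarith [h.2]
    · filter_upwards [hg] with lam h; exact h.1
  refine Tendsto.prodMk_nhds (key tendsto_id ((continuous_fst.tendsto _).comp h1) ?_)
    (key (tendsto_rpow_atTop hγ) ((continuous_snd.tendsto _).comp h1) ?_)
  · filter_upwards [eventually_gt_atTop 0] with lam hlam
    simp only [Function.comp_apply, act_scaledMat, Prod.fst_add]
    exact latticePt_aux hlam _ _
  · filter_upwards [eventually_gt_atTop 0] with lam hlam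
    simp only [Function.comp_apply, act_scaledMat, Prod.snd_add]
    exact latticePt_aux (Real.rpow_pos_of_pos hlam _) _ _

lemma measurable_dil (μ : ℝ) : Measurable (p.dil μ) := by unfold dil; fun_prop

lemma measurable_floorPair_act (p : Params) (μ : ℝ) :
    Measurable fun t => floorPair (act p.B⁻¹ (p.dil μ t)) :=
  measurable_floorPair.comp ((measurable_act _).comp (measurable_dil μ))

lemma measurable_resc (p : Params) (b : ℤ × ℤ → ℝ) (μ : ℝ) : Measurable (resc p b μ) :=
  ((measurable_of_countable b).comp (measurable_floorPair_act p μ)).const_mul μ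

lemma measurable_latticePt (p : Params) (γ κ lam : ℝ) :
    Measurable fun z : (ℝ × ℝ) × (ℝ × ℝ) => latticePt p γ κ lam z.1 z.2 := by
  have h := (measurable_floorPair_act p (lam ^ κ)).comp
    (measurable_snd : Measurable fun z : (ℝ × ℝ) × (ℝ × ℝ) => z.2)
  have hc : Measurable (fun n : ℤ => (n : ℝ)) := measurable_of_countable _
  refine Measurable.prodMk ((hc.comp ((measurable_fst.comp h).add ?_)).const_mul _)
    ((hc.comp ((measurable_snd.comp h).add ?_)).const_mul _)
  · exact Int.measurable_floor.comp (by fun_prop)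
  · exact Int.measurable_floor.comp (by fun_prop)

/-- The integrand of the rescaled kernel. -/
def innerLam (p : Params) (b : ℤ × ℤ → ℝ) (γ κ lam : ℝ) (x u : ℝ × ℝ) : ℝ × ℝ → ℝ :=
  Set.indicator {t | latticePt p γ κ lam u t ∈ rect x} (resc p b (lam ^ κ))

/-- The rescaled kernel of the partial sums. -/
def kernelLam (p : Params) (b : ℤ × ℤ → ℝ) (γ κ lam : ℝ) (x u : ℝ × ℝ) : ℝ :=
  |p.B.det|⁻¹ * ∫ t, innerLam p b γ κ lam x u t

lemma measurable_innerLam (p : Params) (b : ℤ × ℤ → ℝ) (γ κ lam : ℝ) (x : ℝ × ℝ) :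
    Measurable fun z : (ℝ × ℝ) × (ℝ × ℝ) => innerLam p b γ κ lam x z.1 z.2 :=
  ((measurable_resc p b _).comp measurable_snd).indicator
    ((measurableSet_rect x).preimage (measurable_latticePt p γ κ lam))

lemma measurable_kernelLam (p : Params) (b : ℤ × ℤ → ℝ) (γ κ lam : ℝ) (x : ℝ × ℝ) :
    Measurable (kernelLam p b γ κ lam x) :=
  ((measurable_innerLam p b γ κ lam x).stronglyMeasurable.integral_prod_right').measurable.const_mul _

/-- Common domination of the rescaled and of the limiting integrands. -/
lemma IsCoefficient.exists_enorm_le (hb : IsCoefficient p b) : ∃ C : ℝ≥0∞, C ≠ ∞ ∧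
    (∀ μ, 0 < μ → ∀ᵐ t, ‖resc p b μ t‖ₑ ≤ C * ENNReal.ofReal (p.rho t)⁻¹) ∧
    ∀ t, ‖p.aInf t‖ₑ ≤ C * ENNReal.ofReal (p.rho t)⁻¹ := by
  obtain ⟨C, hC, hC'⟩ := hb.enorm_aInf_le
  obtain ⟨C₂, hC₂, hC₂'⟩ := hb.exists_abs_rescaled_le
  refine ⟨max C (ENNReal.ofReal C₂), (max_lt hC.lt_top (by simp)).ne, fun μ hμ => ?_, fun t =>
    (hC' t).trans (by gcongr; exact le_max_left _ _)⟩
  filter_upwards [ae_snd_ne_zero] with t ht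
  rcases hC₂' μ hμ t with h | h
  · refine le_trans ?_ (mul_le_mul_left (le_max_right _ _) _)
    rw [← ENNReal.ofReal_mul hC₂, ← ofReal_norm]
    exact ENNReal.ofReal_le_ofReal h
  · exact absurd h (rho_pos_of_snd_ne_zero ht).ne'

end Kernels

/-! ### Convergence of the rescaled kernels in L²: near and far parts -/

section Convergence

open scoped ENNReal

open Params

variable {p : Params} {b : ℤ × ℤ → ℝ}

/-- The rescaled matrices stay in a class with uniform strip bounds and converge to `D`. -/
structure IsScaling (p : Params) (γ κ : ℝ) (𝒟 : Set (Matrix (Fin 2) (Fin 2) ℝ))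
    (D : Matrix (Fin 2) (Fin 2) ℝ) : Prop where
  γ_pos : 0 < γ
  κ_pos : 0 < κ
  far : FarControl p 𝒟
  limit_mem : D ∈ 𝒟
  scaled_mem : ∀ lam, 1 ≤ lam → scaledMat p γ κ lam ∈ 𝒟
  tendsto : ∀ t, Tendsto (fun lam => act (scaledMat p γ κ lam) t) atTop (𝓝 (act D t))

lemma rect_subset (x : ℝ × ℝ) : rect x ⊆ rect (x.1 + 2, x.2 + 2) := fun y hy =>
  ⟨⟨hy.1.1, hy.1.2.trans (by simp)⟩, ⟨hy.2.1, hy.2.2.trans (by simp)⟩⟩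

/-- One majorant for both integrands. The enlarged rectangle is used for the limit too, so that a
single estimate controls both kernels. -/
lemma IsCoefficient.exists_setLIntegral_le (hb : IsCoefficient p b) : ∃ C : ℝ≥0∞, C ≠ ∞ ∧
    (∀ γ κ lam, 0 < γ → 1 ≤ lam → ∀ x u, ∀ S : Set (ℝ × ℝ), MeasurableSet S →
      ∫⁻ t in S, ‖innerLam p b γ κ lam x u t‖ₑ ≤ C * ∫⁻ t in
        {t | act (scaledMat p γ κ lam) t + u ∈ rect (x.1 + 2, x.2 + 2)} ∩ S,
          ENNReal.ofReal (p.rho t)⁻¹) ∧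
    ∀ D x u, ∀ S : Set (ℝ × ℝ), MeasurableSet S → ∫⁻ t in S, ‖innerV p D x u t‖ₑ ≤
      C * ∫⁻ t in {t | act D t + u ∈ rect (x.1 + 2, x.2 + 2)} ∩ S, ENNReal.ofReal (p.rho t)⁻¹ := by
  obtain ⟨C, hC, h1, h2⟩ := hb.exists_enorm_le
  refine ⟨C, hC, fun γ κ lam hγ hlam x u S hS => ?_, fun D x u S hS => ?_⟩
  · have hE := measurableSet_act_add_mem (scaledMat p γ κ lam) (x.1 + 2, x.2 + 2) u
    rw [← lintegral_const_mul' _ _ hC, ← setLIntegral_indicator hE]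
    refine lintegral_mono_ae (ae_restrict_of_ae ?_)
    filter_upwards [h1 (lam ^ κ) (Real.rpow_pos_of_pos (one_pos.trans_le hlam) _)] with t ht
    by_cases h : latticePt p γ κ lam u t ∈ rect x
    · have h' := mem_rect_of_latticePt_mem hγ hlam h
      rw [innerLam, Set.indicator_of_mem (by exact h), Set.indicator_of_mem (by exact h')]
      exact ht
    · rw [innerLam, Set.indicator_of_notMem (by exact h), enorm_zero]
      exact zero_le
  · have hE := measurableSet_act_add_mem D (x.1 + 2, x.2 + 2) u
    rw [← lintegral_const_mul' _ _ hC, ← setLIntegral_indicator hE]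
    refine lintegral_mono fun t => ?_
    by_cases h : act D t + u ∈ rect x
    · have h' := rect_subset x h
      rw [innerV, Set.indicator_of_mem (by exact h), Set.indicator_of_mem (by exact h')]
      exact h2 t
    · rw [innerV, Set.indicator_of_notMem (by exact h), enorm_zero]
      exact zero_le

variable {γ κ : ℝ} {𝒟 : Set (Matrix (Fin 2) (Fin 2) ℝ)} {D : Matrix (Fin 2) (Fin 2) ℝ}

lemma IsScaling.lintegral_innerLam_le (h : IsScaling p γ κ 𝒟 D) (hb : IsCoefficient p b) :
    ∃ C : ℝ≥0∞, C ≠ ∞ ∧ ∀ lam, 1 ≤ lam → ∀ x u, ∫⁻ t, ‖innerLam p b γ κ lam x u t‖ₑ ≤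
      C * strip p (scaledMat p γ κ lam) (x.1 + 2, x.2 + 2) u := by
  obtain ⟨C, hC, h1, -⟩ := hb.exists_setLIntegral_le
  refine ⟨C, hC, fun lam hlam x u => ?_⟩
  have := h1 γ κ lam h.γ_pos hlam x u Set.univ MeasurableSet.univ
  rwa [Set.inter_univ, setLIntegral_univ] at this

lemma IsScaling.integrable_innerLam (h : IsScaling p γ κ 𝒟 D) (hb : IsCoefficient p b)
    {lam : ℝ} (hlam : 1 ≤ lam) (x u : ℝ × ℝ) : Integrable (innerLam p b γ κ lam x u) := by
  obtain ⟨C, hC, h1⟩ := h.lintegral_innerLam_le hb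
  obtain ⟨A, hA, hA'⟩ := h.far.lintegral_le hb.q₁_pos hb.q₂_pos hb.one_lt_Q (x.1 + 2, x.2 + 2)
  refine ⟨((measurable_innerLam p b γ κ lam x).comp measurable_prodMk_left).aestronglyMeasurable, ?_⟩
  refine (h1 lam hlam x u).trans_lt (ENNReal.mul_lt_top hC.lt_top ?_)
  exact (hA' _ (h.scaled_mem lam hlam) u).trans_lt hA.lt_top

lemma IsScaling.exists_abs_kernelLam_le (h : IsScaling p γ κ 𝒟 D) (hb : IsCoefficient p b)
    (x : ℝ × ℝ) : ∃ A, ∀ lam, 1 ≤ lam → ∀ u, |kernelLam p b γ κ lam x u| ≤ A := by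
  obtain ⟨C, hC, h1⟩ := h.lintegral_innerLam_le hb
  obtain ⟨A, hA, hA'⟩ := h.far.lintegral_le hb.q₁_pos hb.q₂_pos hb.one_lt_Q (x.1 + 2, x.2 + 2)
  refine ⟨|p.B.det|⁻¹ * (C * A).toReal, fun lam hlam u => ?_⟩
  rw [kernelLam, abs_mul, abs_inv, abs_abs]
  gcongr
  have h2 : ENNReal.ofReal |∫ t, innerLam p b γ κ lam x u t| ≤ C * A := by
    rw [← Real.norm_eq_abs, ofReal_norm]
    refine (enorm_integral_le_lintegral_enorm _).trans ((h1 lam hlam x u).trans ?_)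
    gcongr
    exact hA' _ (h.scaled_mem lam hlam) u
  exact (ENNReal.ofReal_le_iff_le_toReal (by finiteness)).1 h2

lemma IsScaling.memLp_kernelLam (h : IsScaling p γ κ 𝒟 D) (hb : IsCoefficient p b)
    {lam : ℝ} (hlam : 1 ≤ lam) (x : ℝ × ℝ) :
    MemLp (kernelLam p b γ κ lam x) 2 (volume : Measure (ℝ × ℝ)) := by
  obtain ⟨C, hC, h1⟩ := h.lintegral_innerLam_le hb
  have hs := h.far.lintegral_strip_sq_lt_top hb.q₁_pos hb.q₂_pos hb.one_lt_Q
    (h.scaled_mem lam hlam) (x.1 + 2, x.2 + 2)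
  refine ⟨(measurable_kernelLam p b γ κ lam x).aestronglyMeasurable, ?_⟩
  rw [eLpNorm_two_eq]
  refine ENNReal.rpow_lt_top_of_nonneg (by norm_num) (ne_of_lt ?_)
  refine (lintegral_mono fun u => ?_).trans_lt (b := ∫⁻ u, (‖|p.B.det|⁻¹‖ₑ * C) ^ 2 *
    strip p (scaledMat p γ κ lam) (x.1 + 2, x.2 + 2) u ^ 2) ?_
  · rw [kernelLam, enorm_mul, ← mul_pow, mul_assoc]
    gcongr
    exact (enorm_integral_le_lintegral_enorm _).trans (h1 lam hlam x u)
  · rw [lintegral_const_mul' _ _ (by finiteness)]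
    finiteness

lemma eventually_mem_Ioc_iff {a c : ℝ} (h0 : a ≠ 0) (hc : a ≠ c) :
    ∀ᶠ z in 𝓝 a, (z ∈ Set.Ioc 0 c ↔ a ∈ Set.Ioc 0 c) := by
  have h1 : ∀ᶠ z in 𝓝 a, (0 < z ↔ 0 < a) := by
    rcases lt_or_gt_of_ne h0 with h | h
    · filter_upwards [gt_mem_nhds h] with z hz
      exact ⟨fun h' => absurd h' (not_lt.2 hz.le), fun h' => absurd h' (not_lt.2 h.le)⟩
    · filter_upwards [lt_mem_nhds h] with z hz
      exact ⟨fun _ => h, fun _ => hz⟩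
  have h2 : ∀ᶠ z in 𝓝 a, (z ≤ c ↔ a ≤ c) := by
    rcases lt_or_gt_of_ne hc with h | h
    · filter_upwards [gt_mem_nhds h] with z hz
      exact ⟨fun _ => h.le, fun _ => hz.le⟩
    · filter_upwards [lt_mem_nhds h] with z hz
      exact ⟨fun h' => absurd h' (not_le.2 hz), fun h' => absurd h' (not_le.2 h)⟩
  filter_upwards [h1, h2] with z a1 a2
  simp only [Set.mem_Ioc, a1, a2]

lemma eventually_mem_rect_iff {y x : ℝ × ℝ} (h1 : y.1 ≠ 0 ∧ y.1 ≠ x.1) (h2 : y.2 ≠ 0 ∧ y.2 ≠ x.2) :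
    ∀ᶠ z in 𝓝 y, (z ∈ rect x ↔ y ∈ rect x) := by
  filter_upwards [continuousAt_fst.eventually (eventually_mem_Ioc_iff h1.1 h1.2),
    continuousAt_snd.eventually (eventually_mem_Ioc_iff h2.1 h2.2)] with z a1 a2
  simp only [rect, Set.mem_prod, a1, a2]

/-- For fixed `t` the bad `u` lie on four lines, and Fubini exchanges the quantifiers. With singular
`D`, an exceptional `u` can put every `t` on the boundary, hence the order. -/
lemma ae_ne_boundary (D : Matrix (Fin 2) (Fin 2) ℝ) (x : ℝ × ℝ) :
    ∀ᵐ u : ℝ × ℝ, ∀ᵐ t : ℝ × ℝ, ((act D t + u).1 ≠ 0 ∧ (act D t + u).1 ≠ x.1) ∧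
      ((act D t + u).2 ≠ 0 ∧ (act D t + u).2 ≠ x.2) := by
  have hm : MeasurableSet {z : (ℝ × ℝ) × (ℝ × ℝ) |
      ((act D z.1 + z.2).1 ≠ 0 ∧ (act D z.1 + z.2).1 ≠ x.1) ∧
      ((act D z.1 + z.2).2 ≠ 0 ∧ (act D z.1 + z.2).2 ≠ x.2)} := by
    have hc : Measurable fun z : (ℝ × ℝ) × (ℝ × ℝ) => act D z.1 + z.2 :=
      ((measurable_act D).comp measurable_fst).add measurable_snd
    have hs : MeasurableSet {y : ℝ × ℝ | (y.1 ≠ 0 ∧ y.1 ≠ x.1) ∧ (y.2 ≠ 0 ∧ y.2 ≠ x.2)} := by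
      refine MeasurableSet.inter (MeasurableSet.inter ?_ ?_) (MeasurableSet.inter ?_ ?_)
      · exact measurable_fst (measurableSet_singleton 0).compl
      · exact measurable_fst (measurableSet_singleton x.1).compl
      · exact measurable_snd (measurableSet_singleton 0).compl
      · exact measurable_snd (measurableSet_singleton x.2).compl
    exact hc hs
  refine (Measure.ae_ae_comm (p := fun t u : ℝ × ℝ =>
    ((act D t + u).1 ≠ 0 ∧ (act D t + u).1 ≠ x.1) ∧
      ((act D t + u).2 ≠ 0 ∧ (act D t + u).2 ≠ x.2)) hm).1 (Eventually.of_forall fun t => ?_)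
  have h1 : ∀ c : ℝ, ∀ᵐ u : ℝ × ℝ, (act D t + u).1 ≠ c := fun c => by
    have := (Measure.quasiMeasurePreserving_fst (μ := (volume : Measure ℝ))
      (ν := (volume : Measure ℝ))).ae (p := fun y => (act D t).1 + y ≠ c) (by
        have : {y : ℝ | ¬ (act D t).1 + y ≠ c} ⊆ {c - (act D t).1} := fun y hy => by
          have hy' : (act D t).1 + y = c := not_not.1 hy
          exact Set.mem_singleton_iff.2 (by linarith)
        exact measure_mono_null this (by simp))
    exact this
  have h2 : ∀ c : ℝ, ∀ᵐ u : ℝ × ℝ, (act D t + u).2 ≠ c := fun c => by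
    have := (Measure.quasiMeasurePreserving_snd (μ := (volume : Measure ℝ))
      (ν := (volume : Measure ℝ))).ae (p := fun y => (act D t).2 + y ≠ c) (by
        have : {y : ℝ | ¬ (act D t).2 + y ≠ c} ⊆ {c - (act D t).2} := fun y hy => by
          have hy' : (act D t).2 + y = c := not_not.1 hy
          exact Set.mem_singleton_iff.2 (by linarith)
        exact measure_mono_null this (by simp))
    exact this
  filter_upwards [h1 0, h1 x.1, h2 0, h2 x.2] with u a1 a2 a3 a4
  exact ⟨⟨a1, a2⟩, ⟨a3, a4⟩⟩

lemma IsScaling.tendsto_innerLam (h : IsScaling p γ κ 𝒟 D) (hb : IsCoefficient p b) (x : ℝ × ℝ) :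
    ∀ᵐ u : ℝ × ℝ, ∀ᵐ t : ℝ × ℝ, Tendsto (fun lam => innerLam p b γ κ lam x u t) atTop
      (𝓝 (innerV p D x u t)) := by
  filter_upwards [ae_ne_boundary D x] with u hu
  filter_upwards [hu, ae_snd_ne_zero] with t h1 h2
  have h3 := (tendsto_latticePt (u := u) h.γ_pos (h.tendsto t)).eventually
    (eventually_mem_rect_iff h1.1 h1.2)
  have h4 := (hb.tendsto_rescaled h2).comp (tendsto_rpow_atTop h.κ_pos)
  by_cases hm : act D t + u ∈ rect x
  · rw [innerV, Set.indicator_of_mem (by exact hm)]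
    refine h4.congr' ?_
    filter_upwards [h3] with lam h5
    rw [innerLam, Set.indicator_of_mem (by exact h5.2 hm)]
    rfl
  · rw [innerV, Set.indicator_of_notMem (by exact hm)]
    refine tendsto_const_nhds.congr' ?_
    filter_upwards [h3] with lam h5
    rw [innerLam, Set.indicator_of_notMem (by exact fun h' => hm (h5.1 h'))]

lemma norm_le_of_enorm_le {C : ℝ≥0∞} (hC : C ≠ ∞) {y r : ℝ} (hr : 0 ≤ r)
    (h : ‖y‖ₑ ≤ C * ENNReal.ofReal r) : ‖y‖ ≤ C.toReal * r := by
  rw [← ofReal_norm] at h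
  have := (ENNReal.ofReal_le_iff_le_toReal (by finiteness)).1 h
  rwa [ENNReal.toReal_mul, ENNReal.toReal_ofReal hr] at this

lemma IsScaling.tendsto_near (h : IsScaling p γ κ 𝒟 D) (hb : IsCoefficient p b) (x : ℝ × ℝ)
    (K : ℝ) : ∀ᵐ u : ℝ × ℝ, Tendsto
      (fun lam => ∫ t in {t | p.rho t ≤ K}, innerLam p b γ κ lam x u t) atTop
      (𝓝 (∫ t in {t | p.rho t ≤ K}, innerV p D x u t)) := by
  obtain ⟨C, hC, h1, -⟩ := hb.exists_enorm_le
  filter_upwards [h.tendsto_innerLam hb x] with u hu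
  refine tendsto_integral_filter_of_dominated_convergence (fun t => C.toReal * (p.rho t)⁻¹)
    (Eventually.of_forall fun lam =>
      ((measurable_innerLam p b γ κ lam x).comp measurable_prodMk_left).aestronglyMeasurable)
    ?_ ?_ (ae_restrict_of_ae hu)
  · filter_upwards [eventually_gt_atTop 0] with lam hlam
    refine ae_restrict_of_ae ?_
    filter_upwards [h1 (lam ^ κ) (Real.rpow_pos_of_pos hlam _)] with t ht
    have h3 := inv_nonneg.2 (p.rho_nonneg t)
    refine (norm_indicator_le_norm_self _ _).trans (norm_le_of_enorm_le hC h3 ht)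
  · refine Integrable.const_mul ⟨?_, ?_⟩ _
    · exact (measurable_rho hb.q₁_pos hb.q₂_pos).inv.aestronglyMeasurable
    · refine lt_of_le_of_lt (lintegral_mono fun t => ?_)
        (lintegral_rho_inv_lt_top hb.q₁_pos hb.q₂_pos hb.one_lt_Q K)
      rw [← ofReal_norm, Real.norm_of_nonneg (inv_nonneg.2 (p.rho_nonneg t))]

lemma norm_act_le (D : Matrix (Fin 2) (Fin 2) ℝ) (t : ℝ × ℝ) :
    ‖act D t‖ ≤ ‖t‖ * (‖act D (1, 0)‖ + ‖act D (0, 1)‖) := by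
  have h1 : act D t = t.1 • act D (1, 0) + t.2 • act D (0, 1) := by
    ext <;> simp [act] <;> ring
  rw [h1, mul_add]
  refine (norm_add_le _ _).trans ?_
  rw [norm_smul, norm_smul]
  gcongr
  · exact norm_fst_le t
  · exact norm_snd_le t

lemma norm_le_of_mem_rect {x y : ℝ × ℝ} (h : y ∈ rect x) : ‖y‖ ≤ ‖x‖ := by
  obtain ⟨⟨h1, h2⟩, ⟨h3, h4⟩⟩ := h
  rw [Prod.norm_def, Prod.norm_def, Real.norm_of_nonneg h1.le, Real.norm_of_nonneg h3.le]
  exact max_le_max (h2.trans (le_abs_self _)) (h4.trans (le_abs_self _))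

/-- The near parts have a common bounded support. -/
lemma IsScaling.exists_support (h : IsScaling p γ κ 𝒟 D) (hb : IsCoefficient p b) (x : ℝ × ℝ)
    (K : ℝ) : ∃ R, ∀ᶠ lam in atTop, ∀ D' ∈ ({D, scaledMat p γ κ lam} : Set _), ∀ u t,
      act D' t + u ∈ rect x → p.rho t ≤ K → u ∈ Metric.closedBall (0 : ℝ × ℝ) R := by
  set M := max (K ^ (1 / p.q₁)) (K ^ (1 / p.q₂))
  have hM : ∀ t, p.rho t ≤ K → ‖t‖ ≤ M := fun t ht => by
    have h₁ := hb.q₁_pos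
    have h₂ := hb.q₂_pos
    exact max_le_max ((abs_fst_le_rho_rpow h₁ t).trans
        (Real.rpow_le_rpow (p.rho_nonneg t) ht (by positivity)))
      ((abs_snd_le_rho_rpow h₂ t).trans
        (Real.rpow_le_rpow (p.rho_nonneg t) ht (by positivity)))
  -- The images of the basis vectors converge, so the added unit lets `N` bound the scaled matrices
  -- eventually, and the limit as well.
  set N := ‖act D (1, 0)‖ + ‖act D (0, 1)‖ + 1 with hN
  have h1 : ∀ᶠ lam in atTop, ‖act (scaledMat p γ κ lam) (1, 0)‖ +
      ‖act (scaledMat p γ κ lam) (0, 1)‖ < N :=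
    ((h.tendsto (1, 0)).norm.add (h.tendsto (0, 1)).norm).eventually (gt_mem_nhds (by linarith))
  refine ⟨‖x‖ + M * N, ?_⟩
  filter_upwards [h1] with lam hlam D' hD' u t hu ht
  have h2 : ‖act D' (1, 0)‖ + ‖act D' (0, 1)‖ ≤ N := by
    rcases hD' with rfl | rfl
    · linarith
    · exact hlam.le
  have h3 : ‖act D' t‖ ≤ M * N := (norm_act_le D' t).trans
    (mul_le_mul (hM t ht) h2 (by positivity) ((norm_nonneg _).trans (hM t ht)))
  rw [mem_closedBall_zero_iff]
  have h4 : u = (act D' t + u) - act D' t := by abel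
  rw [h4]
  exact (norm_sub_le _ _).trans (add_le_add (norm_le_of_mem_rect hu) h3)

/-- Near parts are bounded by `C I` and vanish outside a common ball, so a multiple of its indicator
dominates the squared differences. -/
lemma IsScaling.tendsto_near_Lp (h : IsScaling p γ κ 𝒟 D) (hb : IsCoefficient p b) (x : ℝ × ℝ)
    (K : ℝ) : Tendsto (fun lam => eLpNorm (fun u =>
      (∫ t in {t | p.rho t ≤ K}, innerLam p b γ κ lam x u t) -
        ∫ t in {t | p.rho t ≤ K}, innerV p D x u t) 2 (volume : Measure (ℝ × ℝ))) atTop (𝓝 0) := by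
  obtain ⟨C, hC, h1, h2⟩ := hb.exists_setLIntegral_le
  obtain ⟨R, hR⟩ := h.exists_support hb (x.1 + 2, x.2 + 2) K
  have hKm : MeasurableSet {t | p.rho t ≤ K} :=
    measurableSet_le (measurable_rho hb.q₁_pos hb.q₂_pos) measurable_const
  set I := ∫⁻ t in {t | p.rho t ≤ K}, ENNReal.ofReal (p.rho t)⁻¹
  have hI : I < ∞ := lintegral_rho_inv_lt_top hb.q₁_pos hb.q₂_pos hb.one_lt_Q K
  have hm1 : ∀ lam, Measurable fun u => ∫ t in {t | p.rho t ≤ K}, innerLam p b γ κ lam x u t :=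
    fun lam => (measurable_innerLam p b γ κ lam x).stronglyMeasurable.integral_prod_right'.measurable
  have hm2 : Measurable fun u => ∫ t in {t | p.rho t ≤ K}, innerV p D x u t :=
    (measurable_innerV hb D x).stronglyMeasurable.integral_prod_right'.measurable
  have key : Tendsto (fun lam => ∫⁻ u, ‖(∫ t in {t | p.rho t ≤ K}, innerLam p b γ κ lam x u t) -
        ∫ t in {t | p.rho t ≤ K}, innerV p D x u t‖ₑ ^ 2) atTop (𝓝 (∫⁻ _ : ℝ × ℝ, 0)) := by
    refine tendsto_lintegral_filter_of_dominated_convergence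
      ((Metric.closedBall (0 : ℝ × ℝ) R).indicator fun _ => (2 * (C * I)) ^ 2)
      (Eventually.of_forall fun lam => ((hm1 lam).sub hm2).enorm.pow_const 2) ?_ ?_ ?_
    · filter_upwards [hR, eventually_ge_atTop 1] with lam hlam hlam1
      refine Eventually.of_forall fun u => ?_
      have e1 := (enorm_integral_le_lintegral_enorm _).trans
        (h1 γ κ lam h.γ_pos hlam1 x u _ hKm)
      have e2 := (enorm_integral_le_lintegral_enorm _).trans (h2 D x u _ hKm)
      by_cases hu : u ∈ Metric.closedBall (0 : ℝ × ℝ) R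
      · rw [Set.indicator_of_mem hu]
        gcongr
        refine (enorm_sub_le).trans ?_
        rw [two_mul]
        gcongr
        · exact e1.trans (by gcongr; exact lintegral_mono_set Set.inter_subset_right)
        · exact e2.trans (by gcongr; exact lintegral_mono_set Set.inter_subset_right)
      · have f : ∀ D' ∈ ({D, scaledMat p γ κ lam} : Set _),
            {t | act D' t + u ∈ rect (x.1 + 2, x.2 + 2)} ∩ {t | p.rho t ≤ K} = ∅ :=
          fun D' hD' => Set.eq_empty_of_forall_notMem fun t ht => hu (hlam D' hD' u t ht.1 ht.2)
        rw [f _ (by simp), Measure.restrict_empty, lintegral_zero_measure, mul_zero,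
          nonpos_iff_eq_zero, enorm_eq_zero] at e1 e2
        rw [e1, e2, sub_zero, enorm_zero]
        simp
    · rw [lintegral_indicator Metric.isClosed_closedBall.measurableSet, lintegral_const,
        Measure.restrict_apply_univ]
      have := (isCompact_closedBall (0 : ℝ × ℝ) R).measure_lt_top (μ := volume)
      finiteness
    · filter_upwards [h.tendsto_near hb x K] with u hu
      have := (hu.sub_const (∫ t in {t | p.rho t ≤ K}, innerV p D x u t)).enorm
      rw [sub_self, enorm_zero] at this
      have h2 := (ENNReal.continuous_pow 2).tendsto 0 |>.comp this
      simpa [Function.comp_def] using h2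
  simp only [eLpNorm_two_eq]
  rw [lintegral_zero] at key
  have := (ENNReal.continuous_rpow_const (y := (1 / 2 : ℝ))).tendsto 0 |>.comp key
  simpa [Function.comp_def] using this

/-- The essential point is that `δ` depends on `K` alone, so the truncation can be removed uniformly
in `λ`. -/
lemma IsScaling.far_Lp_le (h : IsScaling p γ κ 𝒟 D) (hb : IsCoefficient p b) (x : ℝ × ℝ) :
    ∃ δ : ℝ → ℝ≥0∞, Tendsto δ atTop (𝓝 0) ∧ ∀ K, 1 ≤ K →
      (∀ lam, 1 ≤ lam → eLpNorm (fun u => ∫ t in {t | K < p.rho t}, innerLam p b γ κ lam x u t) 2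
        (volume : Measure (ℝ × ℝ)) ≤ δ K) ∧
      eLpNorm (fun u => ∫ t in {t | K < p.rho t}, innerV p D x u t) 2
        (volume : Measure (ℝ × ℝ)) ≤ δ K := by
  obtain ⟨C, hC, h1, h2⟩ := hb.exists_setLIntegral_le
  obtain ⟨A, η, hA, hη, hF⟩ := h.far.lintegral_sq_le (x.1 + 2, x.2 + 2)
  have hKm : ∀ K, MeasurableSet {t | K < p.rho t} := fun K =>
    measurableSet_lt measurable_const (measurable_rho hb.q₁_pos hb.q₂_pos)
  refine ⟨fun K => (C ^ 2 * (A * ENNReal.ofReal (K ^ (-η)) ^ 2)) ^ (1 / 2 : ℝ), ?_, fun K hK => ?_⟩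
  · have e1 : Tendsto (fun K : ℝ => ENNReal.ofReal (K ^ (-η))) atTop (𝓝 0) := by
      simpa using ENNReal.tendsto_ofReal (tendsto_rpow_neg_atTop hη)
    have e2 : Tendsto (fun K : ℝ => ENNReal.ofReal (K ^ (-η)) ^ 2) atTop (𝓝 0) := by
      have := (ENNReal.continuous_pow 2).tendsto 0 |>.comp e1
      simpa [Function.comp_def] using this
    have e3 := ENNReal.Tendsto.const_mul (a := C ^ 2)
      (ENNReal.Tendsto.const_mul (a := A) e2 (Or.inr hA)) (Or.inr (by finiteness))
    have := (ENNReal.continuous_rpow_const (y := (1 / 2 : ℝ))).tendsto _ |>.comp e3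
    simpa [Function.comp_def] using this
  · have main : ∀ D' ∈ 𝒟, ∀ f : ℝ × ℝ → ℝ × ℝ → ℝ,
        (∀ u, ∫⁻ t in {t | K < p.rho t}, ‖f u t‖ₑ ≤ C * ∫⁻ t in
          {t | act D' t + u ∈ rect (x.1 + 2, x.2 + 2)} ∩ {t | K < p.rho t},
            ENNReal.ofReal (p.rho t)⁻¹) →
        eLpNorm (fun u => ∫ t in {t | K < p.rho t}, f u t) 2 (volume : Measure (ℝ × ℝ)) ≤
          (C ^ 2 * (A * ENNReal.ofReal (K ^ (-η)) ^ 2)) ^ (1 / 2 : ℝ) := by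
      intro D' hD' f hf
      rw [eLpNorm_two_eq]
      refine ENNReal.rpow_le_rpow ?_ (by norm_num)
      refine (lintegral_mono fun u => ?_).trans ((lintegral_const_mul' _ _
        (by finiteness : C ^ 2 ≠ ∞)).le.trans (by gcongr; exact hF D' hD' K hK))
      rw [← mul_pow]
      gcongr
      exact (enorm_integral_le_lintegral_enorm _).trans (hf u)
    exact ⟨fun lam hlam => main _ (h.scaled_mem lam hlam) _
        fun u => h1 γ κ lam h.γ_pos hlam x u _ (hKm K),
      main _ h.limit_mem _ fun u => h2 D x u _ (hKm K)⟩

/-- The rescaled kernels converge in `L²`. -/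
lemma IsScaling.tendsto_kernelLam (h : IsScaling p γ κ 𝒟 D) (hb : IsCoefficient p b) (x : ℝ × ℝ) :
    Tendsto (fun lam => eLpNorm (kernelLam p b γ κ lam x - kernelV p D x) 2
      (volume : Measure (ℝ × ℝ))) atTop (𝓝 0) := by
  set F : ℝ → ℝ × ℝ → ℝ := fun lam u =>
    (∫ t, innerLam p b γ κ lam x u t) - ∫ t, innerV p D x u t with hF
  suffices hs : Tendsto (fun lam => eLpNorm (F lam) 2 (volume : Measure (ℝ × ℝ))) atTop (𝓝 0) by
    have h1 := ENNReal.Tendsto.const_mul (a := ‖|p.B.det|⁻¹‖ₑ) hs (Or.inr enorm_ne_top)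
    rw [mul_zero] at h1
    refine h1.congr fun lam => ?_
    rw [← eLpNorm_const_smul]
    congr 1
    funext u
    simp only [hF, Pi.smul_apply, Pi.sub_apply, smul_eq_mul, kernelLam, kernelV, mul_sub]
  obtain ⟨δ, hδ, hδ'⟩ := h.far_Lp_le hb x
  rw [ENNReal.tendsto_nhds_zero]
  intro e he
  have he2 : 0 < e / 3 := ENNReal.div_pos he.ne' (by norm_num)
  -- The truncation level is fixed before `λ` grows: two thirds of the error are far parts, one
  -- third is the near difference.
  obtain ⟨K, hK, hK1⟩ := ((ENNReal.tendsto_nhds_zero.1 hδ (e / 3) he2).and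
    (eventually_ge_atTop 1)).exists
  filter_upwards [ENNReal.tendsto_nhds_zero.1 (h.tendsto_near_Lp hb x K) (e / 3) he2,
    eventually_ge_atTop 1] with lam hn hlam
  obtain ⟨f1, f2⟩ := hδ' K hK1
  have hρ := measurable_rho hb.q₁_pos hb.q₂_pos
  have hKm : MeasurableSet {t | p.rho t ≤ K} := measurableSet_le hρ measurable_const
  have hcompl : {t | p.rho t ≤ K}ᶜ = {t | K < p.rho t} := by
    ext t
    simp
  have hsplit : F lam = ((fun u => (∫ t in {t | p.rho t ≤ K}, innerLam p b γ κ lam x u t) -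
        ∫ t in {t | p.rho t ≤ K}, innerV p D x u t) +
      (fun u => ∫ t in {t | K < p.rho t}, innerLam p b γ κ lam x u t)) -
      (fun u => ∫ t in {t | K < p.rho t}, innerV p D x u t) := by
    funext u
    simp only [hF, Pi.add_apply, Pi.sub_apply]
    rw [← integral_add_compl hKm (h.integrable_innerLam hb hlam x u),
      ← integral_add_compl hKm (h.far.integrable_innerV hb h.limit_mem x u), hcompl]
    ring
  have m1 : ∀ S : Set (ℝ × ℝ), Measurable fun u => ∫ t in S, innerLam p b γ κ lam x u t :=
    fun S => (measurable_innerLam p b γ κ lam x).stronglyMeasurable.integral_prod_right'.measurable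
  have m2 : ∀ S : Set (ℝ × ℝ), Measurable fun u => ∫ t in S, innerV p D x u t :=
    fun S => (measurable_innerV hb D x).stronglyMeasurable.integral_prod_right'.measurable
  rw [hsplit]
  refine (eLpNorm_sub_le (((m1 _).sub (m2 _)).add (m1 _)).aestronglyMeasurable
    (m2 _).aestronglyMeasurable (by norm_num)).trans ?_
  refine (add_le_add (eLpNorm_add_le ((m1 _).sub (m2 _)).aestronglyMeasurable
    (m1 _).aestronglyMeasurable (by norm_num)) le_rfl).trans ?_
  calc _ ≤ e / 3 + e / 3 + e / 3 :=
        add_le_add (add_le_add hn ((f1 lam hlam).trans hK)) (f2.trans hK)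
    _ = e := ENNReal.add_thirds e

end Convergence

/-! ### From lattice sums to kernels, and the general scaling limit -/

section Discrete

open scoped ENNReal

open Params

variable {p : Params} {b : ℤ × ℤ → ℝ}

/-- The coefficients are square summable. -/
lemma IsCoefficient.summable_sq (hb : IsCoefficient p b) : Summable fun s => b s ^ 2 := by
  have h₁ := hb.q₁_pos
  have h₂ := hb.q₂_pos
  have hQ := hb.Q_lt_two
  have hQ0 : 0 < p.Q := one_pos.trans hb.one_lt_Q
  obtain ⟨C, hC0, hC⟩ := hb.exists_abs_floorPair_mul_le
  -- The midpoint of `1/2` and `1/Q`, a nonempty interval since `Q < 2`: `2a > 1` makes the squared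
  -- bound integrable, and `aQ < 1` leaves the deficit `η = 1 - aQ > 0`.
  set a := (1 / 2 + 1 / p.Q) / 2 with ha
  have hQ' : 1 / 2 < 1 / p.Q := one_div_lt_one_div_of_lt hQ0 hQ
  have ha2 : 1 < 2 * a := by rw [ha]; linarith
  have haQ : a * p.Q < 1 := by
    have : a < 1 / p.Q := by rw [ha]; linarith
    rwa [lt_div_iff₀ hQ0] at this
  have hc : a / p.q₁ + a / p.q₂ = 1 - (1 - a * p.Q) := by
    unfold Q; ring
  set m : ℝ → ℝ≥0∞ := fun s => ENNReal.ofReal ((1 + |s|) ^ (-(2 * a))) with hm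
  have hmm : Measurable m := by fun_prop
  set A : ℝ := 2 ^ (a + a) with hA
  have hne : ∫⁻ v, ENNReal.ofReal (b (floorPair (act p.B⁻¹ v)) ^ 2) ≠ ∞ := by
    have hle : ∀ᵐ v : ℝ × ℝ, ENNReal.ofReal (b (floorPair (act p.B⁻¹ v)) ^ 2) ≤
        ENNReal.ofReal (C ^ 2) * ({t | p.rho t ≤ 1}.indicator
          (fun t => ENNReal.ofReal (p.rho t)⁻¹) v + ENNReal.ofReal (A ^ 2) * (m v.1 * m v.2)) := by
      filter_upwards [ae_snd_ne_zero] with v hv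
      have hρ := rho_pos_of_snd_ne_zero (p := p) hv
      have e1 : |b (floorPair (act p.B⁻¹ v))| ≤ C * (1 + p.rho v)⁻¹ := by
        rw [← div_eq_mul_inv, le_div_iff₀ (by positivity)]
        exact hC v
      have e2 : b (floorPair (act p.B⁻¹ v)) ^ 2 ≤ C ^ 2 * ((1 + p.rho v)⁻¹) ^ 2 := by
        rw [← sq_abs, ← mul_pow]
        gcongr
      refine (ENNReal.ofReal_le_ofReal e2).trans ?_
      rw [ENNReal.ofReal_mul (by positivity)]
      gcongr
      rcases le_or_gt (p.rho v) 1 with h | h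
      · rw [Set.indicator_of_mem (by exact h)]
        refine le_trans (ENNReal.ofReal_le_ofReal ?_) le_self_add
        have f1 : (1 + p.rho v)⁻¹ ≤ 1 := inv_le_one_of_one_le₀ (by linarith)
        have f2 : 1 ≤ (p.rho v)⁻¹ := (one_le_inv₀ hρ).2 h
        have f3 : 0 ≤ (1 + p.rho v)⁻¹ := by positivity
        nlinarith
      · refine le_trans ?_ le_add_self
        have f1 := rho_inv_le_of_lt h₁ h₂ (by linarith) (by linarith) (by linarith) hc le_rfl h
        rw [Real.one_rpow, mul_one] at f1
        have f2 : (1 + p.rho v)⁻¹ ≤ (p.rho v)⁻¹ := inv_anti₀ hρ (by linarith)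
        have f3 := pow_le_pow_left₀ (by positivity) (f2.trans f1) 2
        refine (ENNReal.ofReal_le_ofReal f3).trans (le_of_eq ?_)
        simp only [hm]
        rw [← one_add_abs_rpow_sq, ← one_add_abs_rpow_sq, ← ENNReal.ofReal_pow (by positivity),
          ← ENNReal.ofReal_pow (by positivity), ← ENNReal.ofReal_mul (by positivity),
          ← ENNReal.ofReal_mul (by positivity), mul_pow, mul_pow]
    refine ne_of_lt ((lintegral_mono_ae hle).trans_lt ?_)
    have hρm : MeasurableSet {t | p.rho t ≤ 1} :=
      measurableSet_le (measurable_rho h₁ h₂) measurable_const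
    have hm1 : Measurable ({t | p.rho t ≤ 1}.indicator
        fun t => ENNReal.ofReal (p.rho t)⁻¹) :=
      (measurable_rho h₁ h₂).inv.ennreal_ofReal.indicator hρm
    rw [lintegral_const_mul' _ _ (by simp), lintegral_add_left hm1,
      lintegral_indicator hρm, lintegral_const_mul' _ _ (by simp), Measure.volume_eq_prod,
      lintegral_prod_mul hmm.aemeasurable hmm.aemeasurable, ← Measure.volume_eq_prod]
    have g1 := lintegral_rho_inv_lt_top h₁ h₂ hb.one_lt_Q 1
    have g2 : ∫⁻ s, m s < ∞ := lintegral_one_add_abs_rpow_lt_top ha2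
    finiteness
  have hdet : p.B⁻¹.det ≠ 0 := by
    rw [Matrix.det_nonsing_inv]
    simpa using hb.det_ne_zero
  rw [lintegral_act hdet (fun τ => ENNReal.ofReal (b (floorPair τ) ^ 2)),
    lintegral_floorPair (fun s => ENNReal.ofReal (b s ^ 2))] at hne
  have h2 : ∑' s, ENNReal.ofReal (b s ^ 2) ≠ ∞ := by
    intro htop
    rw [htop, ENNReal.mul_top (by simpa using hdet)] at hne
    exact hne rfl
  have h3 := ENNReal.summable_toReal h2
  refine h3.congr fun s => ?_
  rw [ENNReal.toReal_ofReal (sq_nonneg _)]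

lemma inv_mul_mem_Ioc_iff {l : ℝ} (hl : 0 < l) (t : ℤ) (c : ℝ) :
    l⁻¹ * (t : ℝ) ∈ Set.Ioc 0 c ↔ t ∈ Finset.Ioc (0 : ℤ) ⌊l * c⌋ := by
  rw [Set.mem_Ioc, Finset.mem_Ioc, Int.le_floor, inv_mul_le_iff₀ hl,
    mul_pos_iff_of_pos_left (inv_pos.2 hl), Int.cast_pos]

lemma det_dil_mat (p : Params) {μ : ℝ} (hμ : 0 < μ) :
    (p.B⁻¹ * !![μ ^ (1 / p.q₁), 0; 0, μ ^ (1 / p.q₂)]).det = p.B.det⁻¹ * μ ^ p.Q := by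
  rw [Matrix.det_mul, Matrix.det_nonsing_inv, Ring.inverse_eq_inv', Matrix.det_fin_two_of, Q,
    Real.rpow_add hμ]
  ring

lemma act_dil_mat (p : Params) (μ : ℝ) (t : ℝ × ℝ) :
    act (p.B⁻¹ * !![μ ^ (1 / p.q₁), 0; 0, μ ^ (1 / p.q₂)]) t = act p.B⁻¹ (p.dil μ t) := by
  rw [act_mul]
  congr 1
  simp [act, dil]

/-- The coefficients of the normalised partial sums in terms of the rescaled kernel. -/
lemma IsCoefficient.coef_eq (hb : IsCoefficient p b) (γ κ H : ℝ) {lam : ℝ} (hlam : 0 < lam)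
    (x u : ℝ × ℝ) : coef b γ H lam x (⌊lam * u.1⌋, ⌊lam ^ γ * u.2⌋) =
      (lam ^ H)⁻¹ * (lam ^ κ) ^ (p.Q - 1) * kernelLam p b γ κ lam x u := by
  classical
  set μ := lam ^ κ with hμ
  have hμ0 : 0 < μ := Real.rpow_pos_of_pos hlam _
  have hg0 : 0 < lam ^ γ := Real.rpow_pos_of_pos hlam _
  set s : ℤ × ℤ := (⌊lam * u.1⌋, ⌊lam ^ γ * u.2⌋) with hs
  set box := Finset.Ioc (0 : ℤ) ⌊lam * x.1⌋ ×ˢ Finset.Ioc (0 : ℤ) ⌊lam ^ γ * x.2⌋ with hbox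
  -- The sum over the box is reindexed by `n = t - s`, which gives a finitely supported function on
  -- the lattice.
  set G : ℤ × ℤ → ℝ := fun n => if n + s ∈ box then μ * b n else 0 with hG
  have hGs : ∀ t ∉ box, G (t - s) = 0 := fun t ht => by
    simp only [hG, sub_add_cancel, if_neg ht]
  have hsum : Summable fun t => G (t - s) := summable_of_ne_finset_zero hGs
  have hsumG : Summable G := by
    have := (Equiv.subRight s).summable_iff (f := G)
    exact this.1 hsum
  have htsum : ∑' n, G n = μ * ∑ t ∈ box, b (t - s) := by
    rw [← (Equiv.subRight s).tsum_eq G, Finset.mul_sum]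
    refine (tsum_eq_sum (s := box) fun t ht => hGs t ht).trans (Finset.sum_congr rfl fun t ht => ?_)
    simp only [hG, sub_add_cancel, if_pos ht]
  have hinner : innerLam p b γ κ lam x u = fun t =>
      G (floorPair (act (p.B⁻¹ * !![μ ^ (1 / p.q₁), 0; 0, μ ^ (1 / p.q₂)]) t)) := by
    funext t
    rw [act_dil_mat]
    simp only [innerLam, Set.indicator, Set.mem_ofPred_eq, hG]
    refine if_congr ?_ rfl rfl
    simp only [latticePt, rect, Set.mem_prod, hbox, Finset.mem_product]
    rw [inv_mul_mem_Ioc_iff hlam, inv_mul_mem_Ioc_iff hg0]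
    rfl
  have hdet := det_dil_mat p hμ0
  have hQ0 : 0 < μ ^ p.Q := Real.rpow_pos_of_pos hμ0 _
  have hB := hb.det_ne_zero
  -- The Jacobian contributes `|det B| μ^(-Q)`, whose determinant cancels the prefactor of the
  -- kernel; the factor `μ` in `G` turns the remaining power into `μ^(1-Q)`.
  rw [kernelLam, hinner, integral_act (by rw [hdet]; positivity) (fun τ => G (floorPair τ)),
    integral_floorPair hsumG, htsum, hdet, abs_mul, abs_of_pos hQ0, abs_inv, coef,
    Real.rpow_sub hμ0, Real.rpow_one]
  have hB' : |p.B.det| ≠ 0 := abs_ne_zero.2 hB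
  field_simp
  rfl

lemma tendsto_integral_sq {f : ℝ → ℝ × ℝ → ℝ} {g : ℝ × ℝ → ℝ}
    (hf : ∀ᶠ lam in atTop, MemLp (f lam) 2 (volume : Measure (ℝ × ℝ)))
    (hg : MemLp g 2 (volume : Measure (ℝ × ℝ)))
    (h : Tendsto (fun lam => eLpNorm (f lam - g) 2 (volume : Measure (ℝ × ℝ))) atTop (𝓝 0)) :
    Tendsto (fun lam => ∫ u, f lam u ^ 2) atTop (𝓝 (∫ u, g u ^ 2)) := by
  have h0 := (ENNReal.tendsto_toReal ENNReal.zero_ne_top).comp h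
  rw [ENNReal.toReal_zero] at h0
  have key : Tendsto (fun lam => (eLpNorm (f lam) 2 (volume : Measure (ℝ × ℝ))).toReal) atTop
      (𝓝 (eLpNorm g 2 (volume : Measure (ℝ × ℝ))).toReal) := by
    rw [tendsto_iff_norm_sub_tendsto_zero]
    refine squeeze_zero' (Eventually.of_forall fun _ => norm_nonneg _) ?_ h0
    filter_upwards [hf] with lam hl
    have e1 : (eLpNorm (f lam) 2 volume).toReal = ‖hl.toLp (f lam)‖ := (Lp.norm_toLp _ hl).symm
    have e2 : (eLpNorm g 2 volume).toReal = ‖hg.toLp g‖ := (Lp.norm_toLp _ hg).symm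
    have e3 : (eLpNorm (f lam - g) 2 volume).toReal = ‖hl.toLp (f lam) - hg.toLp g‖ := by
      rw [← MemLp.toLp_sub, Lp.norm_toLp]
    rw [Function.comp_apply, e1, e2, e3]
    exact abs_norm_sub_norm_le _ _
  have h2 : ∀ {k : ℝ × ℝ → ℝ}, MemLp k 2 (volume : Measure (ℝ × ℝ)) →
      (eLpNorm k 2 (volume : Measure (ℝ × ℝ))).toReal ^ 2 = ∫ u, k u ^ 2 := fun {k} hk => by
    rw [← norm_toLp_sq hk, Lp.norm_toLp]
  have h3 := key.pow 2
  rw [h2 hg] at h3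
  refine h3.congr' ?_
  filter_upwards [hf] with lam hl
  exact h2 hl

variable {γ κ : ℝ} {𝒟 : Set (Matrix (Fin 2) (Fin 2) ℝ)} {D : Matrix (Fin 2) (Fin 2) ℝ}

lemma IsScaling.tendsto_integral_sum_sq (h : IsScaling p γ κ 𝒟 D) (hb : IsCoefficient p b)
    {n : ℕ} (x : Fin n → ℝ × ℝ) (θ : Fin n → ℝ) :
    Tendsto (fun lam => ∫ u, (∑ j, θ j * kernelLam p b γ κ lam (x j) u) ^ 2) atTop
      (𝓝 (∫ u, (∑ j, θ j * kernelV p D (x j) u) ^ 2)) := by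
  refine tendsto_integral_sq (f := fun lam u => ∑ j, θ j * kernelLam p b γ κ lam (x j) u) ?_
    (memLp_finsetSum _ fun j _ => (h.far.memLp_kernelV hb h.limit_mem (x j)).const_mul (θ j)) ?_
  · filter_upwards [eventually_ge_atTop 1] with lam hlam
    exact memLp_finsetSum _ fun j _ => (h.memLp_kernelLam hb hlam (x j)).const_mul (θ j)
  · have h1 : Tendsto (fun lam => ∑ j, ‖θ j‖ₑ * eLpNorm (kernelLam p b γ κ lam (x j) -
        kernelV p D (x j)) 2 (volume : Measure (ℝ × ℝ))) atTop (𝓝 0) := by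
      have := tendsto_finsetSum Finset.univ fun j _ =>
        ENNReal.Tendsto.const_mul (a := ‖θ j‖ₑ) (h.tendsto_kernelLam hb (x j)) (Or.inr enorm_ne_top)
      simpa using this
    refine tendsto_of_tendsto_of_tendsto_of_le_of_le tendsto_const_nhds h1 (fun _ => zero_le)
      fun lam => ?_
    have h2 : ((fun u => ∑ j, θ j * kernelLam p b γ κ lam (x j) u) -
        fun u => ∑ j, θ j * kernelV p D (x j) u) =
        ∑ j, θ j • (kernelLam p b γ κ lam (x j) - kernelV p D (x j)) := by
      funext u
      simp only [Pi.sub_apply, Finset.sum_apply, Pi.smul_apply, smul_eq_mul, mul_sub,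
        Finset.sum_sub_distrib]
    simp only
    rw [h2]
    refine (eLpNorm_sum_le (fun j _ => (((measurable_kernelLam p b γ κ lam (x j)).sub
      (measurable_kernelV hb D (x j))).const_smul (θ j)).aestronglyMeasurable)
      (by norm_num)).trans (Finset.sum_le_sum fun j _ => ?_)
    rw [eLpNorm_const_smul]

/-- The relation on `H` leaves `λ^(-(1+γ)/2)`, the square root of the area of a cell in the variable
`u`. -/
lemma lam_powers {lam H γ κ q : ℝ} (hlam : 0 < lam) (hH : 2 * H = 1 + γ + 2 * κ * (q - 1)) :
    (lam ^ H)⁻¹ * (lam ^ κ) ^ (q - 1) = lam ^ (-((1 + γ) / 2)) := by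
  rw [← Real.rpow_neg hlam.le, ← Real.rpow_mul hlam.le, ← Real.rpow_add hlam]
  congr 1
  linarith

/-- An exact identity for every `λ > 0`: the weights are constant on cells of size `λ⁻¹ × λ^(-γ)`,
whose area absorbs the squared normalisation. -/
lemma IsCoefficient.tsum_coef_sq (hb : IsCoefficient p b) {H : ℝ}
    (hH : 2 * H = 1 + γ + 2 * κ * (p.Q - 1)) {n : ℕ} (x : Fin n → ℝ × ℝ) (θ : Fin n → ℝ)
    {lam : ℝ} (hlam : 0 < lam) :
    ∑' s, (∑ j, θ j * coef b γ H lam (x j) s) ^ 2 =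
      ∫ u, (∑ j, θ j * kernelLam p b γ κ lam (x j) u) ^ 2 := by
  have hs : Summable fun s => (∑ j, θ j * coef b γ H lam (x j) s) ^ 2 :=
    summable_sq_sum _ fun j _ => by
      simp only [mul_pow]
      exact (summable_coef_sq hb.summable_sq γ H lam (x j)).mul_left _
  have hg0 : 0 < lam ^ γ := Real.rpow_pos_of_pos hlam _
  rw [← integral_floorPair hs]
  have hdet : (!![lam, 0; 0, lam ^ γ] : Matrix (Fin 2) (Fin 2) ℝ).det = lam ^ (1 + γ) := by
    rw [Matrix.det_fin_two_of, Real.rpow_add hlam, Real.rpow_one]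
    ring
  have hp : 0 < lam ^ (1 + γ) := Real.rpow_pos_of_pos hlam _
  have h1 := integral_act (D := !![lam, 0; 0, lam ^ γ]) (by rw [hdet]; exact hp.ne')
    fun σ => (∑ j, θ j * coef b γ H lam (x j) (floorPair σ)) ^ 2
  rw [hdet, abs_of_pos hp, eq_inv_mul_iff_mul_eq₀ hp.ne'] at h1
  rw [← h1, ← integral_const_mul]
  refine integral_congr_ae (Eventually.of_forall fun u => ?_)
  have h2 : floorPair (act !![lam, 0; 0, lam ^ γ] u) = (⌊lam * u.1⌋, ⌊lam ^ γ * u.2⌋) := by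
    simp [floorPair, act]
  simp only [h2, hb.coef_eq γ κ H hlam, lam_powers hlam hH]
  have h3 : ∑ j, θ j * (lam ^ (-((1 + γ) / 2)) * kernelLam p b γ κ lam (x j) u) =
      lam ^ (-((1 + γ) / 2)) * ∑ j, θ j * kernelLam p b γ κ lam (x j) u := by
    rw [Finset.mul_sum]
    exact Finset.sum_congr rfl fun j _ => by ring
  rw [h3, mul_pow, ← mul_assoc, ← Real.rpow_natCast (lam ^ _), ← Real.rpow_mul hlam.le,
    ← Real.rpow_add hlam]
  have h4 : 1 + γ + -((1 + γ) / 2) * ((2 : ℕ) : ℝ) = 0 := by push_cast; ring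
  rw [h4, Real.rpow_zero, one_mul]

/-- The kernels are bounded uniformly, so the weights are of order `λ^(-(1+γ)/2)`. -/
lemma IsScaling.exists_abs_coef_le (h : IsScaling p γ κ 𝒟 D) (hb : IsCoefficient p b) {H : ℝ}
    (hH : 2 * H = 1 + γ + 2 * κ * (p.Q - 1)) (x : ℝ × ℝ) :
    ∃ δ : ℝ → ℝ, Tendsto δ atTop (𝓝 0) ∧ ∀ᶠ lam in atTop, ∀ s, |coef b γ H lam x s| ≤ δ lam := by
  obtain ⟨A, hA⟩ := h.exists_abs_kernelLam_le hb x
  have hγ := h.γ_pos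
  refine ⟨fun lam => lam ^ (-((1 + γ) / 2)) * A, ?_, ?_⟩
  · simpa using (tendsto_rpow_neg_atTop (y := (1 + γ) / 2) (by positivity)).mul_const A
  · filter_upwards [eventually_ge_atTop 1] with lam hlam s
    have hl0 : 0 < lam := one_pos.trans_le hlam
    have hg0 : 0 < lam ^ γ := Real.rpow_pos_of_pos hl0 _
    -- At this corner of the cell the integer parts return `s` exactly.
    have h1 := hb.coef_eq γ κ H hl0 x (lam⁻¹ * s.1, (lam ^ γ)⁻¹ * s.2)
    simp only [mul_inv_cancel_left₀ hl0.ne', mul_inv_cancel_left₀ hg0.ne', Int.floor_intCast,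
      Prod.mk.eta, lam_powers hl0 hH] at h1
    rw [h1, abs_mul, abs_of_pos (Real.rpow_pos_of_pos hl0 _)]
    exact mul_le_mul_of_nonneg_left (hA lam hlam _) (Real.rpow_pos_of_pos hl0 _).le

variable {Ω Ω' : Type*} [MeasurableSpace Ω] [MeasurableSpace Ω'] {P : Measure Ω}
  [IsProbabilityMeasure P] {P' : Measure Ω'} [IsProbabilityMeasure P'] {ε : ℤ × ℤ → Ω → ℝ}
  {X : ℤ × ℤ → Ω → ℝ}

/-- The scaling limit of the partial sums, for a field with the covariances of `V_D`. -/
lemma IsScaling.scalesTo_of_gram (h : IsScaling p γ κ 𝒟 D) (hb : IsCoefficient p b)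
    (hε : IsInnovation ε P) (W : WhiteNoise P') (hX : IsLinearField b ε P X) {H : ℝ}
    (hH : 2 * H = 1 + γ + 2 * κ * (p.Q - 1)) {K : ℝ × ℝ → ℝ × ℝ → ℝ}
    (hK : ∀ x ∈ quadrant, MemLp (K x) 2 (volume : Measure (ℝ × ℝ)))
    (hgram : ∀ (n : ℕ) (x : Fin n → ℝ × ℝ) (θ : Fin n → ℝ),
      ∫ u, (∑ j, θ j * K (x j) u) ^ 2 = ∫ u, (∑ j, θ j * kernelV p D (x j) u) ^ 2) :
    ScalesTo P P' X γ H fun x => W.integral (K x) := by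
  refine scalesTo_of_tendsto hε hb.summable_sq W hX hK (fun n x θ _ => ?_)
    fun x _ => h.exists_abs_coef_le hb hH x
  rw [hgram]
  refine (h.tendsto_integral_sum_sq hb x θ).congr' ?_
  filter_upwards [eventually_gt_atTop 0] with lam hlam
  exact (hb.tsum_coef_sq hH x θ hlam).symm

lemma IsScaling.scalesTo (h : IsScaling p γ κ 𝒟 D) (hb : IsCoefficient p b)
    (hε : IsInnovation ε P) (W : WhiteNoise P') (hX : IsLinearField b ε P X) {H : ℝ}
    (hH : 2 * H = 1 + γ + 2 * κ * (p.Q - 1)) : ScalesTo P P' X γ H (fieldV W p D) :=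
  h.scalesTo_of_gram hb hε W hX hH (fun x _ => h.far.memLp_kernelV hb h.limit_mem x)
    fun _ _ _ => rfl

end Discrete

/-! ### The scaling regimes: choice of the exponent `κ` -/

section Regimes

open Params

variable {p : Params} {b : ℤ × ℤ → ℝ}

lemma inv_fin_two (B : Matrix (Fin 2) (Fin 2) ℝ) :
    B⁻¹ = (1 / B.det) • !![B 1 1, -B 0 1; -B 1 0, B 0 0] := by
  rw [Matrix.inv_def, Matrix.adjugate_fin_two, Ring.inverse_eq_inv', one_div]

lemma scaledMat_eq (p : Params) (γ κ : ℝ) {lam : ℝ} (hlam : 0 < lam) :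
    scaledMat p γ κ lam =
      !![p.B⁻¹ 0 0 * lam ^ (κ / p.q₁ - 1), p.B⁻¹ 0 1 * lam ^ (κ / p.q₂ - 1);
        p.B⁻¹ 1 0 * lam ^ (κ / p.q₁ - γ), p.B⁻¹ 1 1 * lam ^ (κ / p.q₂ - γ)] := by
  have e : ∀ q e' : ℝ, lam ^ (κ / q - e') = (lam ^ e')⁻¹ * (lam ^ κ) ^ (1 / q) := fun q e' => by
    rw [Real.rpow_sub hlam, ← Real.rpow_mul hlam.le, mul_one_div, div_eq_inv_mul]
  have e1 : ∀ q : ℝ, lam ^ (κ / q - 1) = lam⁻¹ * (lam ^ κ) ^ (1 / q) := fun q => by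
    rw [e q 1, Real.rpow_one]
  rw [scaledMat, e1, e1, e, e]
  ext i j
  fin_cases i <;> fin_cases j <;> simp <;> ring

lemma tendsto_mul_rpow_atTop {c e d : ℝ} (h : e < 0 ∧ d = 0 ∨ e = 0 ∧ d = c ∨ c = 0 ∧ d = 0) :
    Tendsto (fun lam : ℝ => c * lam ^ e) atTop (𝓝 d) := by
  rcases h with ⟨h, rfl⟩ | ⟨rfl, rfl⟩ | ⟨rfl, rfl⟩
  · simpa using (tendsto_rpow_neg_atTop (y := -e) (by linarith)).const_mul c
  · simp
  · simp

/-- For each entry three possibilities: the power of `λ` decays, is constant, or has coefficient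
zero. Only the last admits a positive exponent. -/
lemma isScaling_of_entries {γ κ : ℝ} {𝒟 : Set (Matrix (Fin 2) (Fin 2) ℝ)}
    {D : Matrix (Fin 2) (Fin 2) ℝ} (hγ : 0 < γ) (hκ : 0 < κ) (h𝒟 : FarControl p 𝒟) (hD : D ∈ 𝒟)
    (hmem : ∀ lam, 0 < lam → scaledMat p γ κ lam ∈ 𝒟)
    (h00 : κ / p.q₁ - 1 < 0 ∧ D 0 0 = 0 ∨ κ / p.q₁ - 1 = 0 ∧ D 0 0 = p.B⁻¹ 0 0 ∨
      p.B⁻¹ 0 0 = 0 ∧ D 0 0 = 0)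
    (h01 : κ / p.q₂ - 1 < 0 ∧ D 0 1 = 0 ∨ κ / p.q₂ - 1 = 0 ∧ D 0 1 = p.B⁻¹ 0 1 ∨
      p.B⁻¹ 0 1 = 0 ∧ D 0 1 = 0)
    (h10 : κ / p.q₁ - γ < 0 ∧ D 1 0 = 0 ∨ κ / p.q₁ - γ = 0 ∧ D 1 0 = p.B⁻¹ 1 0 ∨
      p.B⁻¹ 1 0 = 0 ∧ D 1 0 = 0)
    (h11 : κ / p.q₂ - γ < 0 ∧ D 1 1 = 0 ∨ κ / p.q₂ - γ = 0 ∧ D 1 1 = p.B⁻¹ 1 1 ∨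
      p.B⁻¹ 1 1 = 0 ∧ D 1 1 = 0) : IsScaling p γ κ 𝒟 D where
  γ_pos := hγ
  κ_pos := hκ
  far := h𝒟
  limit_mem := hD
  scaled_mem lam hlam := hmem lam (one_pos.trans_le hlam)
  tendsto t := by
    have h := (((tendsto_mul_rpow_atTop h00).mul_const t.1).add
      ((tendsto_mul_rpow_atTop h01).mul_const t.2)).prodMk_nhds
      (((tendsto_mul_rpow_atTop h10).mul_const t.1).add
      ((tendsto_mul_rpow_atTop h11).mul_const t.2))
    refine h.congr' ?_
    filter_upwards [eventually_gt_atTop 0] with lam hlam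
    rw [scaledMat_eq p γ κ hlam]
    simp [act]

/-- The exponents satisfy `q₁ < q₂` and `Q̃₂ < 1`. -/
structure IsMixedRange (p : Params) : Prop where
  lt : p.q₁ < p.q₂
  Qtilde₂_lt : p.Qtilde₂ < 1

lemma IsMixedRange.snd (h : IsMixedRange p) : 1 / p.q₁ + 1 / (2 * p.q₂) < 1 := by
  have := h.Qtilde₂_lt
  rw [Qtilde₂, Q] at this
  have e : 1 / p.q₂ = 2 * (1 / (2 * p.q₂)) := by ring
  linarith

lemma IsMixedRange.fst (h : IsMixedRange p) (h₁ : 0 < p.q₁) : 1 / (2 * p.q₁) + 1 / p.q₂ < 1 := by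
  have h1 := h.snd
  have h2 : 1 / p.q₂ < 1 / p.q₁ := one_div_lt_one_div_of_lt h₁ h.lt
  have e : 1 / (2 * p.q₂) = 1 / p.q₂ / 2 := by ring
  have e' : 1 / (2 * p.q₁) = 1 / p.q₁ / 2 := by ring
  linarith

lemma IsCoefficient.inv_zero_zero_ne (hb : IsCoefficient p b) (h : p.B 1 1 ≠ 0) :
    p.B⁻¹ 0 0 ≠ 0 := by
  rw [inv_fin_two]
  simpa using ⟨hb.det_ne_zero, h⟩

lemma IsCoefficient.inv_one_zero_ne (hb : IsCoefficient p b) (h : p.B 1 0 ≠ 0) :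
    p.B⁻¹ 1 0 ≠ 0 := by
  rw [inv_fin_two]
  simpa using ⟨hb.det_ne_zero, h⟩

lemma IsCoefficient.inv_one_one_ne (hb : IsCoefficient p b) (h : p.B 0 0 ≠ 0) :
    p.B⁻¹ 1 1 ≠ 0 := by
  rw [inv_fin_two]
  simpa using ⟨hb.det_ne_zero, h⟩

lemma IsCoefficient.diag_ne_zero (hb : IsCoefficient p b) (h : p.B 1 0 = 0) :
    p.B 0 0 ≠ 0 ∧ p.B 1 1 ≠ 0 := by
  have := hb.det_ne_zero
  rw [Matrix.det_fin_two, h, mul_zero, sub_zero] at this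
  exact mul_ne_zero_iff.1 this

lemma scaledMat_apply_zero_zero (h₁ : 0 < p.q₁) (γ : ℝ) {lam : ℝ} (hlam : 0 < lam) :
    scaledMat p γ p.q₁ lam 0 0 = p.B⁻¹ 0 0 := by
  rw [scaledMat_eq p _ _ hlam, div_self h₁.ne']
  simp

/-- Dominance of the first coordinate of `t` in the first direction. -/
lemma isScaling_fst (hb : IsCoefficient p b) (hr : IsMixedRange p) {γ : ℝ}
    (hγ : p.q₁ / p.q₂ ≤ γ) (h11 : p.B 1 1 ≠ 0) {D : Matrix (Fin 2) (Fin 2) ℝ}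
    (d00 : D 0 0 = p.B⁻¹ 0 0) (d01 : D 0 1 = 0)
    (d10 : 1 < γ ∧ D 1 0 = 0 ∨ γ = 1 ∧ D 1 0 = p.B⁻¹ 1 0 ∨ p.B⁻¹ 1 0 = 0 ∧ D 1 0 = 0)
    (d11 : p.q₁ / p.q₂ < γ ∧ D 1 1 = 0 ∨ p.q₁ / p.q₂ = γ ∧ D 1 1 = p.B⁻¹ 1 1) :
    IsScaling p γ p.q₁ {D | D 0 0 = p.B⁻¹ 0 0} D := by
  have h₁ := hb.q₁_pos
  have h₂ := hb.q₂_pos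
  have hlt : p.q₁ / p.q₂ < 1 := (div_lt_one h₂).2 hr.lt
  refine isScaling_of_entries ((div_pos h₁ h₂).trans_le hγ) h₁
    (farControl_fst h₁ h₂ (hr.fst h₁) 0 (hb.inv_zero_zero_ne h11)) d00
    (fun lam hlam => scaledMat_apply_zero_zero h₁ γ hlam) ?_ ?_ ?_ ?_
  · exact Or.inr (Or.inl ⟨by rw [div_self h₁.ne', sub_self], d00⟩)
  · exact Or.inl ⟨by linarith, d01⟩
  · rw [div_self h₁.ne']
    rcases d10 with h | h | h
    · exact Or.inl ⟨by linarith, h.2⟩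
    · exact Or.inr (Or.inl ⟨by linarith, h.2⟩)
    · exact Or.inr (Or.inr h)
  · rcases d11 with h | h
    · exact Or.inl ⟨by linarith, h.2⟩
    · exact Or.inr (Or.inl ⟨by linarith, h.2⟩)

/-- With `κ = q₁` the lower left entry scales as `λ^(1-γ)`, so either `γ > 1` or `b₂₁ = 0` is needed
for it to disappear. -/
lemma isScaling_B11 (hb : IsCoefficient p b) (hr : IsMixedRange p) {γ : ℝ}
    (h11 : p.B 1 1 ≠ 0) (hγ : p.q₁ / p.q₂ < γ) (h : 1 < γ ∨ p.B 1 0 = 0) :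
    IsScaling p γ p.q₁ {D | D 0 0 = p.B⁻¹ 0 0} (B11 p.B) := by
  refine isScaling_fst hb hr hγ.le h11 ?_ ?_ ?_ (Or.inl ⟨hγ, ?_⟩)
  · simp [B11, inv_fin_two]
  · simp [B11]
  · rcases h with h | h
    · exact Or.inl ⟨h, by simp [B11]⟩
    · exact Or.inr (Or.inr ⟨by simp [inv_fin_two, h], by simp [B11]⟩)
  · simp [B11]

lemma isScaling_B01 (hb : IsCoefficient p b) (hr : IsMixedRange p) (h11 : p.B 1 1 ≠ 0) :
    IsScaling p 1 p.q₁ {D | D 0 0 = p.B⁻¹ 0 0} (B01 p.B) := by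
  have hlt : p.q₁ / p.q₂ < 1 := (div_lt_one hb.q₂_pos).2 hr.lt
  refine isScaling_fst hb hr hlt.le h11 ?_ ?_ (Or.inr (Or.inl ⟨rfl, ?_⟩)) (Or.inl ⟨hlt, ?_⟩)
  · simp [B01, inv_fin_two]
  · simp [B01]
  · simp [B01, inv_fin_two]
  · simp [B01]

lemma isScaling_diag (hb : IsCoefficient p b) (hr : IsMixedRange p) (h : p.B 1 0 = 0) :
    IsScaling p (p.q₁ / p.q₂) p.q₁ {D | D 0 0 = p.B⁻¹ 0 0}
      !![p.B⁻¹ 0 0, 0; 0, p.B⁻¹ 1 1] := by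
  refine isScaling_fst hb hr le_rfl (hb.diag_ne_zero h).2 (by simp) (by simp)
    (Or.inr (Or.inr ⟨by simp [inv_fin_two, h], by simp⟩)) (Or.inr ⟨rfl, by simp⟩)

/-- The choice `κ = γ q₁` freezes the lower left entry. The first row has exponents `γ - 1` and `γ
q₁/q₂ - 1`, and the last entry `γ q₁/q₂ - γ`, all negative. -/
lemma isScaling_B21 (hb : IsCoefficient p b) (hr : IsMixedRange p) {γ : ℝ} (h10 : p.B 1 0 ≠ 0)
    (hγ : 0 < γ) (hγ1 : γ < 1) :
    IsScaling p γ (γ * p.q₁) {D | D 1 0 = p.B⁻¹ 1 0} (B21 p.B) := by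
  have h₁ := hb.q₁_pos
  have h₂ := hb.q₂_pos
  have hlt : p.q₁ / p.q₂ < 1 := (div_lt_one h₂).2 hr.lt
  have e1 : γ * p.q₁ / p.q₁ = γ := mul_div_cancel_right₀ _ h₁.ne'
  have e2 : γ * p.q₁ / p.q₂ < γ := by
    rw [mul_div_assoc]; exact mul_lt_of_lt_one_right hγ hlt
  refine isScaling_of_entries hγ (by positivity)
    (farControl_fst h₁ h₂ (hr.fst h₁) 1 (hb.inv_one_zero_ne h10)) ?_ (fun lam hlam => ?_)
    (Or.inl ⟨by linarith, by simp [B21]⟩) (Or.inl ⟨by linarith, by simp [B21]⟩)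
    (Or.inr (Or.inl ⟨by linarith, by simp [B21, inv_fin_two]⟩))
    (Or.inl ⟨by linarith, by simp [B21]⟩)
  · simp [B21, inv_fin_two]
  · rw [Set.mem_ofPred_eq, scaledMat_eq p _ _ hlam, e1]
    simp

/-- The choice `κ = γ q₂` freezes the lower right entry. The lower left exponent `γ q₂/q₁ - γ` is
positive, so that entry must vanish, which is where `b₂₁ = 0` enters; `γ < q₁/q₂` handles the upper
left one. -/
lemma isScaling_B22 (hb : IsCoefficient p b) (hr : IsMixedRange p) {γ : ℝ} (h10 : p.B 1 0 = 0)
    (hγ : 0 < γ) (hγ1 : γ < p.q₁ / p.q₂) :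
    IsScaling p γ (γ * p.q₂) {D | D 1 1 = p.B⁻¹ 1 1} (B22 p.B) := by
  have h₁ := hb.q₁_pos
  have h₂ := hb.q₂_pos
  have hlt : p.q₁ / p.q₂ < 1 := (div_lt_one h₂).2 hr.lt
  have e1 : γ * p.q₂ / p.q₂ = γ := mul_div_cancel_right₀ _ h₂.ne'
  have e2 : γ * p.q₂ / p.q₁ < 1 := by
    rw [div_lt_one h₁]; exact (lt_div_iff₀ h₂).1 hγ1
  refine isScaling_of_entries hγ (by positivity)
    (farControl_snd h₁ h₂ hr.snd 1 (hb.inv_one_one_ne (hb.diag_ne_zero h10).1)) ?_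
    (fun lam hlam => ?_)
    (Or.inl ⟨by linarith, by simp [B22]⟩) (Or.inl ⟨by linarith, by simp [B22]⟩)
    (Or.inr (Or.inr ⟨by simp [inv_fin_two, h10], by simp [B22]⟩))
    (Or.inr (Or.inl ⟨by linarith, by simp [B22, inv_fin_two]⟩))
  · simp [B22, inv_fin_two]
  · rw [Set.mem_ofPred_eq, scaledMat_eq p _ _ hlam, e1]
    simp

/-! ### The field at the congruous transition point -/

section Vtilde

/-- The change of variables relating the inner integrals of `Ṽ_D` and `V_{D⁻¹}`. -/
lemma innerV_inv_eq (p : Params) {D : Matrix (Fin 2) (Fin 2) ℝ} (hD : D.det ≠ 0)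
    (x u : ℝ × ℝ) (t : ℝ × ℝ) : (rect x).indicator (fun t => p.aInf (act D t - u)) t =
      innerV p D⁻¹ x (act D⁻¹ u) (act D t - u) := by
  have h : act D⁻¹ (act D t - u) + act D⁻¹ u = t := by
    rw [← act_add, sub_add_cancel, act_inv_act hD]
  by_cases ht : t ∈ rect x
  · rw [innerV, Set.indicator_of_mem ht, Set.indicator_of_mem (by rwa [Set.mem_ofPred_eq, h])]
  · rw [innerV, Set.indicator_of_notMem ht,
      Set.indicator_of_notMem (by rwa [Set.mem_ofPred_eq, h])]

lemma kernelVtilde_eq (p : Params) {D : Matrix (Fin 2) (Fin 2) ℝ} (hD : D.det ≠ 0)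
    (hdet : D.det = p.B.det) (x u : ℝ × ℝ) : kernelVtilde p D x u =
      |p.B.det| ^ (-(1 / 2) : ℝ) * kernelV p D⁻¹ x (act D⁻¹ u) := by
  rw [kernelVtilde, kernelV, ← integral_indicator (measurableSet_rect x)]
  simp only [innerV_inv_eq p hD]
  rw [integral_act hD (fun t => innerV p D⁻¹ x (act D⁻¹ u) (t - u)), integral_sub_right_eq_self,
    hdet]

lemma FarControl.wellDefinedVtilde {𝒟 : Set (Matrix (Fin 2) (Fin 2) ℝ)} (h : FarControl p 𝒟)
    (hb : IsCoefficient p b) {D : Matrix (Fin 2) (Fin 2) ℝ} (hD : D.det ≠ 0)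
    (hdet : D.det = p.B.det) (hmem : D⁻¹ ∈ 𝒟) : WellDefinedVtilde p D := by
  have hD' : D⁻¹.det ≠ 0 := by
    rw [Matrix.det_nonsing_inv]
    simpa using hD
  refine fun x _ => ⟨Eventually.of_forall fun u => ?_, ?_⟩
  · rw [← integrable_indicator_iff (measurableSet_rect x)]
    have h1 := (h.integrable_innerV hb hmem x (act D⁻¹ u)).comp_sub_right u
    refine ((integrable_act_iff hD).2 h1).congr (Eventually.of_forall fun t => ?_)
    exact (innerV_inv_eq p hD x u t).symm
  · have h1 := (memLp_act hD' (h.memLp_kernelV hb hmem x)).const_mul (|p.B.det| ^ (-(1 / 2) : ℝ))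
    refine (memLp_congr_ae (Eventually.of_forall fun u => ?_)).1 h1
    exact (kernelVtilde_eq p hD hdet x u).symm

/-- The kernels agree up to the substitution `u ↦ D⁻¹ u` and a factor `|det B|^(-1/2)`, whose square
cancels the Jacobian. The two fields thus have equal covariances, though their kernels differ. -/
lemma integral_sum_kernelVtilde_sq (p : Params) {D : Matrix (Fin 2) (Fin 2) ℝ} (hD : D.det ≠ 0)
    (hdet : D.det = p.B.det) {n : ℕ} (x : Fin n → ℝ × ℝ) (θ : Fin n → ℝ) :
    ∫ u, (∑ j, θ j * kernelVtilde p D (x j) u) ^ 2 =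
      ∫ u, (∑ j, θ j * kernelV p D⁻¹ (x j) u) ^ 2 := by
  have hD' : D⁻¹.det ≠ 0 := by
    rw [Matrix.det_nonsing_inv]
    simpa using hD
  have hpos : 0 < |p.B.det| := by rw [← hdet]; positivity
  have h1 : ∀ u, (∑ j, θ j * kernelVtilde p D (x j) u) ^ 2 =
      |p.B.det|⁻¹ * (fun v => (∑ j, θ j * kernelV p D⁻¹ (x j) v) ^ 2) (act D⁻¹ u) := fun u => by
    have h2 : ∑ j, θ j * kernelVtilde p D (x j) u =
        |p.B.det| ^ (-(1 / 2) : ℝ) * ∑ j, θ j * kernelV p D⁻¹ (x j) (act D⁻¹ u) := by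
      rw [Finset.mul_sum]
      exact Finset.sum_congr rfl fun j _ => by rw [kernelVtilde_eq p hD hdet]; ring
    rw [h2, mul_pow, ← Real.rpow_natCast, ← Real.rpow_mul hpos.le]
    norm_num [Real.rpow_neg_one]
  simp only [h1]
  rw [integral_const_mul, integral_act hD' (fun v => (∑ j, θ j * kernelV p D⁻¹ (x j) v) ^ 2),
    Matrix.det_nonsing_inv, Ring.inverse_eq_inv', abs_inv, inv_inv, hdet,
    inv_mul_cancel_left₀ hpos.ne']

lemma det_Btilde00 {B : Matrix (Fin 2) (Fin 2) ℝ} (h : B 1 0 = 0) : (Btilde00 B).det = B.det := by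
  rw [Btilde00, Matrix.det_fin_two_of, Matrix.det_fin_two, h]
  ring

lemma inv_Btilde00 {B : Matrix (Fin 2) (Fin 2) ℝ} (h : B 1 0 = 0) :
    (Btilde00 B)⁻¹ = !![B⁻¹ 0 0, 0; 0, B⁻¹ 1 1] := by
  rw [inv_fin_two, det_Btilde00 h, inv_fin_two B]
  ext i j
  fin_cases i <;> fin_cases j <;> simp [Btilde00]

end Vtilde

end Regimes

/-! ### The fractional Brownian sheet -/

section Sheet

open Params

variable {p : Params} {b : ℤ × ℤ → ℝ} {d : ℝ}

/-- The factor of the kernel of `V₂₂` depending on the second coordinate. -/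
def sndKernel (p : Params) (d z s : ℝ) : ℝ :=
  |p.B.det|⁻¹ * ∫ t, {t : ℝ × ℝ | d * t.2 + s ∈ Set.Ioc 0 z}.indicator p.aInf t

lemma kernelV_diag_eq (p : Params) (d : ℝ) (x u : ℝ × ℝ) : kernelV p !![0, 0; 0, d] x u =
    (Set.Ioc 0 x.1).indicator (fun _ => (1 : ℝ)) u.1 * sndKernel p d x.2 u.2 := by
  by_cases h : u.1 ∈ Set.Ioc 0 x.1
  · have e : {t : ℝ × ℝ | act !![0, 0; 0, d] t + u ∈ rect x} =
        {t : ℝ × ℝ | d * t.2 + u.2 ∈ Set.Ioc 0 x.2} := by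
      ext t
      simp only [rect, act, Set.mem_ofPred_eq, Set.mem_prod]
      simpa using fun _ _ => h
    rw [Set.indicator_of_mem h, one_mul, kernelV, sndKernel]
    simp only [innerV, e]
  · have e : {t : ℝ × ℝ | act !![0, 0; 0, d] t + u ∈ rect x} = ∅ := by
      ext t
      simp only [rect, act, Set.mem_ofPred_eq, Set.mem_prod, Set.mem_empty_iff_false, iff_false]
      intro h'
      exact h (by simpa using h'.1)
    rw [Set.indicator_of_notMem h, kernelV]
    simp [innerV, e]

lemma integrable_sndInner {𝒟 : Set (Matrix (Fin 2) (Fin 2) ℝ)} (hf : FarControl p 𝒟)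
    (hb : IsCoefficient p b) (hd : !![0, 0; 0, d] ∈ 𝒟) (z s : ℝ) :
    Integrable ({t : ℝ × ℝ | d * t.2 + s ∈ Set.Ioc 0 z}.indicator p.aInf) := by
  have h := hf.integrable_innerV hb hd (1, z) (1, s)
  have e : {t : ℝ × ℝ | act !![0, 0; 0, d] t + (1, s) ∈ rect (1, z)} =
      {t : ℝ × ℝ | d * t.2 + s ∈ Set.Ioc 0 z} := by
    ext t
    simp [rect, act]
  rwa [innerV, e] at h

/-- Stationarity of increments: removing `(0, z]` from `(0, w]` leaves `(z, w]`, a translate of `(0,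
w - z]`. -/
lemma sndKernel_sub {𝒟 : Set (Matrix (Fin 2) (Fin 2) ℝ)} (hf : FarControl p 𝒟)
    (hb : IsCoefficient p b) (hd : !![0, 0; 0, d] ∈ 𝒟) {z w : ℝ} (hz : 0 ≤ z) (hzw : z ≤ w)
    (s : ℝ) : sndKernel p d w s - sndKernel p d z s = sndKernel p d (w - z) (s - z) := by
  rw [sndKernel, sndKernel, sndKernel, ← mul_sub,
    ← integral_sub (integrable_sndInner hf hb hd w s) (integrable_sndInner hf hb hd z s)]
  congr 2
  funext t
  have e : ∀ r z : ℝ, {t : ℝ × ℝ | d * t.2 + r ∈ Set.Ioc 0 z}.indicator p.aInf t =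
      (Set.Ioc 0 z).indicator (fun _ => p.aInf t) (d * t.2 + r) := fun r z => rfl
  rw [e, e, e]
  simp only [Set.indicator_apply, Set.mem_Ioc]
  split_ifs <;> first | (simp; done) | (exfalso; grind)

lemma integral_dil (p : Params) {μ : ℝ} (hμ : 0 < μ) (f : ℝ × ℝ → ℝ) :
    ∫ t, f t = μ ^ p.Q * ∫ t, f (p.dil μ t) := by
  have hdet : (!![μ ^ (1 / p.q₁), 0; 0, μ ^ (1 / p.q₂)] : Matrix (Fin 2) (Fin 2) ℝ).det =
      μ ^ p.Q := by
    rw [Matrix.det_fin_two_of, Q, Real.rpow_add hμ]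
    ring
  have hQ : 0 < μ ^ p.Q := Real.rpow_pos_of_pos hμ _
  have h := integral_act (D := !![μ ^ (1 / p.q₁), 0; 0, μ ^ (1 / p.q₂)])
    (by rw [hdet]; exact hQ.ne') f
  rw [hdet, abs_of_pos hQ] at h
  have e : ∀ t, act !![μ ^ (1 / p.q₁), 0; 0, μ ^ (1 / p.q₂)] t = p.dil μ t := fun t => by
    simp [act, dil]
  simp only [e] at h
  rw [h, mul_inv_cancel_left₀ hQ.ne']

/-- Self-similarity: dilation by `μ = c^q₂` multiplies the second coordinate by `c`, has Jacobian
`μ^Q`, and multiplies `a_∞` by `μ⁻¹`. -/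
lemma sndKernel_smul (h₁ : 0 < p.q₁) (h₂ : 0 < p.q₂) {c : ℝ} (hc : 0 < c) (z s : ℝ) :
    sndKernel p d (c * z) (c * s) = c ^ (p.q₂ * (p.Q - 1)) * sndKernel p d z s := by
  have hμ : 0 < c ^ p.q₂ := Real.rpow_pos_of_pos hc _
  have e2 : (c ^ p.q₂) ^ (1 / p.q₂) = c := by
    rw [← Real.rpow_mul hc.le, mul_one_div_cancel h₂.ne', Real.rpow_one]
  have e : ∀ t, {t : ℝ × ℝ | d * t.2 + c * s ∈ Set.Ioc 0 (c * z)}.indicator p.aInf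
      (p.dil (c ^ p.q₂) t) =
      (c ^ p.q₂)⁻¹ * {t : ℝ × ℝ | d * t.2 + s ∈ Set.Ioc 0 z}.indicator p.aInf t := fun t => by
    have hiff : p.dil (c ^ p.q₂) t ∈ {t : ℝ × ℝ | d * t.2 + c * s ∈ Set.Ioc 0 (c * z)} ↔
        t ∈ {t : ℝ × ℝ | d * t.2 + s ∈ Set.Ioc 0 z} := by
      have e3 : d * (c * t.2) + c * s = c * (d * t.2 + s) := by ring
      simp only [Set.mem_ofPred_eq, dil, e2, e3, Set.mem_Ioc]
      rw [mul_pos_iff_of_pos_left hc, mul_le_mul_iff_right₀ hc]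
    by_cases h : t ∈ {t : ℝ × ℝ | d * t.2 + s ∈ Set.Ioc 0 z}
    · rw [Set.indicator_of_mem (hiff.2 h), Set.indicator_of_mem h, aInf_dil h₁ h₂ hμ]
    · rw [Set.indicator_of_notMem (fun h' => h (hiff.1 h')), Set.indicator_of_notMem h, mul_zero]
  rw [sndKernel, sndKernel, integral_dil p hμ]
  simp only [e]
  rw [integral_const_mul, Real.rpow_mul hc.le, Real.rpow_sub hμ, Real.rpow_one]
  ring

lemma integral_sndKernel_sq (h₁ : 0 < p.q₁) (h₂ : 0 < p.q₂) {z : ℝ} (hz : 0 < z) :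
    ∫ s, sndKernel p d z s ^ 2 = z ^ (2 * p.H₂) * ∫ s, sndKernel p d 1 s ^ 2 := by
  have h := Measure.integral_comp_mul_left (fun s => sndKernel p d z s ^ 2) z
  have e : ∀ s, sndKernel p d z (z * s) = z ^ (p.q₂ * (p.Q - 1)) * sndKernel p d 1 s := fun s => by
    have := sndKernel_smul (d := d) h₁ h₂ hz 1 s
    rwa [mul_one] at this
  simp only [e, mul_pow] at h
  rw [integral_const_mul, abs_of_pos (inv_pos.2 hz), smul_eq_mul, eq_inv_mul_iff_mul_eq₀ hz.ne',
    ← mul_assoc] at h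
  rw [← h, ← Real.rpow_natCast (z ^ _), ← Real.rpow_mul hz.le, H₂,
    show 2 * (1 / 2 + p.q₂ * (p.Q - 1)) = 1 + p.q₂ * (p.Q - 1) * ((2 : ℕ) : ℝ) by
      push_cast; ring, Real.rpow_add hz, Real.rpow_one]

lemma memLp_sndKernel {𝒟 : Set (Matrix (Fin 2) (Fin 2) ℝ)} (hf : FarControl p 𝒟)
    (hb : IsCoefficient p b) (hd : !![0, 0; 0, d] ∈ 𝒟) (z : ℝ) :
    MemLp (sndKernel p d z) 2 (volume : Measure ℝ) := by
  have hm : Measurable (sndKernel p d z) := by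
    have h1 : Measurable fun s : ℝ => ((1 : ℝ), s) := by fun_prop
    have h2 := (measurable_kernelV hb !![0, 0; 0, d] (1, z)).comp h1
    have e : kernelV p !![0, 0; 0, d] (1, z) ∘ (fun s : ℝ => ((1 : ℝ), s)) = sndKernel p d z := by
      funext s
      simp [kernelV_diag_eq]
    rwa [e] at h2
  refine (memLp_two_iff_integrable_sq hm.aestronglyMeasurable).2 ?_
  have h := (hf.memLp_kernelV hb hd (1, z)).integrable_sq
  rw [Measure.volume_eq_prod] at h
  -- The two-dimensional kernel is square integrable, hence so is almost every slice; a slice over a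
  -- point of `(0, 1]` is the one-dimensional kernel.
  have h1 := h.prod_right_ae
  have h2 : (volume : Measure ℝ) (Set.Ioc (0 : ℝ) 1) ≠ 0 := by simp
  obtain ⟨r, hr, hr'⟩ := ((frequently_ae_mem_iff.2 h2).and_eventually h1).exists
  refine hr'.congr (Eventually.of_forall fun s => ?_)
  simp only [kernelV_diag_eq, Set.indicator_of_mem hr, one_mul]

/-- Polarisation: the product is recovered from the squares of the two kernels and of their
increment, all known by self-similarity and stationarity. -/
lemma integral_sndKernel_mul {𝒟 : Set (Matrix (Fin 2) (Fin 2) ℝ)} (hf : FarControl p 𝒟)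
    (hb : IsCoefficient p b) (hd : !![0, 0; 0, d] ∈ 𝒟) {z w : ℝ} (hz : 0 < z) (hw : 0 < w) :
    ∫ s, sndKernel p d z s * sndKernel p d w s =
      1 / 2 * (z ^ (2 * p.H₂) + w ^ (2 * p.H₂) - |z - w| ^ (2 * p.H₂)) *
        ∫ s, sndKernel p d 1 s ^ 2 := by
  wlog hzw : z ≤ w generalizing z w
  · have := this hw hz (le_of_not_ge hzw)
    rw [abs_sub_comm, add_comm (w ^ _)] at this
    rw [← this]
    simp only [mul_comm]
  have h₁ := hb.q₁_pos
  have h₂ := hb.q₂_pos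
  have hH : 0 < p.H₂ := by
    have := hb.one_lt_Q
    have : 0 < p.q₂ * (p.Q - 1) := mul_pos h₂ (by linarith)
    rw [H₂]; linarith
  have hL := memLp_sndKernel hf hb hd
  have hsub : ∫ s, (sndKernel p d w s - sndKernel p d z s) ^ 2 =
      |z - w| ^ (2 * p.H₂) * ∫ s, sndKernel p d 1 s ^ 2 := by
    rcases hzw.eq_or_lt with rfl | hlt
    · simp [hH.ne']
    · simp only [sndKernel_sub hf hb hd hz.le hzw]
      rw [integral_sub_right_eq_self (fun s => sndKernel p d (w - z) s ^ 2),
        integral_sndKernel_sq h₁ h₂ (sub_pos.2 hlt), abs_sub_comm, abs_of_pos (sub_pos.2 hlt)]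
  have e : ∀ s, (sndKernel p d w s - sndKernel p d z s) ^ 2 =
      sndKernel p d w s ^ 2 + sndKernel p d z s ^ 2 -
        2 * (sndKernel p d z s * sndKernel p d w s) := fun s => by ring
  have i1 := (hL w).integrable_sq
  have i2 := (hL z).integrable_sq
  have i3 : Integrable fun s => sndKernel p d z s * sndKernel p d w s :=
    (hL z).integrable_mul (hL w)
  simp only [e] at hsub
  rw [integral_sub (by exact i1.add i2) (i3.const_mul 2), integral_add i1 i2, integral_const_mul,
    integral_sndKernel_sq h₁ h₂ hw, integral_sndKernel_sq h₁ h₂ hz] at hsub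
  linarith

lemma integral_kernelV_diag_mul {𝒟 : Set (Matrix (Fin 2) (Fin 2) ℝ)} (hf : FarControl p 𝒟)
    (hb : IsCoefficient p b) (hd : !![0, 0; 0, d] ∈ 𝒟) {x y : ℝ × ℝ} (hx : x ∈ quadrant)
    (hy : y ∈ quadrant) :
    ∫ u, kernelV p !![0, 0; 0, d] x u * kernelV p !![0, 0; 0, d] y u =
      (∫ s, sndKernel p d 1 s ^ 2) * fbsCov (1 / 2) p.H₂ x y := by
  have e : ∀ u : ℝ × ℝ, kernelV p !![0, 0; 0, d] x u * kernelV p !![0, 0; 0, d] y u =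
      (Set.Ioc 0 (min x.1 y.1)).indicator (fun _ => (1 : ℝ)) u.1 *
        (sndKernel p d x.2 u.2 * sndKernel p d y.2 u.2) := fun u => by
    rw [kernelV_diag_eq, kernelV_diag_eq]
    simp only [Set.indicator_apply, Set.mem_Ioc, le_min_iff]
    split_ifs <;> first | (simp; done) | (exfalso; tauto)
  simp only [e]
  rw [Measure.volume_eq_prod, integral_prod_mul
    (fun r => (Set.Ioc 0 (min x.1 y.1)).indicator (fun _ => (1 : ℝ)) r)
    (fun s => sndKernel p d x.2 s * sndKernel p d y.2 s),
    integral_sndKernel_mul hf hb hd hx.2 hy.2, integral_indicator measurableSet_Ioc]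
  have hmin : (0 : ℝ) ≤ min x.1 y.1 := le_min hx.1.le hy.1.le
  simp only [integral_const, MeasurableSet.univ, measureReal_restrict_apply, Set.univ_inter,
    Real.volume_real_Ioc_of_le hmin, smul_eq_mul, mul_one, sub_zero]
  -- The indicator factor gives the covariance of Brownian motion, which is the fractional
  -- covariance at `h₁ = 1/2`.
  have hhalf : min x.1 y.1 = 1 / 2 * (x.1 + y.1 - |x.1 - y.1|) := by
    rcases le_total x.1 y.1 with h | h
    · rw [min_eq_left h, abs_of_nonpos (sub_nonpos.2 h)]; ring
    · rw [min_eq_right h, abs_of_nonneg (sub_nonneg.2 h)]; ring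
  rw [hhalf, fbsCov, mul_one_div_cancel two_ne_zero, Real.rpow_one, Real.rpow_one, Real.rpow_one]
  ring

variable {Ω' : Type*} [MeasurableSpace Ω'] {P' : Measure Ω'}

lemma fbsCov_one_one (h₁ h₂ : ℝ) (hh₁ : 0 < h₁) (hh₂ : 0 < h₂) : fbsCov h₁ h₂ (1, 1) (1, 1) = 1 := by
  have e1 : (0 : ℝ) ^ (2 * h₁) = 0 := Real.zero_rpow (by positivity)
  have e2 : (0 : ℝ) ^ (2 * h₂) = 0 := Real.zero_rpow (by positivity)
  simp only [fbsCov, Real.one_rpow, sub_self, abs_zero, e1, e2]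
  norm_num

/-- The limit in the direction of the second axis is a multiple of a fractional Brownian sheet. -/
lemma hasScaledFBSLaw_diag (W : WhiteNoise P') {𝒟 : Set (Matrix (Fin 2) (Fin 2) ℝ)}
    (hf : FarControl p 𝒟) (hb : IsCoefficient p b) (hd : !![0, 0; 0, d] ∈ 𝒟) :
    HasScaledFBSLaw P' (fieldV W p !![0, 0; 0, d])
      (Real.sqrt (∫ ω, fieldV W p !![0, 0; 0, d] (1, 1) ω ^ 2 ∂P')) (1 / 2) p.H₂ := by
  have hL := hf.memLp_kernelV hb hd
  have hH : 0 < p.H₂ := by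
    have := hb.one_lt_Q
    have : 0 < p.q₂ * (p.Q - 1) := mul_pos hb.q₂_pos (by linarith)
    rw [H₂]; linarith
  have hcov : ∀ x ∈ quadrant, ∀ y ∈ quadrant, ∫ ω, fieldV W p !![0, 0; 0, d] x ω *
      fieldV W p !![0, 0; 0, d] y ω ∂P' =
      (∫ s, sndKernel p d 1 s ^ 2) * fbsCov (1 / 2) p.H₂ x y := fun x hx y hy => by
    rw [← integral_kernelV_diag_mul hf hb hd hx hy]
    exact W.integral_mul (hL x) (hL y)
  have h11 : ((1, 1) : ℝ × ℝ) ∈ quadrant := ⟨one_pos, one_pos⟩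
  refine ⟨W.gaussian_family fun x => hL x, fun x _ => ?_, fun x hx y hy => ?_⟩
  · rw [fieldV, (W.hasLaw_integral (hL x)).integral_eq]
    simp
  · rw [Real.sq_sqrt (integral_nonneg fun ω => sq_nonneg _), hcov x hx y hy]
    simp only [pow_two (fieldV W p !![0, 0; 0, d] (1, 1) _)]
    -- The sheet has unit variance at `(1, 1)`, so the constant in the covariance is `σ²`.
    rw [hcov _ h11 _ h11, fbsCov_one_one _ _ (by norm_num) hH, mul_one]

lemma B22_eq (B : Matrix (Fin 2) (Fin 2) ℝ) : B22 B = !![0, 0; 0, B.det⁻¹ * B 0 0] := by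
  ext i j
  fin_cases i <;> fin_cases j <;> simp [B22]

lemma IsScaling.wellDefinedV {γ κ : ℝ} {𝒟 : Set (Matrix (Fin 2) (Fin 2) ℝ)}
    {D : Matrix (Fin 2) (Fin 2) ℝ} (h : IsScaling p γ κ 𝒟 D) (hb : IsCoefficient p b) :
    WellDefinedV p D :=
  h.far.wellDefinedV hb h.limit_mem

end Sheet

end LinearField

end

open LinearField in
theorem theorem3 {Ω Ω' : Type*} [MeasurableSpace Ω] [MeasurableSpace Ω']
    (P : Measure Ω) [IsProbabilityMeasure P] (P' : Measure Ω') [IsProbabilityMeasure P']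
    (p : Params) (b : ℤ × ℤ → ℝ) (hb : IsCoefficient p b)
    (ε : ℤ × ℤ → Ω → ℝ) (hε : IsInnovation ε P)
    (W : WhiteNoise P')
    (hq : p.q₁ < p.q₂) (hQ : p.Qtilde₂ < 1) :
    -- the linear field exists
    (∃ X, IsLinearField b ε P X) ∧
    -- incongruous scaling, critical point `1`
    (p.B 1 0 * p.B 1 1 ≠ 0 →
      WellDefinedV p (B11 p.B) ∧ WellDefinedV p (B21 p.B) ∧ WellDefinedV p (B01 p.B) ∧
      ∀ X, IsLinearField b ε P X →
        (∀ γ : ℝ, 1 < γ → ScalesTo P P' X γ (p.H₁ + γ / 2) (fieldV W p (B11 p.B))) ∧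
        (∀ γ : ℝ, 0 < γ → γ < 1 →
          ScalesTo P P' X γ (1 / 2 + γ * p.H₁) (fieldV W p (B21 p.B))) ∧
        ScalesTo P P' X 1 (p.H₁ + 1 / 2) (fieldV W p (B01 p.B))) ∧
    -- congruous scaling, critical point `q₁ / q₂`
    (p.B 1 0 = 0 →
      WellDefinedV p (B11 p.B) ∧ WellDefinedV p (B22 p.B) ∧
      WellDefinedVtilde p (Btilde00 p.B) ∧
      -- `V₂₂` has the law of a multiple of a fractional Brownian sheet
      HasScaledFBSLaw P' (fieldV W p (B22 p.B))
        (Real.sqrt (∫ ω, fieldV W p (B22 p.B) (1, 1) ω ^ 2 ∂P')) (1 / 2) p.H₂ ∧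
      ∀ X, IsLinearField b ε P X →
        (∀ γ : ℝ, p.q₁ / p.q₂ < γ →
          ScalesTo P P' X γ (p.H₁ + γ / 2) (fieldV W p (B11 p.B))) ∧
        (∀ γ : ℝ, 0 < γ → γ < p.q₁ / p.q₂ →
          ScalesTo P P' X γ (1 / 2 + γ * p.H₂) (fieldV W p (B22 p.B))) ∧
        ScalesTo P P' X (p.q₁ / p.q₂) (p.Htilde₁ + p.q₁ / p.q₂)
          (fieldVtilde W p (Btilde00 p.B))) := by
  have hr : IsMixedRange p := ⟨hq, hQ⟩
  have h₁ := hb.q₁_pos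
  have h₂ := hb.q₂_pos
  have hlt : p.q₁ / p.q₂ < 1 := (div_lt_one h₂).2 hq
  refine ⟨exists_isLinearField hε hb.summable_sq, fun h => ?_, fun h => ?_⟩
  · obtain ⟨h10, h11⟩ := mul_ne_zero_iff.1 h
    have hB11 := fun (γ : ℝ) (hγ : 1 < γ) =>
      isScaling_B11 hb hr h11 (hlt.trans hγ) (Or.inl hγ)
    have hB21 := fun (γ : ℝ) (hγ : 0 < γ) (hγ1 : γ < 1) => isScaling_B21 hb hr h10 hγ hγ1
    have hB01 := isScaling_B01 hb hr h11
    -- The limit fields do not depend on `γ` within a regime, so any admissible value, here `2` and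
    -- `1/2`, shows that they are well defined.
    refine ⟨(hB11 2 one_lt_two).wellDefinedV hb, (hB21 (1 / 2) (by norm_num)
      (by norm_num)).wellDefinedV hb, hB01.wellDefinedV hb, fun X hX =>
      ⟨fun γ hγ => (hB11 γ hγ).scalesTo hb hε W hX ?_,
      fun γ hγ hγ1 => (hB21 γ hγ hγ1).scalesTo hb hε W hX ?_, hB01.scalesTo hb hε W hX ?_⟩⟩
    · rw [Params.H₁]; ring
    · rw [Params.H₁]; ring
    · rw [Params.H₁]; ring
  · obtain ⟨h00, h11⟩ := hb.diag_ne_zero h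
    have hγ0 : 0 < p.q₁ / p.q₂ := div_pos h₁ h₂
    have hB11 := fun (γ : ℝ) (hγ : p.q₁ / p.q₂ < γ) => isScaling_B11 hb hr h11 hγ (Or.inr h)
    have hB22 := fun (γ : ℝ) (hγ : 0 < γ) (hγ1 : γ < p.q₁ / p.q₂) => isScaling_B22 hb hr h hγ hγ1
    have hdiag := isScaling_diag hb hr h
    -- As `b₂₁ = 0`, the limit matrix is the inverse of `B̃₀₀`, and `det B̃₀₀ = det B`, so the
    -- kernels of `Ṽ₀₀` can replace those of `V`.
    rw [← inv_Btilde00 h] at hdiag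
    have hdet := det_Btilde00 h
    have hdet0 : (Btilde00 p.B).det ≠ 0 := hdet ▸ hb.det_ne_zero
    have hV := hdiag.far.wellDefinedVtilde hb hdet0 hdet hdiag.limit_mem
    have hmid := hB22 _ (half_pos hγ0) (half_lt_self hγ0)
    refine ⟨(hB11 1 hlt).wellDefinedV hb, hmid.wellDefinedV hb, hV, ?_, fun X hX =>
      ⟨fun γ hγ => (hB11 γ hγ).scalesTo hb hε W hX ?_,
      fun γ hγ hγ1 => (hB22 γ hγ hγ1).scalesTo hb hε W hX ?_,
      hdiag.scalesTo_of_gram hb hε W hX ?_ (fun x hx => (hV x hx).2)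
        fun n x θ => integral_sum_kernelVtilde_sq p hdet0 hdet x θ⟩⟩
    · have hmem := hmid.limit_mem
      rw [B22_eq] at hmem ⊢
      exact hasScaledFBSLaw_diag W hmid.far hb hmem
    · rw [Params.H₁]; ring
    · rw [Params.H₂]; ring
    · rw [Params.Htilde₁, Params.Q]
      field_simp
      ring
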